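/- Let $k,m\ge 0$, $d=m+k$. Let $G$ be a connected abelian Lie group of dimension $k$ with Lie algebra $\mathfrak g$ and a fixed basis $(E_1,\dots,E_k)$, and let $\pi:\widetilde X\to X=\widetilde X/G$ be a smooth principal $G$-bundle with $\dim X=m+1=d-k+1$, trivialized over an open cover $\{U_i\}$ with local sections $\sigma_i$ and transition functions $\gamma_{ij}$, $\sigma_j=\gamma_{ij}\cdot\sigma_i$ on $U_i\cap U_j$. For $A\in\mathfrak g$ let $A^\#$ be its fundamental vector field on $\widetilde X$. Write $\eta=\mathrm{diag}(-1,1,\dots,1)$ and $\omega_{MC}$ for the Maurer–Cartan form of $G$. A coframe for an $\mathrm{SO}(1,n)$-structure is given by local $\mathbb R^{1,n}$-valued $1$-forms on an open cover which are smooth, pointwise isomorphisms, and related on overlaps by $\mathrm{SO}(1,n)$-valued functions. For a coframe $e$ and a vector field $\xi$, $L_\xi e$ is the naive Lie derivative of the local representatives, and the Kosmann Lie derivative is $(L^K_\xi e)^a=\eta^{ad}(L_\xi e)_{(db)}e^b$. A partially gauge-fixed $G$-invariant coframe on $\widetilde X$ (over an open cover $\{V_a\}$ of $X$) is a coframe $\hat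 e=(\hat e_H,\hat e_\theta)$ for an $\mathrm{SO}(1,d)$-structure, represented over the sets $\pi^{-1}(V_a)$, such that $L_{A^\#}\hat e=0$ for all $A\in\mathfrak g$; the first $m+1$ components $\hat e_H$ annihilate all $A^\#$; the last $k$ components $\hat e_\theta$ are globally defined $1$-forms; and, up to a pointwise rotation in $\mathrm{SO}(k)$, the vertical coframe $\hat e_\theta$ is the Gram–Schmidt orthonormalization of the vertical $1$-forms $\theta^1,\dots,\theta^k$ dual to $E_1^\#,\dots,E_k^\#$. The following hold. 1. Let $e$ be a coframe for an $\mathrm{SO}(1,d)$-structure on $\widetilde X$ with $L^K_{A^\#}e=0$ for all $A\in\mathfrak g$, such that $A^\#$ is spacelike for $\langle e,e\rangle$ everywhere, for all $A\neq 0$. Then $e$ is related by an $\mathrm{SO}(1,d)$-gauge transformation to a partially gauge-fixed $G$-invariant coframe $\hat e$ (over some cover of $X$). Conversely every partially gauge-fixed $G$-invariant coframe satisfies these hypotheses on $e$. 2. Every partially gauge-fixed $G$-invariant coframe $\hat e$ encodes a unique collection of the following fields on $X$, and every such collection is encoded by a unique partially gauge-fixed $G$-invariant coframe over the same cover: (i)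 a coframe $\hat e_h$ on $X$ for an $\mathrm{SO}(1,d-k)$-structure, with local representatives on $\{V_a\}$; (ii) local $G$-gauge fields $\theta_i\in\Omega^1(U_i;\mathfrak g)$ with $\theta_j=\theta_i+\gamma_{ij}^*\omega_{MC}$ on $U_i\cap U_j$; (iii) a smooth map $\Phi:X\to\mathfrak g^*\otimes\mathbb R^k$ whose matrix of components, with respect to the standard basis of $\mathbb R^k$ and any basis of $\mathfrak g$ with the same orientation as $(E_1,\dots,E_k)$, has positive determinant (for $k=1$: a positive function, the dilaton). Here "encodes" means: there is a connection $1$-form $\theta\in\Omega^1(\widetilde X;\mathfrak g)$ whose horizontal spaces are the orthogonal complements of the fibres for $\langle\hat e,\hat e\rangle$, with $\theta_i=\sigma_i^*\theta$ and $$\hat e=\big(\pi^*\hat e_h,\ (\Phi\circ\pi)\cdot\theta\big).$$ 3. For smooth $u:X\to G$, $\Lambda_a:V_a\to \mathrm{SO}(1,d-k)$ and $R:X\to\mathrm{SO}(k)$, pulling $\hat e$ back along the bundle automorphism $p\mapsto u(\pi(p))\cdot p$ and then acting with $(\Lambda_a\circ\pi, R\circ\pi)$ gives again a partially gauge-fixed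 $G$-invariant coframe, which encodes the fields $\Lambda\cdot\hat e_h$, $\theta_i+u^*\omega_{MC}$, $R\cdot\Phi$. A change of local sections $\sigma_i\mapsto u_i\cdot\sigma_i$ with smooth $u_i:U_i\to G$ changes $\theta_i$ to $\theta_i+u_i^*\omega_{MC}$ and leaves $\hat e_h$ and $\Phi$ unchanged. -/

import Mathlib

open scoped Manifold ContDiff

noncomputable section

namespace KaluzaKlein

/-! ### Minkowski forms and their special isometry groups -/

/-- The Minkowski form `diag (-1, 1, …, 1)` of `ℝ^{1,m}`. -/
def minkowski (m : ℕ) : Matrix (Fin (m + 1)) (Fin (m + 1)) ℝ :=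
  Matrix.diagonal (Fin.cons (-1) (fun _ => 1))

/-- The Minkowski form of `ℝ^{1,m+k} = ℝ^{1,m} ⊕ ℝ^k`: the block matrix `diag (η, δ)`. -/
def minkowskiSum (m k : ℕ) : Matrix (Fin (m + 1) ⊕ Fin k) (Fin (m + 1) ⊕ Fin k) ℝ :=
  Matrix.fromBlocks (minkowski m) 0 0 1

/-- The group of real matrices of determinant one that preserve the bilinear form `η`:
`SO(1,m)` for `η = minkowski m`, `SO(1,m+k)` for `η = minkowskiSum m k`, `SO(k)` for `η = 1`. -/
def SO {ν : Type*} [Fintype ν] [DecidableEq ν] (η : Matrix ν ν ℝ) : Set (Matrix ν ν ℝ) :=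
  {A | A.transpose * η * A = η ∧ A.det = 1}

/-- The bilinear form `η_{ab} v^a w^b`. -/
def pairing {ν : Type*} [Fintype ν] (η : Matrix ν ν ℝ) (v w : ν → ℝ) : ℝ :=
  v ⬝ᵥ (η.mulVec w)

/-! ### One-forms with values in a vector space, and Lie derivatives -/

/-- Not necessarily smooth one-forms on `M` with values in the vector space `F`. -/
abbrev OneForm (n : ℕ) (M : Type*) [TopologicalSpace M]
    [ChartedSpace (EuclideanSpace ℝ (Fin n)) M]
    (F : Type*) [NormedAddCommGroup F] [NormedSpace ℝ F] : Type _ :=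
  ∀ x : M, TangentSpace (𝓡 n) x →L[ℝ] F

section Forms

variable {n : ℕ} {M : Type*} [TopologicalSpace M] [ChartedSpace (EuclideanSpace ℝ (Fin n)) M]
  {F : Type*} [NormedAddCommGroup F] [NormedSpace ℝ F]

/-- Smoothness of a one-form over `U`: as a fibrewise linear function on the tangent bundle,
it is smooth over `U`. -/
def SmoothFormOn [IsManifold (𝓡 n) ∞ M] (α : OneForm n M F) (U : Set M) : Prop :=
  ContMDiffOn (𝓡 n).tangent 𝓘(ℝ, F) ∞
    (fun v : TangentBundle (𝓡 n) M => α v.1 v.2) {v | v.1 ∈ U}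

/-- The (naive) Lie derivative of a vector-valued one-form along `ξ`, evaluated on a vector
field `Y`: `(L_ξ α)(Y) = ξ(α(Y)) - α([ξ, Y])`. -/
def lieDeriv (ξ : ∀ x : M, TangentSpace (𝓡 n) x) (α : OneForm n M F)
    (Y : ∀ x : M, TangentSpace (𝓡 n) x) (x : M) : F :=
  let derivative : F := mfderiv (𝓡 n) 𝓘(ℝ, F) (fun y => α y (Y y)) x (ξ x)
  derivative - α x (VectorField.mlieBracket (𝓡 n) ξ Y x)

/-- `L_ξ α = 0` over `U`. -/
def LieDerivVanishesOn [IsManifold (𝓡 n) ∞ M] (ξ : ∀ x : M, TangentSpace (𝓡 n) x)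
    (α : OneForm n M F) (U : Set M) : Prop :=
  ∀ x ∈ U, ∀ Y : (∀ y : M, TangentSpace (𝓡 n) y),
    ContMDiffAt (𝓡 n) (𝓡 n).tangent ∞ (fun y => (⟨y, Y y⟩ : TangentBundle (𝓡 n) M)) x →
    lieDeriv ξ α Y x = 0

end Forms

/-! ### Coframes and the Kosmann Lie derivative -/

section Coframes

variable {n : ℕ} {M : Type*} [TopologicalSpace M] [ChartedSpace (EuclideanSpace ℝ (Fin n)) M]
  {ν : Type*} [Fintype ν] [DecidableEq ν] {A : Type*}

/-- A coframe for an `SO(η)`-structure, that is, a bundle isomorphism `TM ≅ ℝ^ν_{SO(η)}`, through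
its local representatives over a trivializing cover: smooth local `ℝ^ν`-valued one-forms `e a` on
`V a` that are pointwise isomorphisms and are related on overlaps by `SO(η)`-valued transition
functions. These functions, `(e b) ∘ (e a)⁻¹`, are unique, smooth and satisfy the cocycle
condition, since the `e a` are smooth isomorphisms. -/
structure IsCoframe [IsManifold (𝓡 n) ∞ M] (η : Matrix ν ν ℝ) (V : A → Set M)
    (e : A → OneForm n M (ν → ℝ)) : Prop where
  isOpen : ∀ a, IsOpen (V a)
  cover : ∀ x, ∃ a, x ∈ V a
  smooth : ∀ a, SmoothFormOn (e a) (V a)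
  iso : ∀ a, ∀ x ∈ V a, (e a x).IsInvertible
  transition : ∀ a b, ∀ x ∈ V a ∩ V b, ∃ γ ∈ SO η, ∀ v, e b x v = γ.mulVec (e a x v)

/-- Two coframes are related by a (smooth, uniquely determined) `SO(η)`-gauge transformation
`e' = r · e`, expressed in local representatives. -/
def GaugeEquivalent {A' : Type*} (η : Matrix ν ν ℝ) (V : A → Set M)
    (e : A → OneForm n M (ν → ℝ)) (V' : A' → Set M) (e' : A' → OneForm n M (ν → ℝ)) : Prop :=
  ∀ a a', ∀ x ∈ V a ∩ V' a', ∃ r ∈ SO η, ∀ v, e' a' x v = r.mulVec (e a x v)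

/-- The frame dual to a local coframe. -/
def dualFrame (e : OneForm n M (ν → ℝ)) (b : ν) (x : M) : TangentSpace (𝓡 n) x :=
  (e x).inverse (Pi.single b 1)

/-- The components `(L_ξ e)_{ab} = η_{ac} (L_ξ e^c)(ê_b)` with respect to the dual frame `ê`. -/
def lieComponents (η : Matrix ν ν ℝ) (ξ : ∀ x : M, TangentSpace (𝓡 n) x)
    (e : OneForm n M (ν → ℝ)) (x : M) : Matrix ν ν ℝ :=
  η * Matrix.of (fun c b => lieDeriv ξ e (dualFrame e b) x c)

/-- The Kosmann Lie derivative `(L^K_ξ e)^a = η^{ad} (L_ξ e)_{(db)} e^b` of a local coframe, where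
round brackets denote symmetrization with weight one. -/
def kosmannLieDeriv (η : Matrix ν ν ℝ) (ξ : ∀ x : M, TangentSpace (𝓡 n) x)
    (e : OneForm n M (ν → ℝ)) (x : M) (v : TangentSpace (𝓡 n) x) : ν → ℝ :=
  (η⁻¹ * ((1 / 2 : ℝ) • (lieComponents η ξ e x + (lieComponents η ξ e x).transpose))).mulVec
    (e x v)

end Coframes

/-! ### Principal bundles with abelian structure group -/

section Bundle

variable {k m : ℕ} {G P X ι A : Type*}
  [TopologicalSpace G] [ChartedSpace (EuclideanSpace ℝ (Fin k)) G] [CommGroup G]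
  [LieGroup (𝓡 k) ∞ G]
  [TopologicalSpace P] [ChartedSpace (EuclideanSpace ℝ (Fin (m + 1 + k))) P]
  [IsManifold (𝓡 (m + 1 + k)) ∞ P] [MulAction G P]
  [TopologicalSpace X] [ChartedSpace (EuclideanSpace ℝ (Fin (m + 1))) X]
  [IsManifold (𝓡 (m + 1)) ∞ X]

variable (k m G P X ι) in
/-- A smooth principal `G`-bundle `proj : P → X = P / G` for an abelian Lie group `G`, together
with a trivializing cover. Since `G` is commutative, the principal right action is written as a
left action. The trivialization over `U i` is `p ↦ (proj p, triv i p)`, with smooth inverse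
`(x, g) ↦ g • sec i x`, where `sec i` is its canonical local section. -/
structure PrincipalBundle where
  proj : P → X
  contMDiff_smul : ContMDiff ((𝓡 k).prod (𝓡 (m + 1 + k))) (𝓡 (m + 1 + k)) ∞
    (fun q : G × P => q.1 • q.2)
  contMDiff_proj : ContMDiff (𝓡 (m + 1 + k)) (𝓡 (m + 1)) ∞ proj
  proj_smul : ∀ (g : G) (p : P), proj (g • p) = proj p
  free : ∀ (g : G) (p : P), g • p = p → g = 1
  U : ι → Set X
  isOpen_U : ∀ i, IsOpen (U i)
  cover_U : ∀ x, ∃ i, x ∈ U i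
  sec : ι → X → P
  contMDiffOn_sec : ∀ i, ContMDiffOn (𝓡 (m + 1)) (𝓡 (m + 1 + k)) ∞ (sec i) (U i)
  proj_sec : ∀ i, ∀ x ∈ U i, proj (sec i x) = x
  triv : ι → P → G
  contMDiffOn_triv : ∀ i, ContMDiffOn (𝓡 (m + 1 + k)) (𝓡 k) ∞ (triv i) (proj ⁻¹' U i)
  triv_smul_sec : ∀ i p, proj p ∈ U i → triv i p • sec i (proj p) = p

namespace PrincipalBundle

/-- The transition functions `γ_{ij}` on `U i ∩ U j`, with `sec j x = γ_{ij}(x) • sec i x`. -/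
def transition (B : PrincipalBundle k m G P X ι) (i j : ι) (x : X) : G :=
  B.triv i (B.sec j x)

/-- The same bundle with the local sections replaced by `u i • sec i`, for smooth local functions
`u i : U i → G`: a local `G`-gauge transformation. -/
def changeSections (B : PrincipalBundle k m G P X ι) (u : ι → X → G)
    (hu : ∀ i, ContMDiffOn (𝓡 (m + 1)) (𝓡 k) ∞ (u i) (B.U i)) :
    PrincipalBundle k m G P X ι where
  proj := B.proj
  contMDiff_smul := B.contMDiff_smul
  contMDiff_proj := B.contMDiff_proj
  proj_smul := B.proj_smul
  free := B.free
  U := B.U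
  isOpen_U := B.isOpen_U
  cover_U := B.cover_U
  sec := fun i x => u i x • B.sec i x
  contMDiffOn_sec := fun i =>
    B.contMDiff_smul.comp_contMDiffOn ((hu i).prodMk (B.contMDiffOn_sec i))
  proj_sec := fun i x hx => by rw [B.proj_smul, B.proj_sec i x hx]
  triv := fun i p => B.triv i p * (u i (B.proj p))⁻¹
  contMDiffOn_triv := fun i =>
    (B.contMDiffOn_triv i).mul
      (((hu i).comp B.contMDiff_proj.contMDiffOn (fun _ hp => hp)).inv)
  triv_smul_sec := fun i p hp => by
    rw [smul_smul, inv_mul_cancel_right, B.triv_smul_sec i p hp]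

end PrincipalBundle

/-- The Lie algebra `𝔤 = T_1 G` of a `k`-dimensional Lie group `G`. In Mathlib the tangent space is
by definition the model space; the latter is used here because it carries a norm. -/
abbrev LieAlg (k : ℕ) : Type := EuclideanSpace ℝ (Fin k)

theorem groupLieAlgebra_eq (G : Type*) [TopologicalSpace G]
    [ChartedSpace (EuclideanSpace ℝ (Fin k)) G] [CommGroup G] :
    GroupLieAlgebra (𝓡 k) G = LieAlg k := rfl

variable (G) in
/-- The fundamental vector field `a^#` of `a ∈ 𝔤`. -/
def fundamental (P : Type*) [TopologicalSpace P]
    [ChartedSpace (EuclideanSpace ℝ (Fin (m + 1 + k))) P] [MulAction G P]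
    (a : LieAlg k) (p : P) : TangentSpace (𝓡 (m + 1 + k)) p :=
  mfderiv (𝓡 k) (𝓡 (m + 1 + k)) (fun g : G => g • p) 1 a

/-- The pullback `u^* ω_MC = u⁻¹ du` of the Maurer–Cartan form along `u : X → G`. -/
def pullbackMC (u : X → G) : OneForm (m + 1) X (LieAlg k) :=
  fun x => mfderiv (𝓡 (m + 1)) (𝓡 k) (fun y => (u x)⁻¹ * u y) x

variable (G) in
/-- Connection one-forms. As `G` is abelian, `G`-equivariance is `G`-invariance. -/
structure IsConnection (θ : OneForm (m + 1 + k) P (LieAlg k)) : Prop where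
  smooth : SmoothFormOn θ Set.univ
  invariant : ∀ (g : G) (p : P) (v : TangentSpace (𝓡 (m + 1 + k)) p),
    θ (g • p) (mfderiv (𝓡 (m + 1 + k)) (𝓡 (m + 1 + k)) (fun q : P => g • q) p v) = θ p v
  fundamental : ∀ (a : LieAlg k) (p : P), θ p (fundamental G P a p) = a

/-! ### The coframes on the total space -/

variable (G) in
/-- Infinitesimal `G`-invariance in the sense of the Kosmann Lie derivative: `L^K_{a^#} e = 0` for
all `a ∈ 𝔤`. -/
def KosmannInvariant (W : A → Set P)
    (e : A → OneForm (m + 1 + k) P (Fin (m + 1) ⊕ Fin k → ℝ)) : Prop :=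
  ∀ (a : LieAlg k) (i : A), ∀ p ∈ W i, ∀ v,
    kosmannLieDeriv (minkowskiSum m k) (fundamental G P a) (e i) p v = 0

variable (G) in
/-- The fundamental vector fields `a^#`, `a ≠ 0`, are everywhere spacelike for `⟨e, e⟩`. -/
def SpacelikeFibers (W : A → Set P)
    (e : A → OneForm (m + 1 + k) P (Fin (m + 1) ⊕ Fin k → ℝ)) : Prop :=
  ∀ (a : LieAlg k), a ≠ 0 → ∀ i, ∀ p ∈ W i,
    0 < pairing (minkowskiSum m k) (e i p (fundamental G P a p)) (e i p (fundamental G P a p))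

/-- Partially gauge-fixed `G`-invariant coframes `ê = (ê_H, ê_θ)`, in local representatives over
the preimages of a cover `V` of the base. The first `m + 1` components are horizontal; the last
`k` components are global one-forms which, on the fibres, arise from the basis `θ^1, …, θ^k` of
vertical one-forms dual to the fundamental vector fields of `b` by Gram–Schmidt
orthonormalization (a lower triangular change of basis with positive diagonal) up to a rotation
in `SO(k)`; and the naive Lie derivatives of all components along fundamental vector fields
vanish. -/
structure IsPartiallyGaugeFixed (B : PrincipalBundle k m G P X ι)
    (b : Module.Basis (Fin k) ℝ (LieAlg k)) (V : A → Set X)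
    (e : A → OneForm (m + 1 + k) P (Fin (m + 1) ⊕ Fin k → ℝ)) : Prop where
  isOpen : ∀ a, IsOpen (V a)
  coframe : IsCoframe (minkowskiSum m k) (fun a => B.proj ⁻¹' V a) e
  invariant : ∀ (c : LieAlg k) (a : A),
    LieDerivVanishesOn (fundamental G P c) (e a) (B.proj ⁻¹' V a)
  horizontal : ∀ (c : LieAlg k) (a : A) (p : P), B.proj p ∈ V a →
    ∀ s : Fin (m + 1), e a p (fundamental G P c p) (Sum.inl s) = 0
  vertical_global : ∀ (a a' : A) (p : P), B.proj p ∈ V a → B.proj p ∈ V a' →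
    ∀ v, ∀ s : Fin k, e a p v (Sum.inr s) = e a' p v (Sum.inr s)
  vertical_gramSchmidt : ∀ (a : A) (p : P), B.proj p ∈ V a →
    ∃ R ∈ SO (1 : Matrix (Fin k) (Fin k) ℝ), ∃ L : Matrix (Fin k) (Fin k) ℝ,
      (∀ s t, s < t → L s t = 0) ∧ (∀ s, 0 < L s s) ∧
      Matrix.of (fun s t => e a p (fundamental G P (b t) p) (Sum.inr s)) = R * L

/-! ### The fields on the base -/

variable (k m X ι A) in
/-- Field content on the base: local one-forms `ê_h` (indexed by `A`), local `𝔤`-valued one-forms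
`θ_i` (indexed by `ι`), and a scalar with values in `𝔤^* ⊗ ℝ^k = Hom(𝔤, ℝ^k)`. -/
structure KKFields where
  eh : A → OneForm (m + 1) X (Fin (m + 1) → ℝ)
  gauge : ι → OneForm (m + 1) X (LieAlg k)
  scalar : X → (LieAlg k →L[ℝ] (Fin k → ℝ))

/-- The component matrix `(Φ^s_t)` of an element of `Hom(𝔤, ℝ^k)` with respect to a basis of
`𝔤` and the standard basis of `ℝ^k`. -/
def componentMatrix (b : Module.Basis (Fin k) ℝ (LieAlg k))
    (φ : LieAlg k →L[ℝ] (Fin k → ℝ)) : Matrix (Fin k) (Fin k) ℝ :=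
  Matrix.of (fun s t => φ (b t) s)

/-- The conditions on the fields: `ê_h` is a coframe for an `SO(1,m)`-structure on `X`; the `θ_i`
are local `G`-gauge fields for the given bundle; `Φ` is smooth, with positive determinant with
respect to all bases with the orientation of `b`. -/
structure IsKKFields (B : PrincipalBundle k m G P X ι)
    (b : Module.Basis (Fin k) ℝ (LieAlg k)) (V : A → Set X)
    (F : KKFields k m X ι A) : Prop where
  coframe : IsCoframe (minkowski m) V F.eh
  gauge_smooth : ∀ i, SmoothFormOn (F.gauge i) (B.U i)
  gauge_transition : ∀ i j, ∀ x ∈ B.U i ∩ B.U j,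
    F.gauge j x = F.gauge i x + pullbackMC (B.transition i j) x
  scalar_smooth : ContMDiff (𝓡 (m + 1)) 𝓘(ℝ, LieAlg k →L[ℝ] (Fin k → ℝ)) ∞
    F.scalar
  scalar_det_pos : ∀ (x : X) (b' : Module.Basis (Fin k) ℝ (LieAlg k)),
    0 < b.det b' → 0 < (componentMatrix b' (F.scalar x)).det

/-- The two collections of fields agree on the domains of their local representatives. -/
def KKFields.Agree (B : PrincipalBundle k m G P X ι) (V : A → Set X)
    (F F' : KKFields k m X ι A) : Prop :=
  (∀ a, ∀ x ∈ V a, F.eh a x = F'.eh a x) ∧ (∀ i, ∀ x ∈ B.U i, F.gauge i x = F'.gauge i x) ∧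
    F.scalar = F'.scalar

/-- The coframe `ê` on `P` encodes the fields `(ê_h, {θ_i}, Φ)` on `X`: there is a connection `θ`
on `P` whose horizontal space is the orthogonal complement of the fibres for `⟨ê, ê⟩`, with local
gauge fields `θ_i = (sec i)^* θ`, and `ê = (π^* ê_h, (Φ ∘ π) · θ)`. -/
def Encodes (B : PrincipalBundle k m G P X ι) (V : A → Set X)
    (e : A → OneForm (m + 1 + k) P (Fin (m + 1) ⊕ Fin k → ℝ)) (F : KKFields k m X ι A) : Prop :=
  ∃ θ : OneForm (m + 1 + k) P (LieAlg k),
    IsConnection G θ ∧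
    (∀ (a : A) (p : P), B.proj p ∈ V a → ∀ v, θ p v = 0 ↔
      ∀ c : LieAlg k,
        pairing (minkowskiSum m k) (e a p v) (e a p (fundamental G P c p)) = 0) ∧
    (∀ i, ∀ x ∈ B.U i, ∀ w, F.gauge i x w =
      θ (B.sec i x) (mfderiv (𝓡 (m + 1)) (𝓡 (m + 1 + k)) (B.sec i) x w)) ∧
    ∀ (a : A) (p : P), B.proj p ∈ V a → ∀ v, e a p v =
      Sum.elim
        (F.eh a (B.proj p) (mfderiv (𝓡 (m + 1 + k)) (𝓡 (m + 1)) B.proj p v))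
        (F.scalar (B.proj p) (θ p v))

/-! ### Local `G × SO(1,m) × SO(k)`-transformations -/

/-- Left multiplication by a matrix as a continuous linear map. -/
def mulVecL {ν : Type*} [Fintype ν] [DecidableEq ν] (A : Matrix ν ν ℝ) : (ν → ℝ) →L[ℝ] (ν → ℝ) :=
  LinearMap.toContinuousLinearMap A.mulVecLin

/-- The bundle automorphism `p ↦ u(π(p)) • p` given by `u : X → G`. -/
def gaugeAut (B : PrincipalBundle k m G P X ι) (u : X → G) (p : P) : P :=
  u (B.proj p) • p

/-- The action of `(u, Λ, R)` on coframes on `P`: pull back along the bundle automorphism of `u`,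
then rotate the first `m + 1` components by `Λ ∘ π` and the last `k` components by `R ∘ π`. -/
def transformCoframe (B : PrincipalBundle k m G P X ι) (u : X → G)
    (Λ : A → X → Matrix (Fin (m + 1)) (Fin (m + 1)) ℝ) (R : X → Matrix (Fin k) (Fin k) ℝ)
    (e : A → OneForm (m + 1 + k) P (Fin (m + 1) ⊕ Fin k → ℝ)) :
    A → OneForm (m + 1 + k) P (Fin (m + 1) ⊕ Fin k → ℝ) :=
  fun a p => (mulVecL (Matrix.fromBlocks (Λ a (B.proj p)) 0 0 (R (B.proj p)))).comp
    ((e a (gaugeAut B u p)).comp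
      (mfderiv (𝓡 (m + 1 + k)) (𝓡 (m + 1 + k)) (gaugeAut B u) p))

/-- The expected action of `(u, Λ, R)` on the fields on `X`:
`ê_h ↦ Λ ê_h`, `θ_i ↦ θ_i + u⁻¹ du`, `Φ ↦ R Φ`. -/
def KKFields.transform (u : X → G) (Λ : A → X → Matrix (Fin (m + 1)) (Fin (m + 1)) ℝ)
    (R : X → Matrix (Fin k) (Fin k) ℝ) (F : KKFields k m X ι A) : KKFields k m X ι A where
  eh := fun a x => (mulVecL (Λ a x)).comp (F.eh a x)
  gauge := fun i x => F.gauge i x + pullbackMC u x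
  scalar := fun x => (mulVecL (R x)).comp (F.scalar x)

/-- The expected effect on the fields of a change `sec i ↦ u i • sec i` of the local sections:
`θ_i ↦ θ_i + u_i⁻¹ du_i`, while `ê_h` and `Φ` do not change. -/
def KKFields.changeSections (u : ι → X → G) (F : KKFields k m X ι A) :
    KKFields k m X ι A where
  eh := F.eh
  gauge := fun i x => F.gauge i x + pullbackMC (u i) x
  scalar := F.scalar

end Bundle

end KaluzaKlein

end

open scoped Manifold ContDiff

set_option linter.unusedSectionVars false

noncomputable section

namespace KaluzaKlein

/-! ### Smooth one-forms: locality, pullback, contraction. -/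

section Forms

variable {n n' : ℕ} {M : Type*} [TopologicalSpace M]
  [ChartedSpace (EuclideanSpace ℝ (Fin n)) M] [IsManifold (𝓡 n) ∞ M]
  {N : Type*} [TopologicalSpace N]
  [ChartedSpace (EuclideanSpace ℝ (Fin n')) N] [IsManifold (𝓡 n') ∞ N]
  {F : Type*} [NormedAddCommGroup F] [NormedSpace ℝ F]
  {F' : Type*} [NormedAddCommGroup F'] [NormedSpace ℝ F']

/-! Invariance is studied through translates. For a one-form `α` and a tangent vector `v` at `p`,
`translate` is the function g ↦ α(g p)(dg v) on the group, and its derivative at the identity is the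
naive Lie derivative along the fundamental field (`mfderiv_translate`). In coordinates this is the
classical formula for the derivative of a family of pullbacks, in which the bracket term appears
through the symmetry of mixed second derivatives. As G is connected, a function all of whose
translates have zero derivative at the identity is constant (`eq_of_translates`), so infinitesimal
conditions integrate. Vanishing naive Lie derivatives make the form invariant under every g. The
Kosmann condition says that the matrix of L_ξ e in the frame of e lies in the Lie algebra of SO(η);
hence the metric ⟨e, e⟩ is invariant (`pairing_translate`), and g acts on e by a matrix of SO(η),
whose determinant is one by continuity and connectedness (`exists_translate_eq_mulVec`).

The bridge between P and X is the form ê = (π^* ê_h, Φ θ) with θ a connection (`IsKKCoframe`). Such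
a coframe is invariant because dπ and θ are, its first components are horizontal because dπ kills
fundamental fields, and the Gram–Schmidt condition holds because a matrix of positive determinant is
a rotation times a lower triangular matrix with positive diagonal. The identity ⟨ê v, ê c^#⟩ = Φ(θ
v) · Φ c shows that the kernel of θ is the orthogonal complement of the fibres. Conversely, for a
partially gauge-fixed coframe the values of ê_θ on fundamental fields are constant along fibres and
descend to Φ; then θ is Φ⁻¹ ê_θ and ê_h is the pullback of ê_H along local sections
(`exists_isKKCoframe`). These recipes also give uniqueness. Local gauge fields are glued to a
connection as π^*θ_i plus the flat connection of the i-th trivialization (`exists_connection`). The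
transformation laws all come from the product rule d(u • s) = u_* ds + (u⁻¹ du)^#.

To gauge-fix a Kosmann-invariant coframe, the Gram matrix of the fundamental fields descends to X by
invariance of the metric; its smooth Cholesky factor is a global Φ, and orthogonal projection to the
fibres defines θ. The normalized vertical vectors along a local section are completed to a Lorentz
frame R by Gram–Schmidt (`exists_smooth_lorentz_frame`), and the first components of R⁻¹ e give ê_h.
Along the section the new coframe is R⁻¹ e; away from it, e is carried along by SO(η) while the new
coframe is invariant, so the two remain gauge equivalent. -/

theorem SmoothFormOn.mono {α : OneForm n M F} {U V : Set M} (h : SmoothFormOn α U) (hV : V ⊆ U) :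
    SmoothFormOn α V :=
  ContMDiffOn.mono h (fun _ hv => hV hv)

theorem SmoothFormOn.congr {α β : OneForm n M F} {U : Set M} (h : SmoothFormOn α U)
    (hβ : ∀ x ∈ U, ∀ v, β x v = α x v) : SmoothFormOn β U :=
  ContMDiffOn.congr h (fun v hv => hβ v.1 hv v.2)

theorem isOpen_fiberPreimage {U : Set M} (hU : IsOpen U) :
    IsOpen {v : TangentBundle (𝓡 n) M | v.1 ∈ U} :=
  hU.preimage (FiberBundle.continuous_proj _ _)

theorem smoothFormOn_of_locally {α : OneForm n M F} {U : Set M}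
    (h : ∀ x ∈ U, ∃ W, IsOpen W ∧ x ∈ W ∧ SmoothFormOn α W) : SmoothFormOn α U := by
  intro v hv
  obtain ⟨W, hW, hx, hα⟩ := h v.1 hv
  exact (hα.contMDiffAt ((isOpen_fiberPreimage hW).mem_nhds hx)).contMDiffWithinAt

/-- The pullback is `α` after the tangent map of `f`, which is smooth; on the open set `S` the
derivative within `S` is the derivative. -/
theorem SmoothFormOn.pullback {α : OneForm n M F} {U : Set M} (h : SmoothFormOn α U)
    {f : N → M} {S : Set N} (hS : IsOpen S) (hf : ContMDiffOn (𝓡 n') (𝓡 n) ∞ f S)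
    (hfS : Set.MapsTo f S U) :
    SmoothFormOn (fun x => (α (f x)).comp (mfderiv (𝓡 n') (𝓡 n) f x)) S := by
  have h1 := hf.contMDiffOn_tangentMapWithin (m := ∞) le_rfl hS.uniqueMDiffOn
  have h2 := ContMDiffOn.comp h h1 (fun v hv => hfS hv)
  refine h2.congr ?_
  intro v hv
  simp only [Function.comp, tangentMapWithin, mfderivWithin_of_isOpen hS hv]
  rfl

theorem SmoothFormOn.clm_apply {α : OneForm n M F} {U : Set M} (h : SmoothFormOn α U)
    {Φ : M → F →L[ℝ] F'} (hΦ : ContMDiffOn (𝓡 n) 𝓘(ℝ, F →L[ℝ] F') ∞ Φ U) :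
    SmoothFormOn (fun x => (Φ x).comp (α x)) U := by
  have h1 : ContMDiffOn (𝓡 n).tangent 𝓘(ℝ, F →L[ℝ] F') ∞
      (fun v : TangentBundle (𝓡 n) M => Φ v.1) {v | v.1 ∈ U} :=
    hΦ.comp (Bundle.contMDiff_proj _).contMDiffOn (fun _ hv => hv)
  exact h1.clm_apply h

theorem SmoothFormOn.add {α β : OneForm n M F} {U : Set M} (h : SmoothFormOn α U)
    (hβ : SmoothFormOn β U) : SmoothFormOn (fun x => α x + β x) U :=
  ContMDiffOn.add h hβ

theorem SmoothFormOn.pi {ν : Type*} [Fintype ν] {α : OneForm n M (ν → ℝ)} {U : Set M}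
    (h : ∀ i, ContMDiffOn (𝓡 n).tangent 𝓘(ℝ, ℝ) ∞
      (fun v : TangentBundle (𝓡 n) M => α v.1 v.2 i) {v | v.1 ∈ U}) : SmoothFormOn α U :=
  contMDiffOn_pi_space.2 h

theorem SmoothFormOn.apply {α : OneForm n M F} {U : Set M} (h : SmoothFormOn α U)
    {Q H E : Type*} [NormedAddCommGroup E] [NormedSpace ℝ E] [TopologicalSpace H]
    [TopologicalSpace Q] [ChartedSpace H Q] {I : ModelWithCorners ℝ E H}
    {f : Q → M} {Y : ∀ q : Q, TangentSpace (𝓡 n) (f q)} {S : Set Q}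
    (hY : ContMDiffOn I (𝓡 n).tangent ∞ (fun q => (⟨f q, Y q⟩ : TangentBundle (𝓡 n) M)) S)
    (hf : Set.MapsTo f S U) :
    ContMDiffOn I 𝓘(ℝ, F) ∞ (fun q => α (f q) (Y q)) S :=
  ContMDiffOn.comp h hY hf

/-- The differential of a vector-valued function. -/
theorem smoothFormOn_mfderiv {f : M → F} {U : Set M} (hU : IsOpen U)
    (hf : ContMDiffOn (𝓡 n) 𝓘(ℝ, F) ∞ f U) :
    SmoothFormOn (fun x => (mfderiv (𝓡 n) 𝓘(ℝ, F) f x : TangentSpace (𝓡 n) x →L[ℝ] F)) U := by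
  have h1 := hf.contMDiffOn_tangentMapWithin (m := ∞) le_rfl hU.uniqueMDiffOn
  have h2 := (contMDiff_snd_tangentBundle_modelSpace F 𝓘(ℝ, F) (n := ∞)).comp_contMDiffOn h1
  refine h2.congr ?_
  intro v hv
  simp only [Function.comp, tangentMapWithin, mfderivWithin_of_isOpen hU hv]
  rfl

end Forms

/-! ### Forms, vector fields and brackets in a chart. -/

section Coordinates

variable {n : ℕ} {M : Type*} [TopologicalSpace M]
  [ChartedSpace (EuclideanSpace ℝ (Fin n)) M] 
  {F : Type*} [NormedAddCommGroup F] [NormedSpace ℝ F]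

/-- A one-form in the coordinates of the chart at `p`. -/
def coordForm (p : M) (α : OneForm n M F) (y : EuclideanSpace ℝ (Fin n)) :
    EuclideanSpace ℝ (Fin n) →L[ℝ] F :=
  (α ((extChartAt (𝓡 n) p).symm y)).comp
    (mfderiv 𝓘(ℝ, EuclideanSpace ℝ (Fin n)) (𝓡 n) (extChartAt (𝓡 n) p).symm y)

/-- A vector field in the coordinates of the chart at `p`. -/
def coordField (p : M) (Y : ∀ x : M, TangentSpace (𝓡 n) x) (y : EuclideanSpace ℝ (Fin n)) :
    EuclideanSpace ℝ (Fin n) :=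
  mfderiv (𝓡 n) 𝓘(ℝ, EuclideanSpace ℝ (Fin n)) (extChartAt (𝓡 n) p)
    ((extChartAt (𝓡 n) p).symm y) (Y ((extChartAt (𝓡 n) p).symm y))

/-- The vector field with given coordinates in the chart at `p`. -/
def ofCoordField (p : M) (w : EuclideanSpace ℝ (Fin n) → EuclideanSpace ℝ (Fin n)) (x : M) :
    TangentSpace (𝓡 n) x :=
  mfderiv 𝓘(ℝ, EuclideanSpace ℝ (Fin n)) (𝓡 n) (extChartAt (𝓡 n) p).symm
    (extChartAt (𝓡 n) p x) (w (extChartAt (𝓡 n) p x))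

variable [IsManifold (𝓡 n) ∞ M]

theorem mfderiv_extChartAt_symm_apply {p : M} {y : EuclideanSpace ℝ (Fin n)}
    (hy : y ∈ (extChartAt (𝓡 n) p).target)
    (v : TangentSpace (𝓡 n) ((extChartAt (𝓡 n) p).symm y)) :
    mfderiv 𝓘(ℝ, EuclideanSpace ℝ (Fin n)) (𝓡 n) (extChartAt (𝓡 n) p).symm y
      (mfderiv (𝓡 n) 𝓘(ℝ, EuclideanSpace ℝ (Fin n)) (extChartAt (𝓡 n) p)
        ((extChartAt (𝓡 n) p).symm y) v) = v := by
  have : IsManifold (𝓡 n) 1 M := IsManifold.of_le (n := ∞) (by simp)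
  have h := mfderivWithin_extChartAt_symm_comp_mfderiv_extChartAt (I := 𝓡 n) hy
  rw [ModelWithCorners.range_eq_univ, mfderivWithin_univ] at h
  exact congrArg (fun L => L v) h

theorem coordForm_coordField {p : M} {y : EuclideanSpace ℝ (Fin n)}
    (hy : y ∈ (extChartAt (𝓡 n) p).target) (α : OneForm n M F)
    (Y : ∀ x : M, TangentSpace (𝓡 n) x) :
    coordForm p α y (coordField p Y y) =
      α ((extChartAt (𝓡 n) p).symm y) (Y ((extChartAt (𝓡 n) p).symm y)) :=
  congrArg (α ((extChartAt (𝓡 n) p).symm y)) (mfderiv_extChartAt_symm_apply hy _)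

/-- The bracket on a manifold is a coordinate bracket transported by the inverse of the derivative
of the chart. At the centre of its own chart this derivative is the identity, so no outer factor
survives. -/
theorem mlieBracket_eq_lieBracket (p : M) (V Y : ∀ x : M, TangentSpace (𝓡 n) x) :
    VectorField.mlieBracket (𝓡 n) V Y p =
      VectorField.lieBracket ℝ (coordField p V) (coordField p Y) (extChartAt (𝓡 n) p p) := by
  have : IsManifold (𝓡 n) 1 M := IsManifold.of_le (n := ∞) (by simp)
  have key : ∀ Z : (∀ x : M, TangentSpace (𝓡 n) x),
      VectorField.mpullback 𝓘(ℝ, EuclideanSpace ℝ (Fin n)) (𝓡 n) (extChartAt (𝓡 n) p).symm Z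
        =ᶠ[nhds (extChartAt (𝓡 n) p p)] coordField p Z := by
    intro Z
    filter_upwards [extChartAt_target_mem_nhds (I := 𝓡 n) p] with y hy
    have h1 := mfderivWithin_extChartAt_symm_comp_mfderiv_extChartAt (I := 𝓡 n) hy
    have h2 := mfderiv_extChartAt_comp_mfderivWithin_extChartAt_symm (I := 𝓡 n) hy
    rw [ModelWithCorners.range_eq_univ, mfderivWithin_univ] at h1 h2
    rw [VectorField.mpullback_apply, ContinuousLinearMap.inverse_eq h1 h2]
    rfl
  have hinv : ∀ v : EuclideanSpace ℝ (Fin n),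
      (mfderiv (𝓡 n) 𝓘(ℝ, EuclideanSpace ℝ (Fin n)) (extChartAt (𝓡 n) p) p).inverse v = v := by
    intro v
    have h := mfderiv_extChartAt_self (I := 𝓡 n) (x := p)
    exact (congrArg (fun L : EuclideanSpace ℝ (Fin n) →L[ℝ] EuclideanSpace ℝ (Fin n) =>
      L.inverse v) h).trans (congrArg (fun L : _ →L[ℝ] _ => L v) ContinuousLinearMap.inverse_id)
  refine (hinv _).trans ?_
  simp only [ModelWithCorners.range_eq_univ, VectorField.mpullbackWithin_univ, Set.preimage_univ,
    Set.inter_univ]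
  refine (congrFun (VectorField.lieBracketWithin_univ (𝕜 := ℝ)
    (E := EuclideanSpace ℝ (Fin n))) _).trans ?_
  exact Filter.EventuallyEq.lieBracket_vectorField_eq (𝕜 := ℝ)
    (E := EuclideanSpace ℝ (Fin n)) (key V) (key Y)

theorem contDiffOn_coordForm {p : M} {α : OneForm n M F} {U : Set M} (hα : SmoothFormOn α U)
    (hU : IsOpen U) :
    ContDiffOn ℝ ∞ (coordForm p α)
      ((extChartAt (𝓡 n) p).target ∩ (extChartAt (𝓡 n) p).symm ⁻¹' U) := by
  rw [contDiffOn_clm_apply]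
  intro w
  have ho : IsOpen ((extChartAt (𝓡 n) p).target ∩ (extChartAt (𝓡 n) p).symm ⁻¹' U) :=
    (continuousOn_extChartAt_symm p).isOpen_inter_preimage (isOpen_extChartAt_target p) hU
  have h := hα.pullback ho ((contMDiffOn_extChartAt_symm (I := 𝓡 n) (n := ∞) p).mono
    Set.inter_subset_left) (fun y hy => hy.2)
  have hw : ContMDiffOn 𝓘(ℝ, EuclideanSpace ℝ (Fin n)) (𝓡 n).tangent ∞
      (fun y => (⟨y, w⟩ : TangentBundle (𝓡 n) (EuclideanSpace ℝ (Fin n))))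
      ((extChartAt (𝓡 n) p).target ∩ (extChartAt (𝓡 n) p).symm ⁻¹' U) :=
    contMDiffOn_vectorSpace_iff_contDiffOn.2 contDiffOn_const
  exact (h.apply hw (fun y hy => hy)).contDiffOn

theorem contDiffAt_coordForm {p : M} {α : OneForm n M F} {U : Set M} (hα : SmoothFormOn α U)
    (hU : IsOpen U) (hp : p ∈ U) : ContDiffAt ℝ ∞ (coordForm p α) (extChartAt (𝓡 n) p p) := by
  have ho : IsOpen ((extChartAt (𝓡 n) p).target ∩ (extChartAt (𝓡 n) p).symm ⁻¹' U) :=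
    (continuousOn_extChartAt_symm p).isOpen_inter_preimage (isOpen_extChartAt_target p) hU
  exact (contDiffOn_coordForm hα hU).contDiffAt
    (ho.mem_nhds ⟨mem_extChartAt_target p, by simpa using hp⟩)

theorem smoothFormOn_extChartAt (p : M) :
    SmoothFormOn (fun x => (mfderiv (𝓡 n) 𝓘(ℝ, EuclideanSpace ℝ (Fin n)) (extChartAt (𝓡 n) p) x :
      TangentSpace (𝓡 n) x →L[ℝ] EuclideanSpace ℝ (Fin n))) (extChartAt (𝓡 n) p).source :=
  smoothFormOn_mfderiv (isOpen_extChartAt_source p)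
    (by rw [extChartAt_source]; exact contMDiffOn_extChartAt)

theorem contDiffAt_coordField {p : M} {Y : ∀ x : M, TangentSpace (𝓡 n) x}
    (hY : ContMDiffAt (𝓡 n) (𝓡 n).tangent ∞
      (fun x => (⟨x, Y x⟩ : TangentBundle (𝓡 n) M)) p) :
    ContDiffAt ℝ ∞ (coordField p Y) (extChartAt (𝓡 n) p p) := by
  have h1 := (smoothFormOn_extChartAt (n := n) p).contMDiffAt
    ((isOpen_fiberPreimage (isOpen_extChartAt_source (I := 𝓡 n) p)).mem_nhds
      (x := (⟨p, Y p⟩ : TangentBundle (𝓡 n) M)) (mem_extChartAt_source p))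
  have h2 : ContMDiffAt (𝓡 n) 𝓘(ℝ, EuclideanSpace ℝ (Fin n)) ∞
      (fun x => (mfderiv (𝓡 n) 𝓘(ℝ, EuclideanSpace ℝ (Fin n)) (extChartAt (𝓡 n) p) x (Y x) :
        EuclideanSpace ℝ (Fin n))) p :=
    ContMDiffAt.comp p h1 hY
  have h3 : ContMDiffAt 𝓘(ℝ, EuclideanSpace ℝ (Fin n)) (𝓡 n) ∞ (extChartAt (𝓡 n) p).symm
      (extChartAt (𝓡 n) p p) :=
    (contMDiffOn_extChartAt_symm (I := 𝓡 n) (n := ∞) p).contMDiffAt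
      (extChartAt_target_mem_nhds p)
  exact (ContMDiffAt.comp_of_eq h2 h3 (extChartAt_to_inv p)).contDiffAt

/-- A source of smooth vector fields: constant coordinates extend a single tangent vector, and
inverting a coframe in coordinates yields its dual frame. -/
theorem contMDiffAt_ofCoordField {p : M} {w : EuclideanSpace ℝ (Fin n) → EuclideanSpace ℝ (Fin n)}
    (hw : ContDiffAt ℝ ∞ w (extChartAt (𝓡 n) p p)) :
    ContMDiffAt (𝓡 n) (𝓡 n).tangent ∞
      (fun x => (⟨x, ofCoordField p w x⟩ : TangentBundle (𝓡 n) M)) p := by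
  have h1 := (contMDiffOn_extChartAt_symm (I := 𝓡 n) (n := ∞) p).contMDiffOn_tangentMapWithin
    (m := ∞) le_rfl (isOpen_extChartAt_target p).uniqueMDiffOn
  have h2 : ContMDiffAt (𝓡 n) (𝓡 n).tangent ∞ (fun x => (⟨extChartAt (𝓡 n) p x,
      w (extChartAt (𝓡 n) p x)⟩ : TangentBundle (𝓡 n) (EuclideanSpace ℝ (Fin n)))) p :=
    ContMDiffAt.comp p (contMDiffAt_vectorSpace_iff_contDiffAt.2 hw) contMDiffAt_extChartAt
  have h3 := ContMDiffAt.comp p (h1.contMDiffAt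
    ((isOpen_fiberPreimage (isOpen_extChartAt_target (I := 𝓡 n) p)).mem_nhds
      (x := (⟨extChartAt (𝓡 n) p p, w (extChartAt (𝓡 n) p p)⟩ :
        TangentBundle (𝓡 n) (EuclideanSpace ℝ (Fin n)))) (mem_extChartAt_target p))) h2
  refine h3.congr_of_eventuallyEq ?_
  filter_upwards [extChartAt_source_mem_nhds (I := 𝓡 n) p] with x hx
  -- The base points agree only propositionally and the fibres depend on them; generalizing one
  -- point lets the equality be substituted.
  have key : ∀ z : M, z = x → ∀ u : EuclideanSpace ℝ (Fin n),
      (⟨x, u⟩ : TangentBundle (𝓡 n) M) = ⟨z, u⟩ := by rintro z rfl u; rfl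
  simp only [Function.comp, tangentMapWithin, mfderivWithin_of_isOpen (isOpen_extChartAt_target p)
    ((extChartAt (𝓡 n) p).map_source hx)]
  exact key _ ((extChartAt (𝓡 n) p).left_inv hx) _

theorem ofCoordField_self (p : M) (w : EuclideanSpace ℝ (Fin n) → EuclideanSpace ℝ (Fin n)) :
    ofCoordField p w p = w (extChartAt (𝓡 n) p p) := by
  have : IsManifold (𝓡 n) 1 M := IsManifold.of_le (n := ∞) (by simp)
  have h := mfderivWithin_range_extChartAt_symm (I := 𝓡 n) (x := p)
  rw [ModelWithCorners.range_eq_univ, mfderivWithin_univ] at h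
  exact congrArg (fun L : EuclideanSpace ℝ (Fin n) →L[ℝ] EuclideanSpace ℝ (Fin n) =>
    L (w (extChartAt (𝓡 n) p p))) h

/-- `LieDerivVanishesOn` tests against vector fields smooth at the point; through extensions it
becomes a condition on single tangent vectors. -/
theorem exists_smooth_extension (p : M) (v : TangentSpace (𝓡 n) p) :
    ∃ Y : ∀ x : M, TangentSpace (𝓡 n) x, ContMDiffAt (𝓡 n) (𝓡 n).tangent ∞
      (fun x => (⟨x, Y x⟩ : TangentBundle (𝓡 n) M)) p ∧ Y p = v :=
  ⟨ofCoordField p (fun _ => v), contMDiffAt_ofCoordField contDiffAt_const, ofCoordField_self p _⟩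

end Coordinates

/-! ### The Lie derivative as a derivative of pullbacks, in a vector space. -/

section VectorSpace

variable {E E' F : Type*} [NormedAddCommGroup E] [NormedSpace ℝ E]
  [NormedAddCommGroup E'] [NormedSpace ℝ E'] [NormedAddCommGroup F] [NormedSpace ℝ F]

theorem fderiv_prodMk_right {Ψ : E' × E → F} {s : E'} {y : E}
    (hΨ : DifferentiableAt ℝ Ψ (s, y)) (v : E) :
    fderiv ℝ Ψ (s, y) (0, v) = fderiv ℝ (fun y => Ψ (s, y)) y v := by
  have h := hΨ.hasFDerivAt.comp y (hasFDerivAt_prodMk_right s y)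
  rw [show (fun y => Ψ (s, y)) = Ψ ∘ (fun y => (s, y)) from rfl, h.fderiv]
  simp

theorem fderiv_prodMk_left {Ψ : E' × E → F} {s : E'} {y : E}
    (hΨ : DifferentiableAt ℝ Ψ (s, y)) (a : E') :
    fderiv ℝ Ψ (s, y) (a, 0) = fderiv ℝ (fun s => Ψ (s, y)) s a := by
  have h := HasFDerivAt.comp (f := fun s => (s, y)) s hΨ.hasFDerivAt (hasFDerivAt_prodMk_left s y)
  rw [show (fun s => Ψ (s, y)) = Ψ ∘ (fun s => (s, y)) from rfl, h.fderiv]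
  simp

/-- The derivative of the pullbacks `Ψ_s^* α` of a one-form along a family of maps with
`Ψ_{s₀} = id` is the Lie derivative of `α` along the velocity field of `Ψ`. -/
theorem fderiv_pullback_family {Ψ : E' × E → E} {s₀ : E'} {y₀ : E}
    (hΨ : ContDiffAt ℝ ∞ Ψ (s₀, y₀)) (hid : ∀ᶠ y in nhds y₀, Ψ (s₀, y) = y)
    {α : E → E →L[ℝ] F} (hα : DifferentiableAt ℝ α y₀)
    {Y : E → E} (hY : DifferentiableAt ℝ Y y₀) (a : E') :
    fderiv ℝ (fun s => α (Ψ (s, y₀)) (fderiv ℝ Ψ (s, y₀) (0, Y y₀))) s₀ a =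
      fderiv ℝ (fun y => α y (Y y)) y₀ (fderiv ℝ Ψ (s₀, y₀) (a, 0)) -
        α y₀ (VectorField.lieBracket ℝ (fun y => fderiv ℝ Ψ (s₀, y) (a, 0)) Y y₀) := by
  have hd : DifferentiableAt ℝ Ψ (s₀, y₀) := hΨ.differentiableAt (by simp)
  have hd2 : DifferentiableAt ℝ (fderiv ℝ Ψ) (s₀, y₀) :=
    (hΨ.fderiv_right (m := ∞) (by simp)).differentiableAt (by simp)
  have hsymm := hΨ.isSymmSndFDerivAt (by
    simpa using WithTop.coe_le_coe.2 (le_top : (2 : ℕ∞) ≤ ⊤))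
  have h0 : Ψ (s₀, y₀) = y₀ := hid.self_of_nhds
  have hD : ∀ v, fderiv ℝ Ψ (s₀, y₀) (0, v) = v := by
    intro v
    rw [fderiv_prodMk_right hd, Filter.EventuallyEq.fderiv_eq (f₁ := fun y => Ψ (s₀, y))
      (f := fun y => y) hid]
    simp
  have hξ : HasFDerivAt (fun y => fderiv ℝ Ψ (s₀, y) (a, 0)) _ y₀ :=
    ((hd2.hasFDerivAt.comp y₀ (hasFDerivAt_prodMk_right s₀ y₀)).clm_apply
      (hasFDerivAt_const (a, (0 : E)) y₀))
  have hT : HasFDerivAt (fun s => fderiv ℝ Ψ (s, y₀) (0, Y y₀)) _ s₀ :=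
    ((hd2.hasFDerivAt.comp s₀ (hasFDerivAt_prodMk_left s₀ y₀)).clm_apply
      (hasFDerivAt_const ((0 : E'), Y y₀) s₀))
  have hα' : HasFDerivAt (fun s => α (Ψ (s, y₀))) _ s₀ :=
    HasFDerivAt.comp s₀ (f := fun s => Ψ (s, y₀)) (g := α) (by
      rw [h0]; exact hα.hasFDerivAt) (hd.hasFDerivAt.comp s₀ (hasFDerivAt_prodMk_left s₀ y₀))
  have hL : HasFDerivAt (fun s => α (Ψ (s, y₀)) (fderiv ℝ Ψ (s, y₀) (0, Y y₀))) _ s₀ :=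
    hα'.clm_apply hT
  have hR : HasFDerivAt (fun y => α y (Y y)) _ y₀ := hα.hasFDerivAt.clm_apply hY.hasFDerivAt
  -- Varying the pullback yields D₁D₂Ψ, while the bracket contains the derivative of the velocity
  -- field, D₂D₁Ψ. Symmetry of the second derivative identifies them; the terms with the derivative
  -- of `Y` cancel on the right-hand side.
  have hs := hsymm (a, (0 : E)) ((0 : E'), Y y₀)
  rw [hL.fderiv, hR.fderiv, VectorField.lieBracket, hξ.fderiv]
  simp [h0, hD, hs]
  abel

end VectorSpace

/-! ### Derivatives at the centre of a chart, and smoothness of the action. -/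

section Orbit

variable {n k m : ℕ} {M : Type*} [TopologicalSpace M] [ChartedSpace (EuclideanSpace ℝ (Fin n)) M]
  [IsManifold (𝓡 n) ∞ M]
  {F : Type*} [NormedAddCommGroup F] [NormedSpace ℝ F]

/-- Tangent vectors at `p` are stored in the coordinates of the chart at `p`, so no change of
coordinates enters. -/
theorem mfderiv_eq_fderiv_chart {f : M → F} {p : M} (hf : MDifferentiableAt (𝓡 n) 𝓘(ℝ, F) f p)
    (v : EuclideanSpace ℝ (Fin n)) :
    mfderiv (𝓡 n) 𝓘(ℝ, F) f p v =
      fderiv ℝ (f ∘ (extChartAt (𝓡 n) p).symm) (extChartAt (𝓡 n) p p) v := by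
  rw [hf.mfderiv]
  simp only [ModelWithCorners.range_eq_univ, fderivWithin_univ]
  rfl

theorem coordForm_mfderiv {p q : M} (hq : q ∈ (extChartAt (𝓡 n) p).source) (α : OneForm n M F)
    (u : TangentSpace (𝓡 n) q) :
    coordForm p α (extChartAt (𝓡 n) p q)
      (mfderiv (𝓡 n) 𝓘(ℝ, EuclideanSpace ℝ (Fin n)) (extChartAt (𝓡 n) p) q u) = α q u := by
  obtain ⟨y, hy, rfl⟩ : ∃ y ∈ (extChartAt (𝓡 n) p).target, (extChartAt (𝓡 n) p).symm y = q :=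
    ⟨_, (extChartAt (𝓡 n) p).map_source hq, (extChartAt (𝓡 n) p).left_inv hq⟩
  rw [(extChartAt (𝓡 n) p).right_inv hy]
  exact congrArg (α _) (mfderiv_extChartAt_symm_apply hy u)

theorem mfderiv_extChartAt_self_apply (p : M) (v : TangentSpace (𝓡 n) p) :
    mfderiv (𝓡 n) 𝓘(ℝ, EuclideanSpace ℝ (Fin n)) (extChartAt (𝓡 n) p) p v = v := by
  have : IsManifold (𝓡 n) 1 M := IsManifold.of_le (n := ∞) (by simp)
  exact congrArg (fun L : EuclideanSpace ℝ (Fin n) →L[ℝ] EuclideanSpace ℝ (Fin n) => L v)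
    (mfderiv_extChartAt_self (I := 𝓡 n) (x := p))

theorem coordForm_self (p : M) (α : OneForm n M F) (u : TangentSpace (𝓡 n) p) :
    coordForm p α (extChartAt (𝓡 n) p p) u = α p u := by
  have h := coordForm_mfderiv (mem_extChartAt_source (I := 𝓡 n) p) α u
  exact (congrArg (coordForm p α (extChartAt (𝓡 n) p p))
    (mfderiv_extChartAt_self_apply p u)).symm.trans h

theorem coordField_self (p : M) (Y : ∀ x : M, TangentSpace (𝓡 n) x) :
    coordField p Y (extChartAt (𝓡 n) p p) = Y p := by
  have key : ∀ z : M, z = p → mfderiv (𝓡 n) 𝓘(ℝ, EuclideanSpace ℝ (Fin n)) (extChartAt (𝓡 n) p) z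
      (Y z) = Y p := by
    rintro z rfl
    exact mfderiv_extChartAt_self_apply z (Y z)
  exact key _ (extChartAt_to_inv p)

variable {G P : Type*}
  [TopologicalSpace G] [ChartedSpace (EuclideanSpace ℝ (Fin k)) G] [CommGroup G]
  [LieGroup (𝓡 k) ∞ G]
  [TopologicalSpace P] [ChartedSpace (EuclideanSpace ℝ (Fin (m + 1 + k))) P]
  [IsManifold (𝓡 (m + 1 + k)) ∞ P] [MulAction G P]

theorem contMDiff_const_smul_of_smul
    (hact : ContMDiff ((𝓡 k).prod (𝓡 (m + 1 + k))) (𝓡 (m + 1 + k)) ∞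
      (fun q : G × P => q.1 • q.2)) (g : G) :
    ContMDiff (𝓡 (m + 1 + k)) (𝓡 (m + 1 + k)) ∞ (fun p : P => g • p) :=
  hact.comp (contMDiff_const.prodMk contMDiff_id)

theorem contMDiff_smul_const_of_smul
    (hact : ContMDiff ((𝓡 k).prod (𝓡 (m + 1 + k))) (𝓡 (m + 1 + k)) ∞
      (fun q : G × P => q.1 • q.2)) (p : P) :
    ContMDiff (𝓡 k) (𝓡 (m + 1 + k)) ∞ (fun g : G => g • p) :=
  hact.comp (contMDiff_id.prodMk contMDiff_const)

/-- The differential of a smooth map in two variables is smooth. -/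
theorem contMDiff_tangent_prod {E₁ E₂ E₃ H₁ H₂ H₃ M₁ M₂ M₃ : Type*}
    [NormedAddCommGroup E₁] [NormedSpace ℝ E₁] [TopologicalSpace H₁]
    [NormedAddCommGroup E₂] [NormedSpace ℝ E₂] [TopologicalSpace H₂]
    [NormedAddCommGroup E₃] [NormedSpace ℝ E₃] [TopologicalSpace H₃]
    [TopologicalSpace M₁] [ChartedSpace H₁ M₁] [TopologicalSpace M₂] [ChartedSpace H₂ M₂]
    [TopologicalSpace M₃] [ChartedSpace H₃ M₃] {I₁ : ModelWithCorners ℝ E₁ H₁}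
    {I₂ : ModelWithCorners ℝ E₂ H₂} {I₃ : ModelWithCorners ℝ E₃ H₃}
    [IsManifold I₁ ∞ M₁] [IsManifold I₂ ∞ M₂] [IsManifold I₃ ∞ M₃] {f : M₁ → M₂ → M₃}
    (hf : ContMDiff (I₁.prod I₂) I₃ ∞ (fun q : M₁ × M₂ => f q.1 q.2)) :
    ContMDiff (I₁.tangent.prod I₂.tangent) I₃.tangent ∞
      (fun q : TangentBundle I₁ M₁ × TangentBundle I₂ M₂ =>
        (⟨f q.1.1 q.2.1, mfderiv I₁ I₃ (fun x => f x q.2.1) q.1.1 q.1.2 +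
          mfderiv I₂ I₃ (fun y => f q.1.1 y) q.2.1 q.2.2⟩ : TangentBundle I₃ M₃)) := by
  have h1 := hf.contMDiff_tangentMap (m := ∞) le_rfl
  have h2 : ContMDiff (I₁.tangent.prod I₂.tangent) (I₁.prod I₂).tangent ∞
      (equivTangentBundleProd I₁ M₁ I₂ M₂).symm := contMDiff_equivTangentBundleProd_symm
  have h3 := h1.comp h2
  refine h3.congr ?_
  intro q
  simp only [Function.comp, tangentMap]
  rw [mfderiv_prod_eq_add_apply (hf.mdifferentiableAt (by simp))]
  rfl

/-- The fundamental field is the differential of the action at the pair of `a` over the identity and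
the zero vector over `p`, both of which depend smoothly on `p`. -/
theorem contMDiff_fundamental
    (hact : ContMDiff ((𝓡 k).prod (𝓡 (m + 1 + k))) (𝓡 (m + 1 + k)) ∞
      (fun q : G × P => q.1 • q.2)) (a : LieAlg k) :
    ContMDiff (𝓡 (m + 1 + k)) (𝓡 (m + 1 + k)).tangent ∞
      (fun p => (⟨p, fundamental G P a p⟩ : TangentBundle (𝓡 (m + 1 + k)) P)) := by
  have h1 : ContMDiff (𝓡 (m + 1 + k)) (𝓡 k).tangent ∞
      (fun _ : P => (⟨1, a⟩ : TangentBundle (𝓡 k) G)) := contMDiff_const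
  have h2 : ContMDiff (𝓡 (m + 1 + k)) (𝓡 (m + 1 + k)).tangent ∞
      (fun p : P => (⟨p, 0⟩ : TangentBundle (𝓡 (m + 1 + k)) P)) :=
    Bundle.contMDiff_zeroSection ℝ _
  refine ((contMDiff_tangent_prod hact).comp (h1.prodMk h2)).congr ?_
  intro p
  have key : ∀ z : P, z = p → ∀ u v : EuclideanSpace ℝ (Fin (m + 1 + k)), u = v →
      (⟨p, u⟩ : TangentBundle (𝓡 (m + 1 + k)) P) = ⟨z, v⟩ := by rintro z rfl u v rfl; rfl
  refine key _ (one_smul G p) _ _ ?_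
  simp only [map_zero]
  exact (add_zero _).symm

/-- The velocities of the translates `g ↦ dg v` of a tangent vector. -/
theorem contMDiff_translate
    (hact : ContMDiff ((𝓡 k).prod (𝓡 (m + 1 + k))) (𝓡 (m + 1 + k)) ∞
      (fun q : G × P => q.1 • q.2)) {p : P} (v : TangentSpace (𝓡 (m + 1 + k)) p) :
    ContMDiff (𝓡 k) (𝓡 (m + 1 + k)).tangent ∞
      (fun g : G => (⟨g • p, mfderiv (𝓡 (m + 1 + k)) (𝓡 (m + 1 + k)) (fun q : P => g • q) p v⟩ :
        TangentBundle (𝓡 (m + 1 + k)) P)) := by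
  have h1 : ContMDiff (𝓡 k) (𝓡 k).tangent ∞
      (fun g : G => (⟨g, 0⟩ : TangentBundle (𝓡 k) G)) := Bundle.contMDiff_zeroSection ℝ _
  have h2 : ContMDiff (𝓡 k) (𝓡 (m + 1 + k)).tangent ∞
      (fun _ : G => (⟨p, v⟩ : TangentBundle (𝓡 (m + 1 + k)) P)) := contMDiff_const
  refine ((contMDiff_tangent_prod hact).comp (h1.prodMk h2)).congr ?_
  intro g
  simp only [Function.comp, map_zero, zero_add]

end Orbit
-- Lie derivatives along fundamental fields as derivatives of translates.
section Orbit

variable {k m : ℕ}  {F : Type*} [NormedAddCommGroup F] [NormedSpace ℝ F]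
  {G P : Type*}
  [TopologicalSpace G] [ChartedSpace (EuclideanSpace ℝ (Fin k)) G] [CommGroup G]
  [LieGroup (𝓡 k) ∞ G]
  [TopologicalSpace P] [ChartedSpace (EuclideanSpace ℝ (Fin (m + 1 + k))) P]
  [IsManifold (𝓡 (m + 1 + k)) ∞ P] [MulAction G P]

variable (G) in
/-- The pullback of a one-form along the action of `g`, evaluated on a tangent vector. -/
def translate (α : OneForm (m + 1 + k) P F) {p : P} (v : TangentSpace (𝓡 (m + 1 + k)) p) (g : G) :
    F :=
  α (g • p) (mfderiv (𝓡 (m + 1 + k)) (𝓡 (m + 1 + k)) (fun q : P => g • q) p v)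

theorem contMDiffAt_translate
    (hact : ContMDiff ((𝓡 k).prod (𝓡 (m + 1 + k))) (𝓡 (m + 1 + k)) ∞
      (fun q : G × P => q.1 • q.2))
    {α : OneForm (m + 1 + k) P F} {U : Set P} (hU : IsOpen U) (hα : SmoothFormOn α U)
    {p : P} (v : TangentSpace (𝓡 (m + 1 + k)) p) {g : G} (hg : g • p ∈ U) :
    ContMDiffAt (𝓡 k) 𝓘(ℝ, F) ∞ (translate G α v) g :=
  ContMDiffAt.comp g (hα.contMDiffAt ((isOpen_fiberPreimage hU).mem_nhds (x :=
    (⟨g • p, mfderiv (𝓡 (m + 1 + k)) (𝓡 (m + 1 + k)) (fun q : P => g • q) p v⟩ :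
      TangentBundle (𝓡 (m + 1 + k)) P)) hg)) (contMDiff_translate hact v g)

/-- The action in charts. -/
def coordAction (G : Type*) [TopologicalSpace G] [ChartedSpace (EuclideanSpace ℝ (Fin k)) G]
    [CommGroup G] [MulAction G P] (p : P)
    (q : EuclideanSpace ℝ (Fin k) × EuclideanSpace ℝ (Fin (m + 1 + k))) :
    EuclideanSpace ℝ (Fin (m + 1 + k)) :=
  extChartAt (𝓡 (m + 1 + k)) p
    ((extChartAt (𝓡 k) (1 : G)).symm q.1 • (extChartAt (𝓡 (m + 1 + k)) p).symm q.2)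

theorem contDiffAt_coordAction
    (hact : ContMDiff ((𝓡 k).prod (𝓡 (m + 1 + k))) (𝓡 (m + 1 + k)) ∞
      (fun q : G × P => q.1 • q.2)) (p : P) :
    ContDiffAt ℝ ∞ (coordAction G p)
      (extChartAt (𝓡 k) (1 : G) 1, extChartAt (𝓡 (m + 1 + k)) p p) := by
  have h1 : ContMDiffAt 𝓘(ℝ, EuclideanSpace ℝ (Fin k) × EuclideanSpace ℝ (Fin (m + 1 + k)))
      (𝓡 k) ∞ (fun q => (extChartAt (𝓡 k) (1 : G)).symm q.1)
      (extChartAt (𝓡 k) (1 : G) 1, extChartAt (𝓡 (m + 1 + k)) p p) :=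
    ContMDiffAt.comp _ (((contMDiffOn_extChartAt_symm (I := 𝓡 k) (n := ∞) (1 : G)).contMDiffAt
      (x := extChartAt (𝓡 k) (1 : G) 1) (extChartAt_target_mem_nhds (1 : G)))) contDiffAt_fst.contMDiffAt
  have h2 : ContMDiffAt 𝓘(ℝ, EuclideanSpace ℝ (Fin k) × EuclideanSpace ℝ (Fin (m + 1 + k)))
      (𝓡 (m + 1 + k)) ∞ (fun q => (extChartAt (𝓡 (m + 1 + k)) p).symm q.2)
      (extChartAt (𝓡 k) (1 : G) 1, extChartAt (𝓡 (m + 1 + k)) p p) :=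
    ContMDiffAt.comp _ (((contMDiffOn_extChartAt_symm (I := 𝓡 (m + 1 + k)) (n := ∞) p).contMDiffAt
      (x := extChartAt (𝓡 (m + 1 + k)) p p) (extChartAt_target_mem_nhds p))) contDiffAt_snd.contMDiffAt
  have h3 := ContMDiffAt.comp_of_eq (x := (extChartAt (𝓡 k) (1 : G) 1,
    extChartAt (𝓡 (m + 1 + k)) p p)) (contMDiffAt_extChartAt (I := 𝓡 (m + 1 + k)) (n := ∞) (x := p))
    (ContMDiffAt.comp _ (hact.contMDiffAt) (h1.prodMk h2)) (by
      simp [Function.comp])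
  exact h3.contDiffAt

/-- Equality near the centre, not only at it, is needed because the Lie bracket differentiates this
field. -/
theorem fderiv_coordAction_left
    (hact : ContMDiff ((𝓡 k).prod (𝓡 (m + 1 + k))) (𝓡 (m + 1 + k)) ∞
      (fun q : G × P => q.1 • q.2)) (p : P) (a : LieAlg k) :
    (fun y => fderiv ℝ (coordAction G p) (extChartAt (𝓡 k) (1 : G) 1, y) (a, 0))
      =ᶠ[nhds (extChartAt (𝓡 (m + 1 + k)) p p)] coordField p (fundamental G P a) := by
  have h1 : ∀ᶠ y in nhds (extChartAt (𝓡 (m + 1 + k)) p p),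
      DifferentiableAt ℝ (coordAction G p) (extChartAt (𝓡 k) (1 : G) 1, y) := by
    -- Finite differentiability at a point persists nearby, which is why the order is first lowered
    -- from `∞` to `1`.
    have := ((contDiffAt_coordAction hact p).of_le (m := 1) (by simp)).eventually (by simp)
    exact ((Continuous.prodMk_right (extChartAt (𝓡 k) (1 : G) 1)).tendsto _).eventually
      (this.mono fun z hz => hz.differentiableAt (by simp))
  filter_upwards [h1, extChartAt_target_mem_nhds (I := 𝓡 (m + 1 + k)) p] with y hy hyt
  rw [fderiv_prodMk_left hy]
  have hq : (extChartAt (𝓡 (m + 1 + k)) p).symm y ∈ (extChartAt (𝓡 (m + 1 + k)) p).source :=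
    (extChartAt (𝓡 (m + 1 + k)) p).map_target hyt
  have hφ : MDifferentiableAt (𝓡 (m + 1 + k)) 𝓘(ℝ, EuclideanSpace ℝ (Fin (m + 1 + k)))
      (extChartAt (𝓡 (m + 1 + k)) p) ((1 : G) • (extChartAt (𝓡 (m + 1 + k)) p).symm y) := by
    rw [one_smul]
    exact mdifferentiableAt_extChartAt (by rwa [← extChartAt_source (I := 𝓡 (m + 1 + k))])
  have hs : MDifferentiableAt (𝓡 k) (𝓡 (m + 1 + k))
      (fun g : G => g • (extChartAt (𝓡 (m + 1 + k)) p).symm y) 1 :=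
    (contMDiff_smul_const_of_smul hact _).mdifferentiableAt (by simp)
  have hc := hφ.comp 1 hs
  refine (mfderiv_eq_fderiv_chart hc a).symm.trans ?_
  rw [mfderiv_comp 1 hφ hs]
  have key : ∀ z : P, z = (extChartAt (𝓡 (m + 1 + k)) p).symm y →
      ∀ u : EuclideanSpace ℝ (Fin (m + 1 + k)),
      mfderiv (𝓡 (m + 1 + k)) 𝓘(ℝ, EuclideanSpace ℝ (Fin (m + 1 + k)))
        (extChartAt (𝓡 (m + 1 + k)) p) z u =
      mfderiv (𝓡 (m + 1 + k)) 𝓘(ℝ, EuclideanSpace ℝ (Fin (m + 1 + k)))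
        (extChartAt (𝓡 (m + 1 + k)) p) ((extChartAt (𝓡 (m + 1 + k)) p).symm y) u := by
    rintro z rfl u; rfl
  exact key _ (one_smul G _) _

/-- Identifies the family differentiated in `fderiv_pullback_family` with `translate`, read in the
chart at `1`. -/
theorem fderiv_coordAction_right
    (hact : ContMDiff ((𝓡 k).prod (𝓡 (m + 1 + k))) (𝓡 (m + 1 + k)) ∞
      (fun q : G × P => q.1 • q.2)) (p : P) (v : EuclideanSpace ℝ (Fin (m + 1 + k)))
    (α : OneForm (m + 1 + k) P F) :
    (fun s => coordForm p α (coordAction G p (s, extChartAt (𝓡 (m + 1 + k)) p p))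
      (fderiv ℝ (coordAction G p) (s, extChartAt (𝓡 (m + 1 + k)) p p) (0, v)))
      =ᶠ[nhds (extChartAt (𝓡 k) (1 : G) 1)]
        translate G α (p := p) v ∘ (extChartAt (𝓡 k) (1 : G)).symm := by
  have h1 : ∀ᶠ s in nhds (extChartAt (𝓡 k) (1 : G) 1),
      DifferentiableAt ℝ (coordAction G p) (s, extChartAt (𝓡 (m + 1 + k)) p p) := by
    have := ((contDiffAt_coordAction hact p).of_le (m := 1) (by simp)).eventually (by simp)
    exact ((Continuous.prodMk_left (extChartAt (𝓡 (m + 1 + k)) p p)).tendsto _).eventually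
      (this.mono fun z hz => hz.differentiableAt (by simp))
  have h2 : ∀ᶠ s in nhds (extChartAt (𝓡 k) (1 : G) 1),
      (extChartAt (𝓡 k) (1 : G)).symm s • p ∈ (extChartAt (𝓡 (m + 1 + k)) p).source := by
    have hc : ContinuousAt (fun s => (extChartAt (𝓡 k) (1 : G)).symm s • p)
        (extChartAt (𝓡 k) (1 : G) 1) :=
      (contMDiff_smul_const_of_smul hact p).continuous.continuousAt.comp
        (continuousAt_extChartAt_symm (1 : G))
    refine hc.eventually_mem ?_
    rw [extChartAt_to_inv, one_smul]
    exact extChartAt_source_mem_nhds p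
  filter_upwards [h1, h2] with s hs hsrc
  rw [fderiv_prodMk_right hs]
  set g := (extChartAt (𝓡 k) (1 : G)).symm s with hg
  have hφ : MDifferentiableAt (𝓡 (m + 1 + k)) 𝓘(ℝ, EuclideanSpace ℝ (Fin (m + 1 + k)))
      (extChartAt (𝓡 (m + 1 + k)) p) (g • p) :=
    mdifferentiableAt_extChartAt (by rwa [← extChartAt_source (I := 𝓡 (m + 1 + k))])
  have hgs : MDifferentiableAt (𝓡 (m + 1 + k)) (𝓡 (m + 1 + k)) (fun q : P => g • q) p :=
    (contMDiff_const_smul_of_smul hact g).mdifferentiableAt (by simp)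
  have hc := hφ.comp p hgs
  have h3 : fderiv ℝ (fun y => coordAction G p (s, y)) (extChartAt (𝓡 (m + 1 + k)) p p) v =
      mfderiv (𝓡 (m + 1 + k)) 𝓘(ℝ, EuclideanSpace ℝ (Fin (m + 1 + k)))
        (extChartAt (𝓡 (m + 1 + k)) p) (g • p)
        (mfderiv (𝓡 (m + 1 + k)) (𝓡 (m + 1 + k)) (fun q : P => g • q) p v) := by
    refine (mfderiv_eq_fderiv_chart hc v).symm.trans ?_
    rw [mfderiv_comp p hφ hgs]
    rfl
  rw [h3]
  have h4 : coordAction G p (s, extChartAt (𝓡 (m + 1 + k)) p p) =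
      extChartAt (𝓡 (m + 1 + k)) p (g • p) := by
    simp [coordAction, hg]
  rw [h4]
  exact coordForm_mfderiv hsrc α _

/-- The Lie derivative along a fundamental vector field is the derivative of the pullbacks along
the group action. -/
theorem mfderiv_translate
    (hact : ContMDiff ((𝓡 k).prod (𝓡 (m + 1 + k))) (𝓡 (m + 1 + k)) ∞
      (fun q : G × P => q.1 • q.2))
    {α : OneForm (m + 1 + k) P F} {U : Set P} (hU : IsOpen U) (hα : SmoothFormOn α U)
    {p : P} (hp : p ∈ U) {Y : ∀ q : P, TangentSpace (𝓡 (m + 1 + k)) q}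
    (hY : ContMDiffAt (𝓡 (m + 1 + k)) (𝓡 (m + 1 + k)).tangent ∞
      (fun q => (⟨q, Y q⟩ : TangentBundle (𝓡 (m + 1 + k)) P)) p) (a : LieAlg k) :
    (mfderiv (𝓡 k) 𝓘(ℝ, F) (translate G α (Y p)) 1 a : F) =
      lieDeriv (fundamental G P a) α Y p := by
  have hid : ∀ᶠ y in nhds (extChartAt (𝓡 (m + 1 + k)) p p),
      coordAction G p (extChartAt (𝓡 k) (1 : G) 1, y) = y := by
    filter_upwards [extChartAt_target_mem_nhds (I := 𝓡 (m + 1 + k)) p] with y hy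
    rw [coordAction, extChartAt_to_inv, one_smul, (extChartAt (𝓡 (m + 1 + k)) p).right_inv hy]
  have hdα : DifferentiableAt ℝ (coordForm p α) (extChartAt (𝓡 (m + 1 + k)) p p) :=
    (contDiffAt_coordForm hα hU hp).differentiableAt (by simp)
  have hdY := (contDiffAt_coordField hY).differentiableAt (by simp)
  have main := fderiv_pullback_family (contDiffAt_coordAction hact p) hid hdα hdY a
  have h6 : fderiv ℝ (coordAction G p) (extChartAt (𝓡 k) (1 : G) 1,
      extChartAt (𝓡 (m + 1 + k)) p p) (a, 0) = fundamental G P a p :=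
    (fderiv_coordAction_left hact p a).self_of_nhds.trans (coordField_self p _)
  rw [(fderiv_coordAction_left hact p a).lieBracket_vectorField_eq Filter.EventuallyEq.rfl,
    h6, coordField_self, (fderiv_coordAction_right hact p (Y p) α).fderiv_eq,
    ← mlieBracket_eq_lieBracket] at main
  have hdt : MDifferentiableAt (𝓡 k) 𝓘(ℝ, F) (translate G α (Y p)) 1 :=
    (contMDiffAt_translate hact hU hα (Y p) (by rwa [one_smul])).mdifferentiableAt (by simp)
  have hdαY : MDifferentiableAt (𝓡 (m + 1 + k)) 𝓘(ℝ, F) (fun q => α q (Y q)) p :=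
    (ContMDiffAt.comp p (hα.contMDiffAt ((isOpen_fiberPreimage hU).mem_nhds (x :=
      (⟨p, Y p⟩ : TangentBundle (𝓡 (m + 1 + k)) P)) hp)) hY).mdifferentiableAt (by simp)
  have h5 : (fun y => coordForm p α y (coordField p Y y))
      =ᶠ[nhds (extChartAt (𝓡 (m + 1 + k)) p p)]
      (fun q => α q (Y q)) ∘ (extChartAt (𝓡 (m + 1 + k)) p).symm := by
    filter_upwards [extChartAt_target_mem_nhds (I := 𝓡 (m + 1 + k)) p] with y hy
    exact coordForm_coordField hy α Y
  rw [h5.fderiv_eq] at main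
  refine (mfderiv_eq_fderiv_chart hdt a).trans (main.trans ?_)
  exact congrArg₂ (· - ·) (mfderiv_eq_fderiv_chart hdαY (fundamental G P a p)).symm
    (coordForm_self p α _)

end Orbit

/-! ### The pairing and the groups SO(η). -/

section Pairing

variable {ν : Type*} [Fintype ν] [DecidableEq ν]

theorem pairing_mulVec {κ : Type*} [Fintype κ] (η : Matrix ν ν ℝ) (A B : Matrix ν κ ℝ)
    (v w : κ → ℝ) :
    pairing η (A.mulVec v) (B.mulVec w) = pairing (A.transpose * η * B) v w := by
  rw [pairing, pairing, ← Matrix.vecMul_transpose A v, ← Matrix.dotProduct_mulVec,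
    Matrix.mulVec_mulVec, Matrix.mulVec_mulVec]

theorem pairing_single (η : Matrix ν ν ℝ) (i j : ν) :
    pairing η (Pi.single i 1) (Pi.single j 1) = η i j := by
  simp [pairing]

theorem pairing_injective {η η' : Matrix ν ν ℝ} (h : ∀ v w, pairing η v w = pairing η' v w) :
    η = η' := by
  ext i j
  rw [← pairing_single η, ← pairing_single η', h]

theorem fderiv_pairing {E : Type*} [NormedAddCommGroup E] [NormedSpace ℝ E] (η : Matrix ν ν ℝ)
    {f h : E → ν → ℝ} {s : E} (hf : DifferentiableAt ℝ f s) (hh : DifferentiableAt ℝ h s) (a : E) :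
    DifferentiableAt ℝ (fun s => pairing η (f s) (h s)) s ∧
    fderiv ℝ (fun s => pairing η (f s) (h s)) s a =
      pairing η (fderiv ℝ f s a) (h s) + pairing η (f s) (fderiv ℝ h s a) := by
  have hf' := hasFDerivAt_pi'.1 hf.hasFDerivAt
  have hh' := hasFDerivAt_pi'.1 hh.hasFDerivAt
  have key : HasFDerivAt (fun s => pairing η (f s) (h s)) _ s :=
    HasFDerivAt.fun_sum (u := Finset.univ) fun i _ => (hf' i).mul
      (HasFDerivAt.fun_sum (u := Finset.univ) fun j _ => (hh' j).const_mul (η i j))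
  refine ⟨key.differentiableAt, ?_⟩
  rw [key.fderiv]
  simp only [pairing, dotProduct, Matrix.mulVec, FunLike.coe_sum,
    Finset.sum_apply, add_apply, smul_apply,
    ContinuousLinearMap.comp_apply, ContinuousLinearMap.proj_apply, smul_eq_mul,
    Finset.sum_add_distrib, add_comm]
  congr 1
  refine Finset.sum_congr rfl fun i _ => ?_
  rw [mul_comm]

/-- Expanding `v` in the dual frame of an invertible coframe turns derivatives and translates of the
coframe into square matrices. -/
theorem linearMap_eq_mulVec {V : Type*} [AddCommGroup V] [Module ℝ V] [TopologicalSpace V]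
    (f : V →ₗ[ℝ] (ν → ℝ)) (e : V →L[ℝ] (ν → ℝ)) (he : e.IsInvertible) (v : V) :
    f v = (Matrix.of fun i j => f (e.inverse (Pi.single j 1)) i).mulVec (e v) := by
  have hv : v = e.inverse (∑ j, (e v j) • Pi.single j (1 : ℝ)) := by
    rw [← pi_eq_sum_univ' (e v), he.inverse_apply_self]
  ext i
  conv_lhs => rw [hv]
  simp only [map_sum, map_smul, Finset.sum_apply, Pi.smul_apply, smul_eq_mul, Matrix.mulVec,
    dotProduct, Matrix.of_apply]
  exact Finset.sum_congr rfl fun j _ => mul_comm _ _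

theorem SO.mul_mem {η A B : Matrix ν ν ℝ} (hA : A ∈ SO η) (hB : B ∈ SO η) : A * B ∈ SO η := by
  refine ⟨?_, by rw [Matrix.det_mul, hA.2, hB.2, one_mul]⟩
  rw [Matrix.transpose_mul]
  calc B.transpose * A.transpose * η * (A * B) = B.transpose * (A.transpose * η * A) * B := by
        simp only [Matrix.mul_assoc]
    _ = η := by rw [hA.1, hB.1]

theorem SO.inv_mem {η A : Matrix ν ν ℝ} (hA : A ∈ SO η) : A⁻¹ ∈ SO η := by
  have hu : IsUnit A.det := by rw [hA.2]; exact isUnit_one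
  refine ⟨?_, by rw [Matrix.det_nonsing_inv, hA.2, Ring.inverse_one]⟩
  conv_lhs => rw [← hA.1]
  calc A⁻¹.transpose * (A.transpose * η * A) * A⁻¹
      = (A * A⁻¹).transpose * η * (A * A⁻¹) := by
        rw [Matrix.transpose_mul]; simp only [Matrix.mul_assoc]
    _ = η := by rw [Matrix.mul_nonsing_inv A hu]; simp

theorem SO.inv_mul {η A : Matrix ν ν ℝ} (hA : A ∈ SO η) : A⁻¹ * A = 1 :=
  Matrix.nonsing_inv_mul A (by rw [hA.2]; exact isUnit_one)

theorem SO.pairing_eq {η A : Matrix ν ν ℝ} (hA : A ∈ SO η) (v w : ν → ℝ) :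
    pairing η (A.mulVec v) (A.mulVec w) = pairing η v w := by
  rw [pairing_mulVec, hA.1]

end Pairing

/-! ### From infinitesimal to global invariance on a connected group. -/

section Orbit

variable {k m : ℕ}  {F : Type*} [NormedAddCommGroup F] [NormedSpace ℝ F]
  {G P : Type*}
  [TopologicalSpace G] [ChartedSpace (EuclideanSpace ℝ (Fin k)) G] [CommGroup G]
  [LieGroup (𝓡 k) ∞ G]
  [TopologicalSpace P] [ChartedSpace (EuclideanSpace ℝ (Fin (m + 1 + k))) P]
  [IsManifold (𝓡 (m + 1 + k)) ∞ P] [MulAction G P]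

/-- On a ball in a chart the derivative vanishes on a convex set, so the function is locally
constant; connectedness does the rest. -/
theorem eq_of_mfderiv_eq_zero [ConnectedSpace G] {f : G → F}
    (hf : ∀ g, HasMFDerivAt (𝓡 k) 𝓘(ℝ, F) f g (0 : EuclideanSpace ℝ (Fin k) →L[ℝ] F)) (g h : G) :
    f g = f h := by
  refine IsLocallyConstant.apply_eq_of_preconnectedSpace ?_ g h
  rw [IsLocallyConstant.iff_eventually_eq]
  intro x
  obtain ⟨r, hr, hball⟩ := Metric.mem_nhds_iff.1 (extChartAt_target_mem_nhds (I := 𝓡 k) x)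
  have hd : ∀ y ∈ Metric.ball (extChartAt (𝓡 k) x x) r,
      HasFDerivAt (f ∘ (extChartAt (𝓡 k) x).symm)
        (0 : EuclideanSpace ℝ (Fin k) →L[ℝ] F) y := by
    intro y hy
    have h1 : MDifferentiableAt 𝓘(ℝ, EuclideanSpace ℝ (Fin k)) (𝓡 k) (extChartAt (𝓡 k) x).symm y :=
      ((contMDiffOn_extChartAt_symm (I := 𝓡 k) (n := ∞) x).contMDiffAt
        ((isOpen_extChartAt_target x).mem_nhds (hball hy))).mdifferentiableAt (by simp)
    have h2 := (hf _).comp y h1.hasMFDerivAt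
    have h3 := hasMFDerivAt_iff_hasFDerivAt.1 h2
    refine h3.congr_fderiv ?_
    exact ContinuousLinearMap.zero_comp _
  have hc := fun y hy => (convex_ball (extChartAt (𝓡 k) x x) r).is_const_of_fderivWithin_eq_zero
    (𝕜 := ℝ) (y := extChartAt (𝓡 k) x x) (x := y)
    (f := f ∘ (extChartAt (𝓡 k) x).symm)
    (fun y hy => (hd y hy).differentiableAt.differentiableWithinAt)
    (fun y hy => by
      rw [fderivWithin_of_isOpen Metric.isOpen_ball hy, (hd y hy).fderiv]) hy (Metric.mem_ball_self hr)
  filter_upwards [(continuousAt_extChartAt (I := 𝓡 k) x).preimage_mem_nhds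
    (Metric.ball_mem_nhds _ hr), extChartAt_source_mem_nhds (I := 𝓡 k) x] with y hy hys
  have := hc _ hy
  rwa [Function.comp_apply, Function.comp_apply, (extChartAt (𝓡 k) x).left_inv hys,
    extChartAt_to_inv] at this

/-- A function on a connected Lie group is constant if the derivatives of its translates vanish
at the identity. -/
theorem eq_of_translates [ConnectedSpace G] {f : G → F}
    (hf : ∀ g₀ : G, ∃ h : G → F, (∀ g, f (g * g₀) = h g) ∧ MDifferentiableAt (𝓡 k) 𝓘(ℝ, F) h 1 ∧
      ∀ a : LieAlg k, (mfderiv (𝓡 k) 𝓘(ℝ, F) h 1 a : F) = 0) (g h : G) : f g = f h := by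
  refine eq_of_mfderiv_eq_zero (k := k) (fun g₀ => ?_) g h
  obtain ⟨h, hfh, hd, hz⟩ := hf g₀
  have h1 : HasMFDerivAt (𝓡 k) 𝓘(ℝ, F) h (g₀ * g₀⁻¹) (0 : EuclideanSpace ℝ (Fin k) →L[ℝ] F) := by
    rw [mul_inv_cancel]
    have h0 := hd.hasMFDerivAt
    have hz' : (mfderiv (𝓡 k) 𝓘(ℝ, F) h 1 : EuclideanSpace ℝ (Fin k) →L[ℝ] F) = 0 := by
      ext a
      exact hz a
    exact hz' ▸ h0
  -- `f` is `h` after right translation by `g₀⁻¹`, which carries `g₀` to the identity; the chain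
  -- rule moves the vanishing derivative to `g₀`.
  have h2 : MDifferentiableAt (𝓡 k) (𝓡 k) (fun g : G => g * g₀⁻¹) g₀ :=
    ((contMDiff_mul_right (I := 𝓡 k) (n := ∞) (a := g₀⁻¹)).mdifferentiableAt (by simp))
  have h3 := h1.comp g₀ h2.hasMFDerivAt
  have h4 : h ∘ (fun g : G => g * g₀⁻¹) = f := by
    ext g; simp [← hfh]
  rw [h4] at h3
  have h5 : ∀ L : EuclideanSpace ℝ (Fin k) →L[ℝ] EuclideanSpace ℝ (Fin k),
      (0 : EuclideanSpace ℝ (Fin k) →L[ℝ] F).comp L = 0 := ContinuousLinearMap.zero_comp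
  exact h5 _ ▸ h3

/-- Chain rule for the composite of two translations. It makes every group element look like the
identity, as `eq_of_translates` requires. -/
theorem translate_mul
    (hact : ContMDiff ((𝓡 k).prod (𝓡 (m + 1 + k))) (𝓡 (m + 1 + k)) ∞
      (fun q : G × P => q.1 • q.2)) (α : OneForm (m + 1 + k) P F) {p : P}
    (v : TangentSpace (𝓡 (m + 1 + k)) p) (g g₀ : G) :
    translate G α v (g * g₀) =
      translate G α (mfderiv (𝓡 (m + 1 + k)) (𝓡 (m + 1 + k)) (fun q : P => g₀ • q) p v) g := by
  have key : ∀ f f' : P → P, f = f' → α (f p) (mfderiv (𝓡 (m + 1 + k)) (𝓡 (m + 1 + k)) f p v) =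
      α (f' p) (mfderiv (𝓡 (m + 1 + k)) (𝓡 (m + 1 + k)) f' p v) := by rintro f _ rfl; rfl
  refine (key (fun q => (g * g₀) • q) ((fun q => g • q) ∘ (fun q => g₀ • q))
    (funext fun q => mul_smul g g₀ q)).trans ?_
  rw [mfderiv_comp p ((contMDiff_const_smul_of_smul hact g).mdifferentiableAt (by simp))
    ((contMDiff_const_smul_of_smul hact g₀).mdifferentiableAt (by simp))]
  rfl

theorem translate_one (α : OneForm (m + 1 + k) P F) {p : P}
    (v : TangentSpace (𝓡 (m + 1 + k)) p) : translate G α v 1 = α p v := by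
  have key : ∀ f f' : P → P, f = f' → α (f p) (mfderiv (𝓡 (m + 1 + k)) (𝓡 (m + 1 + k)) f p v) =
      α (f' p) (mfderiv (𝓡 (m + 1 + k)) (𝓡 (m + 1 + k)) f' p v) := by rintro f _ rfl; rfl
  refine (key (fun q => (1 : G) • q) id (funext fun q => one_smul G q)).trans ?_
  rw [mfderiv_id]
  rfl

/-- The derivative of the translates at `g₀` is, by `translate_mul`, a Lie derivative at `g₀ • p`,
which vanishes; hence they are constant in `g`. -/
theorem translate_eq_of_lieDerivVanishesOn [ConnectedSpace G]
    (hact : ContMDiff ((𝓡 k).prod (𝓡 (m + 1 + k))) (𝓡 (m + 1 + k)) ∞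
      (fun q : G × P => q.1 • q.2))
    {α : OneForm (m + 1 + k) P F} {U : Set P} (hU : IsOpen U) (hα : SmoothFormOn α U)
    (hUG : ∀ (g : G), ∀ p ∈ U, g • p ∈ U)
    (hL : ∀ a : LieAlg k, LieDerivVanishesOn (fundamental G P a) α U) {p : P} (hp : p ∈ U)
    (v : TangentSpace (𝓡 (m + 1 + k)) p) (g : G) : translate G α v g = α p v := by
  rw [← translate_one (G := G) α v]
  refine eq_of_translates (k := k) (fun g₀ => ⟨_, fun g => translate_mul hact α v g g₀, ?_⟩) g 1
  have hq : g₀ • p ∈ U := hUG g₀ p hp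
  obtain ⟨Y, hY, hYq⟩ := exists_smooth_extension (g₀ • p)
    (mfderiv (𝓡 (m + 1 + k)) (𝓡 (m + 1 + k)) (fun q : P => g₀ • q) p v)
  rw [← hYq]
  exact ⟨(contMDiffAt_translate hact hU hα (Y _) (by rwa [one_smul])).mdifferentiableAt (by simp),
    fun a => (mfderiv_translate hact hU hα hq hY a).trans (hL a _ hq Y hY)⟩

theorem lieDerivVanishesOn_of_translate_eq
    (hact : ContMDiff ((𝓡 k).prod (𝓡 (m + 1 + k))) (𝓡 (m + 1 + k)) ∞
      (fun q : G × P => q.1 • q.2))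
    {α : OneForm (m + 1 + k) P F} {U : Set P} (hU : IsOpen U) (hα : SmoothFormOn α U)
    (h : ∀ p ∈ U, ∀ (v : TangentSpace (𝓡 (m + 1 + k)) p) (g : G), translate G α v g = α p v)
    (a : LieAlg k) : LieDerivVanishesOn (fundamental G P a) α U := by
  intro p hp Y hY
  rw [← mfderiv_translate hact hU hα hp hY a]
  have : translate G α (Y p) = fun _ => α p (Y p) := funext (h p hp (Y p))
  rw [this, mfderiv_const]
  rfl

end Orbit

/-! ### Smoothness of the dual frame. -/

section DualFrame

variable {n : ℕ} {M : Type*} [TopologicalSpace M] [ChartedSpace (EuclideanSpace ℝ (Fin n)) M]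
  [IsManifold (𝓡 n) ∞ M] {ν : Type*} [Fintype ν] [DecidableEq ν]

theorem coordForm_isInvertible {p : M} {e : OneForm n M (ν → ℝ)} {y : EuclideanSpace ℝ (Fin n)}
    (hy : y ∈ (extChartAt (𝓡 n) p).target) (he : (e ((extChartAt (𝓡 n) p).symm y)).IsInvertible) :
    (coordForm p e y).IsInvertible := by
  have : IsManifold (𝓡 n) 1 M := IsManifold.of_le (n := ∞) (by simp)
  have h := isInvertible_mfderivWithin_extChartAt_symm (I := 𝓡 n) hy
  rw [ModelWithCorners.range_eq_univ, mfderivWithin_univ] at h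
  exact he.comp h

/-- Inversion of continuous linear maps is smooth at invertible ones, so the coordinates of the dual
frame are smooth. This is what allows Lie derivatives to be evaluated on the dual frame. -/
theorem contMDiffAt_dualFrame {e : OneForm n M (ν → ℝ)} {U : Set M} (hU : IsOpen U)
    (he : SmoothFormOn e U) (hi : ∀ x ∈ U, (e x).IsInvertible) (b : ν) {p : M} (hp : p ∈ U) :
    ContMDiffAt (𝓡 n) (𝓡 n).tangent ∞
      (fun x => (⟨x, dualFrame e b x⟩ : TangentBundle (𝓡 n) M)) p := by
  have h1 := contDiffAt_coordForm he hU hp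
  have h2 : (coordForm p e (extChartAt (𝓡 n) p p)).IsInvertible :=
    coordForm_isInvertible (mem_extChartAt_target p) (by rw [extChartAt_to_inv]; exact hi p hp)
  have h3 : ContDiffAt ℝ ∞ (fun y => (coordForm p e y).inverse (Pi.single b 1))
      (extChartAt (𝓡 n) p p) :=
    (ContDiffAt.comp (extChartAt (𝓡 n) p p) h2.contDiffAt_map_inverse h1).clm_apply
      contDiffAt_const
  refine (contMDiffAt_ofCoordField h3).congr_of_eventuallyEq ?_
  filter_upwards [extChartAt_source_mem_nhds (I := 𝓡 n) p, hU.mem_nhds hp] with x hx hxU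
  have key : ∀ u v : TangentSpace (𝓡 n) x, u = v →
      (⟨x, u⟩ : TangentBundle (𝓡 n) M) = ⟨x, v⟩ := by rintro u _ rfl; rfl
  refine key _ _ ((hi x hxU).inverse_apply_eq.2 ?_)
  obtain ⟨y, hy, rfl⟩ : ∃ y ∈ (extChartAt (𝓡 n) p).target, (extChartAt (𝓡 n) p).symm y = x :=
    ⟨_, (extChartAt (𝓡 n) p).map_source hx, (extChartAt (𝓡 n) p).left_inv hx⟩
  have h4 := (coordForm_isInvertible hy (hi _ hxU)).self_apply_inverse (Pi.single b 1)
  refine h4.symm.trans ?_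
  have h5 : ∀ z, z = y → coordForm p e y ((coordForm p e y).inverse (Pi.single b 1)) =
      e ((extChartAt (𝓡 n) p).symm y) (mfderiv 𝓘(ℝ, EuclideanSpace ℝ (Fin n)) (𝓡 n)
        (extChartAt (𝓡 n) p).symm z ((coordForm p e z).inverse (Pi.single b 1))) := by
    rintro z rfl; rfl
  exact h5 _ ((extChartAt (𝓡 n) p).right_inv hy)

end DualFrame

/-! ### The Kosmann condition and invariance of the metric. -/

section Kosmann

variable {k m : ℕ} {A G P : Type*}
  [TopologicalSpace G] [ChartedSpace (EuclideanSpace ℝ (Fin k)) G] [CommGroup G]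
  [LieGroup (𝓡 k) ∞ G]
  [TopologicalSpace P] [ChartedSpace (EuclideanSpace ℝ (Fin (m + 1 + k))) P]
  [IsManifold (𝓡 (m + 1 + k)) ∞ P] [MulAction G P] {ν : Type*} [Fintype ν] [DecidableEq ν]

/-- The derivative of the translates of a coframe at the identity. -/
theorem mfderiv_translate_coframe
    (hact : ContMDiff ((𝓡 k).prod (𝓡 (m + 1 + k))) (𝓡 (m + 1 + k)) ∞
      (fun q : G × P => q.1 • q.2))
    {e : OneForm (m + 1 + k) P (ν → ℝ)} {U : Set P} (hU : IsOpen U) (he : SmoothFormOn e U)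
    (hi : ∀ p ∈ U, (e p).IsInvertible) {p : P} (hp : p ∈ U) (a : LieAlg k)
    (v : TangentSpace (𝓡 (m + 1 + k)) p) :
    (mfderiv (𝓡 k) 𝓘(ℝ, ν → ℝ) (translate G e v) 1 a : ν → ℝ) =
      (Matrix.of fun c b => lieDeriv (fundamental G P a) e (dualFrame e b) p c).mulVec (e p v) := by
  have hd : ∀ v : TangentSpace (𝓡 (m + 1 + k)) p,
      MDifferentiableAt (𝓡 k) 𝓘(ℝ, ν → ℝ) (translate G e v) 1 := fun v =>
    (contMDiffAt_translate hact hU he v (by rwa [one_smul])).mdifferentiableAt (by simp)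
  -- The derivative is linear in `v`, so its matrix can be read off on the dual frame, whose members
  -- are smooth vector fields.
  let D : TangentSpace (𝓡 (m + 1 + k)) p →ₗ[ℝ] (ν → ℝ) :=
    { toFun := fun v => mfderiv (𝓡 k) 𝓘(ℝ, ν → ℝ) (translate G e v) 1 a
      map_add' := fun v w => by
        have h1 : translate G e (v + w) = translate G e v + translate G e w := by
          ext1 g; simp only [translate, map_add, Pi.add_apply]
        rw [h1, mfderiv_add (hd v) (hd w)]
        rfl
      map_smul' := fun c v => by
        have h1 : translate G e (c • v) = c • translate G e v := by
          ext1 g; simp only [translate, map_smul, Pi.smul_apply]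
        rw [h1, const_smul_mfderiv (hd v) c]
        rfl }
  have h1 := linearMap_eq_mulVec D (e p) (hi p hp) v
  refine h1.trans (congrArg (fun L : Matrix ν ν ℝ => L.mulVec (e p v)) ?_)
  ext c b
  exact congrFun (mfderiv_translate hact hU he hp (contMDiffAt_dualFrame hU he hi b hp) a) c

/-- Vanishing of the Kosmann derivative kills the symmetric part of `η * L`, where `L` is the matrix
of the Lie derivative of `e`. So `L` is an infinitesimal isometry of `η`. -/
theorem mulVec_lieDeriv_skew {η : Matrix ν ν ℝ} (hη : η.transpose = η) (hdet : IsUnit η.det)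
    {ξ : ∀ x : P, TangentSpace (𝓡 (m + 1 + k)) x}
    {e : OneForm (m + 1 + k) P (ν → ℝ)} {p : P} (hi : (e p).IsInvertible)
    (h : ∀ v, kosmannLieDeriv η ξ e p v = 0) (v w : ν → ℝ) :
    pairing η ((Matrix.of fun c b => lieDeriv ξ e (dualFrame e b) p c).mulVec v) w +
      pairing η v ((Matrix.of fun c b => lieDeriv ξ e (dualFrame e b) p c).mulVec w) = 0 := by
  set L := Matrix.of fun c b => lieDeriv ξ e (dualFrame e b) p c with hL
  have h1 : η⁻¹ * ((1 / 2 : ℝ) • (lieComponents η ξ e p + (lieComponents η ξ e p).transpose))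
      = 0 := by
    refine Matrix.ext_of_mulVec_single fun i => ?_
    obtain ⟨v, hv⟩ := hi.surjective (Pi.single i 1)
    rw [← hv, Matrix.zero_mulVec]
    exact h v
  have h2 : lieComponents η ξ e p + (lieComponents η ξ e p).transpose = 0 := by
    have := congrArg (fun S => (2 : ℝ) • (η * S)) h1
    simpa [Matrix.mul_nonsing_inv_cancel_left _ _ hdet] using this
  have h3 : lieComponents η ξ e p = η * L := rfl
  rw [h3, Matrix.transpose_mul, hη] at h2
  have e1 := pairing_mulVec η L 1 v w
  have e2 := pairing_mulVec η 1 L v w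
  rw [Matrix.one_mulVec] at e1 e2
  rw [e1, e2, pairing, pairing, ← dotProduct_add, ← Matrix.add_mulVec]
  simp only [Matrix.mul_one, Matrix.transpose_one, Matrix.one_mul]
  rw [add_comm, h2, Matrix.zero_mulVec, dotProduct_zero]

theorem pairing_transition {η : Matrix ν ν ℝ} {W : A → Set P}
    {e : A → OneForm (m + 1 + k) P (ν → ℝ)} (he : IsCoframe η W e) {a b : A} {p : P}
    (ha : p ∈ W a) (hb : p ∈ W b) (v w : TangentSpace (𝓡 (m + 1 + k)) p) :
    pairing η (e a p v) (e a p w) = pairing η (e b p v) (e b p w) := by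
  obtain ⟨γ, hγ, h⟩ := he.transition a b p ⟨ha, hb⟩
  rw [h, h, SO.pairing_eq hγ]

/-- The metric of a Kosmann-invariant coframe is invariant. -/
theorem pairing_translate [ConnectedSpace G]
    (hact : ContMDiff ((𝓡 k).prod (𝓡 (m + 1 + k))) (𝓡 (m + 1 + k)) ∞
      (fun q : G × P => q.1 • q.2))
    {η : Matrix ν ν ℝ} (hη : η.transpose = η) (hdet : IsUnit η.det) {W : A → Set P}
    {e : A → OneForm (m + 1 + k) P (ν → ℝ)} (he : IsCoframe η W e)
    (hK : ∀ (a : LieAlg k) (i : A), ∀ p ∈ W i, ∀ v,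
      kosmannLieDeriv η (fundamental G P a) (e i) p v = 0)
    {a c : A} {p : P} {g : G} (ha : p ∈ W a) (hc : g • p ∈ W c)
    (v w : TangentSpace (𝓡 (m + 1 + k)) p) :
    pairing η (translate G (e c) v g) (translate G (e c) w g) =
      pairing η (e a p v) (e a p w) := by
  choose idx hidx using he.cover
  -- The representative at `g • p` is chosen point by point. Transition functions preserve the
  -- pairing, so the value does not depend on the choice.
  let f : P → ∀ p : P, TangentSpace (𝓡 (m + 1 + k)) p → TangentSpace (𝓡 (m + 1 + k)) p → G → ℝ :=
    fun _ p v w g => pairing η (translate G (e (idx (g • p))) v g)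
      (translate G (e (idx (g • p))) w g)
  have hf : ∀ (i : A) (p : P) (v w : TangentSpace (𝓡 (m + 1 + k)) p) (g : G), g • p ∈ W i →
      f p p v w g = pairing η (translate G (e i) v g) (translate G (e i) w g) :=
    fun i p v w g hg => pairing_transition he (hidx _) hg _ _
  have hconst := eq_of_translates (k := k) (f := f p p v w) (fun g₀ => by
    refine ⟨f p (g₀ • p) (mfderiv (𝓡 (m + 1 + k)) (𝓡 (m + 1 + k)) (fun q : P => g₀ • q) p v)
      (mfderiv (𝓡 (m + 1 + k)) (𝓡 (m + 1 + k)) (fun q : P => g₀ • q) p w), fun g => ?_, ?_⟩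
    · rw [hf _ _ _ _ _ (hidx ((g * g₀) • p)), hf (idx ((g * g₀) • p)) (g₀ • p) _ _ g
        (by rw [← mul_smul]; exact hidx _), ← translate_mul hact, ← translate_mul hact]
    · generalize mfderiv (𝓡 (m + 1 + k)) (𝓡 (m + 1 + k)) (fun q : P => g₀ • q) p v = v'
      generalize mfderiv (𝓡 (m + 1 + k)) (𝓡 (m + 1 + k)) (fun q : P => g₀ • q) p w = w'
      generalize g₀ • p = q at v' w' ⊢
      have hq := hidx q
      set i := idx q
      -- Near the identity a single index serves all translates since `W i` is open; with the index
      -- frozen the function is smooth and the product rule applies.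
      have hev : f p q v' w' =ᶠ[nhds 1] fun g =>
          pairing η (translate G (e i) v' g) (translate G (e i) w' g) := by
        have hc1 : ContinuousAt (fun g : G => g • q) 1 :=
          (contMDiff_smul_const_of_smul hact q).continuous.continuousAt
        filter_upwards [hc1.preimage_mem_nhds ((he.isOpen i).mem_nhds
          (by rwa [one_smul]))] with g hg
        exact hf i q v' w' g hg
      have hs : ∀ u : TangentSpace (𝓡 (m + 1 + k)) q,
          ContMDiffAt (𝓡 k) 𝓘(ℝ, ν → ℝ) ∞ (translate G (e i) u) 1 := fun u =>
        contMDiffAt_translate hact (he.isOpen i) (he.smooth i) u (by rwa [one_smul])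
      have hs' : ∀ u : TangentSpace (𝓡 (m + 1 + k)) q, DifferentiableAt ℝ
          (translate G (e i) u ∘ (extChartAt (𝓡 k) (1 : G)).symm) (extChartAt (𝓡 k) (1 : G) 1) := by
        intro u
        have h3 : ContMDiffAt 𝓘(ℝ, EuclideanSpace ℝ (Fin k)) (𝓡 k) ∞ (extChartAt (𝓡 k) (1 : G)).symm
            (extChartAt (𝓡 k) (1 : G) 1) :=
          (contMDiffOn_extChartAt_symm (I := 𝓡 k) (n := ∞) (1 : G)).contMDiffAt
            (extChartAt_target_mem_nhds (1 : G))
        exact (ContMDiffAt.comp_of_eq (hs u) h3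
          (extChartAt_to_inv (1 : G))).contDiffAt.differentiableAt (by simp)
      have hpair : ContMDiffAt (𝓡 k) 𝓘(ℝ, ℝ) ∞ (fun g =>
          pairing η (translate G (e i) v' g) (translate G (e i) w' g)) 1 := by
        have h4 := fun u j => (contMDiffAt_pi_space.1 (hs u)) j
        simp only [pairing, dotProduct, Matrix.mulVec]
        exact ContMDiffAt.sum fun j _ => (h4 v' j).mul
          (ContMDiffAt.sum fun l _ => contMDiffAt_const.mul (h4 w' l))
      refine ⟨(hpair.congr_of_eventuallyEq hev).mdifferentiableAt (by simp), fun a => ?_⟩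
      rw [hev.mfderiv_eq]
      refine (mfderiv_eq_fderiv_chart (hpair.mdifferentiableAt (by simp)) a).trans ?_
      refine (fderiv_pairing η (hs' v') (hs' w') a).2.trans ?_
      rw [← mfderiv_eq_fderiv_chart ((hs v').mdifferentiableAt (by simp)),
        ← mfderiv_eq_fderiv_chart ((hs w').mdifferentiableAt (by simp)),
        mfderiv_translate_coframe hact (he.isOpen i) (he.smooth i) (he.iso i) hq,
        mfderiv_translate_coframe hact (he.isOpen i) (he.smooth i) (he.iso i) hq]
      simp only [Function.comp, extChartAt_to_inv, translate_one]
      exact mulVec_lieDeriv_skew hη hdet (he.iso i q hq) (hK a i q hq) _ _) g 1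
  rw [hf c p v w g hc, hf a p v w 1 (by rwa [one_smul]), translate_one, translate_one] at hconst
  exact hconst

end Kosmann

/-! ### The Minkowski forms. -/

theorem minkowski_transpose (m : ℕ) : (minkowski m).transpose = minkowski m :=
  Matrix.diagonal_transpose _

theorem minkowski_mul_self (m : ℕ) : minkowski m * minkowski m = 1 := by
  rw [minkowski, Matrix.diagonal_mul_diagonal, ← Matrix.diagonal_one]
  congr 1
  ext i
  refine Fin.cases ?_ (fun i => ?_) i <;> simp

theorem minkowskiSum_transpose (m k : ℕ) : (minkowskiSum m k).transpose = minkowskiSum m k := by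
  simp [minkowskiSum, Matrix.fromBlocks_transpose, minkowski_transpose]

theorem minkowskiSum_mul_self (m k : ℕ) : minkowskiSum m k * minkowskiSum m k = 1 := by
  simp [minkowskiSum, Matrix.fromBlocks_multiply, minkowski_mul_self]

theorem isUnit_det_minkowskiSum (m k : ℕ) : IsUnit (minkowskiSum m k).det :=
  Matrix.isUnit_det_of_left_inverse (minkowskiSum_mul_self m k)

theorem pairing_minkowskiSum {m k : ℕ} (u v : Fin (m + 1) ⊕ Fin k → ℝ) :
    pairing (minkowskiSum m k) u v = pairing (minkowski m) (u ∘ Sum.inl) (v ∘ Sum.inl) +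
      (u ∘ Sum.inr) ⬝ᵥ (v ∘ Sum.inr) := by
  rw [pairing, minkowskiSum, Matrix.fromBlocks_mulVec, dotProduct, Fintype.sum_sum_type]
  simp [pairing, dotProduct]

/-! ### The group acts on a Kosmann-invariant coframe by SO(η). -/

section Kosmann

variable {k m : ℕ} {A G P : Type*}
  [TopologicalSpace G] [ChartedSpace (EuclideanSpace ℝ (Fin k)) G] [CommGroup G]
  [LieGroup (𝓡 k) ∞ G]
  [TopologicalSpace P] [ChartedSpace (EuclideanSpace ℝ (Fin (m + 1 + k))) P]
  [IsManifold (𝓡 (m + 1 + k)) ∞ P] [MulAction G P] {ν : Type*} [Fintype ν] [DecidableEq ν]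

/-- The flow of a Kosmann-invariant coframe acts by `SO(η)`. -/
theorem exists_translate_eq_mulVec [ConnectedSpace G]
    (hact : ContMDiff ((𝓡 k).prod (𝓡 (m + 1 + k))) (𝓡 (m + 1 + k)) ∞
      (fun q : G × P => q.1 • q.2))
    {η : Matrix ν ν ℝ} (hη : η.transpose = η) (hdet : IsUnit η.det) {W : A → Set P}
    {e : A → OneForm (m + 1 + k) P (ν → ℝ)} (he : IsCoframe η W e)
    (hK : ∀ (a : LieAlg k) (i : A), ∀ p ∈ W i, ∀ v,
      kosmannLieDeriv η (fundamental G P a) (e i) p v = 0)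
    {a c : A} {p : P} {g : G} (ha : p ∈ W a) (hc : g • p ∈ W c) :
    ∃ T ∈ SO η, ∀ v, translate G (e c) (p := p) v g = T.mulVec (e a p v) := by
  let T : A → G → Matrix ν ν ℝ := fun c g =>
    Matrix.of fun i j => translate G (e c) (dualFrame (e a) j p) g i
  have hT : ∀ c g v, translate G (e c) (p := p) v g = (T c g).mulVec (e a p v) := fun c g v =>
    linearMap_eq_mulVec ((e c (g • p)).comp
      (mfderiv (𝓡 (m + 1 + k)) (𝓡 (m + 1 + k)) (fun q : P => g • q) p)).toLinearMap (e a p)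
      (he.iso a p ha) v
  have hTη : ∀ c g, g • p ∈ W c → (T c g).transpose * η * T c g = η := by
    intro c g hg
    refine pairing_injective fun v w => ?_
    obtain ⟨v, rfl⟩ := (he.iso a p ha).surjective v
    obtain ⟨w, rfl⟩ := (he.iso a p ha).surjective w
    rw [← pairing_mulVec, ← hT, ← hT]
    exact pairing_translate hact hη hdet he hK ha hg v w
  -- An isometry has determinant ±1. The sign is settled by connectedness: the determinant does not
  -- depend on the representative, varies continuously with `g`, and is `1` at the identity.
  have hTsq : ∀ c g, g • p ∈ W c → (T c g).det ^ 2 = 1 := by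
    intro c g hg
    have h := congrArg Matrix.det (hTη c g hg)
    rw [Matrix.det_mul, Matrix.det_mul, Matrix.det_transpose] at h
    refine mul_right_cancel₀ hdet.ne_zero ?_
    linear_combination h
  have hTc : ∀ c c' g, g • p ∈ W c → g • p ∈ W c' → (T c g).det = (T c' g).det := by
    intro c c' g hg hg'
    obtain ⟨γ, hγ, h⟩ := he.transition c c' (g • p) ⟨hg, hg'⟩
    have h2 : T c' g = γ * T c g := by
      refine Matrix.ext_of_mulVec_single fun i => ?_
      obtain ⟨v, hv⟩ := (he.iso a p ha).surjective (Pi.single i 1)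
      rw [← hv, ← Matrix.mulVec_mulVec, ← hT, ← hT]
      exact h _
    rw [h2, Matrix.det_mul, hγ.2, one_mul]
  choose idx hidx using he.cover
  have hcont : Continuous fun g : G => (T (idx (g • p)) g).det := by
    rw [continuous_iff_continuousAt]
    intro g₀
    have h1 : ContinuousAt (fun g => (T (idx (g₀ • p)) g).det) g₀ := by
      have h2 : ContinuousAt (fun g => T (idx (g₀ • p)) g) g₀ := by
        refine continuousAt_pi.2 fun i => continuousAt_pi.2 fun j => ?_
        exact continuousAt_pi.1 (contMDiffAt_translate hact (he.isOpen _) (he.smooth _)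
          (dualFrame (e a) j p) (hidx (g₀ • p))).continuousAt i
      exact (Continuous.matrix_det continuous_id).continuousAt.comp h2
    refine h1.congr ?_
    have hc1 : ContinuousAt (fun g : G => g • p) g₀ :=
      (contMDiff_smul_const_of_smul hact p).continuous.continuousAt
    filter_upwards [hc1.preimage_mem_nhds ((he.isOpen _).mem_nhds (hidx (g₀ • p)))] with g hg
    exact hTc _ _ g hg (hidx _)
  have h1 : (T (idx ((1 : G) • p)) (1 : G)).det = 1 := by
    rw [hTc _ a 1 (hidx _) (by rwa [one_smul])]
    have : T a 1 = 1 := by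
      refine Matrix.ext_of_mulVec_single fun i => ?_
      obtain ⟨v, hv⟩ := (he.iso a p ha).surjective (Pi.single i 1)
      rw [← hv, ← hT, translate_one, Matrix.one_mulVec]
    rw [this, Matrix.det_one]
  have hD := isPreconnected_univ.eq_of_sq_eq (f := fun g : G => (T (idx (g • p)) g).det)
    (g := fun _ => (1 : ℝ)) hcont.continuousOn continuousOn_const
    (fun g _ => by simpa using hTsq _ g (hidx _)) (by simp) (Set.mem_univ (1 : G)) h1
  refine ⟨T c g, ⟨hTη c g hc, ?_⟩, fun v => hT c g v⟩
  rw [hTc c _ g hc (hidx (g • p))]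
  exact hD (Set.mem_univ g)

theorem kosmannLieDeriv_eq_zero {η : Matrix ν ν ℝ} {ξ : ∀ x : P, TangentSpace (𝓡 (m + 1 + k)) x}
    {e : OneForm (m + 1 + k) P (ν → ℝ)} {U : Set P} (hU : IsOpen U) (he : SmoothFormOn e U)
    (hi : ∀ p ∈ U, (e p).IsInvertible) (h : LieDerivVanishesOn ξ e U) {p : P} (hp : p ∈ U)
    (v : TangentSpace (𝓡 (m + 1 + k)) p) : kosmannLieDeriv η ξ e p v = 0 := by
  have h1 : (Matrix.of fun c b => lieDeriv ξ e (dualFrame e b) p c) = 0 := by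
    ext c b
    exact congrFun (h p hp _ (contMDiffAt_dualFrame hU he hi b hp)) c
  simp [kosmannLieDeriv, lieComponents, h1]

end Kosmann

theorem pairing_eq_sum {ν : Type*} [Fintype ν] (η : Matrix ν ν ℝ) (v w : ν → ℝ) :
    pairing η v w = ∑ i, ∑ j, v i * η i j * w j := by
  simp only [pairing, dotProduct, Matrix.mulVec, Finset.mul_sum, mul_assoc]

theorem dotProduct_self_pos {ν : Type*} [Fintype ν] {v : ν → ℝ} (hv : v ≠ 0) : 0 < v ⬝ᵥ v :=
  lt_of_le_of_ne (Finset.sum_nonneg fun i _ => mul_self_nonneg (v i))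
    fun h => hv (dotProduct_self_eq_zero.1 h.symm)

/-! ### Smooth matrix functions and Cholesky factors. -/

section SmoothMatrices

variable {E H Q : Type*} [NormedAddCommGroup E] [NormedSpace ℝ E] [TopologicalSpace H]
  [TopologicalSpace Q] [ChartedSpace H Q] {I : ModelWithCorners ℝ E H} {S : Set Q}
  {ν μ κ : Type*}

variable (I) in
/-- Matrix-valued functions with smooth entries. -/
def SmoothMatrixOn (h : Q → Matrix ν μ ℝ) (S : Set Q) : Prop :=
  ∀ i j, ContMDiffOn I 𝓘(ℝ, ℝ) ∞ (fun x => h x i j) S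

theorem contMDiffOn_sum {ι : Type*} {s : Finset ι} {f : ι → Q → ℝ}
    (h : ∀ i ∈ s, ContMDiffOn I 𝓘(ℝ, ℝ) ∞ (f i) S) :
    ContMDiffOn I 𝓘(ℝ, ℝ) ∞ (fun x => ∑ i ∈ s, f i x) S := by
  classical
  induction s using Finset.induction_on with
  | empty => simpa using contMDiffOn_const
  | insert i s hi ih =>
    simp only [Finset.sum_insert hi]
    exact (h i (Finset.mem_insert_self _ _)).add
      (ih fun j hj => h j (Finset.mem_insert_of_mem hj))

theorem contMDiffOn_prod {ι : Type*} {s : Finset ι} {f : ι → Q → ℝ}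
    (h : ∀ i ∈ s, ContMDiffOn I 𝓘(ℝ, ℝ) ∞ (f i) S) :
    ContMDiffOn I 𝓘(ℝ, ℝ) ∞ (fun x => ∏ i ∈ s, f i x) S := by
  classical
  induction s using Finset.induction_on with
  | empty => simpa using contMDiffOn_const
  | insert i s hi ih =>
    simp only [Finset.prod_insert hi]
    exact (h i (Finset.mem_insert_self _ _)).mul
      (ih fun j hj => h j (Finset.mem_insert_of_mem hj))

theorem SmoothMatrixOn.mul [Fintype μ] {h : Q → Matrix ν μ ℝ} {h' : Q → Matrix μ κ ℝ}
    (hh : SmoothMatrixOn I h S) (hh' : SmoothMatrixOn I h' S) :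
    SmoothMatrixOn I (fun x => h x * h' x) S := by
  intro i j
  simp only [Matrix.mul_apply]
  exact contMDiffOn_sum fun l _ => (hh i l).mul (hh' l j)

theorem SmoothMatrixOn.transpose {h : Q → Matrix ν μ ℝ} (hh : SmoothMatrixOn I h S) :
    SmoothMatrixOn I (fun x => (h x).transpose) S := fun i j => hh j i

theorem smoothMatrixOn_const (A : Matrix ν μ ℝ) : SmoothMatrixOn I (fun _ : Q => A) S :=
  fun _ _ => contMDiffOn_const

theorem SmoothMatrixOn.det [Fintype ν] [DecidableEq ν] {h : Q → Matrix ν ν ℝ}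
    (hh : SmoothMatrixOn I h S) : ContMDiffOn I 𝓘(ℝ, ℝ) ∞ (fun x => (h x).det) S := by
  simp only [Matrix.det_apply']
  exact contMDiffOn_sum fun σ _ => contMDiffOn_const.mul (contMDiffOn_prod fun i _ => hh _ i)

theorem contMDiffOn_inv_of_ne_zero {f : Q → ℝ} (hf : ContMDiffOn I 𝓘(ℝ, ℝ) ∞ f S)
    (h0 : ∀ x ∈ S, f x ≠ 0) : ContMDiffOn I 𝓘(ℝ, ℝ) ∞ (fun x => (f x)⁻¹) S := fun x hx =>
  ContMDiffAt.comp_contMDiffWithinAt x (contDiffAt_inv ℝ (h0 x hx)).contMDiffAt (hf x hx)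

theorem contMDiffOn_sqrt {f : Q → ℝ} (hf : ContMDiffOn I 𝓘(ℝ, ℝ) ∞ f S)
    (h0 : ∀ x ∈ S, 0 < f x) : ContMDiffOn I 𝓘(ℝ, ℝ) ∞ (fun x => √(f x)) S := fun x hx =>
  ContMDiffAt.comp_contMDiffWithinAt x (Real.contDiffAt_sqrt (h0 x hx).ne').contMDiffAt (hf x hx)

/-- Cramer's rule: the entries are determinants divided by the determinant. -/
theorem SmoothMatrixOn.inv [Fintype ν] [DecidableEq ν] {h : Q → Matrix ν ν ℝ}
    (hh : SmoothMatrixOn I h S) (h0 : ∀ x ∈ S, (h x).det ≠ 0) :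
    SmoothMatrixOn I (fun x => (h x)⁻¹) S := by
  intro i j
  simp only [Matrix.inv_def, Ring.inverse_eq_inv', Matrix.smul_apply, smul_eq_mul,
    Matrix.adjugate_apply]
  refine (contMDiffOn_inv_of_ne_zero hh.det h0).mul (SmoothMatrixOn.det fun r c => ?_)
  by_cases hr : r = j
  · subst hr
    simp only [Matrix.updateRow_self]
    exact contMDiffOn_const
  · simp only [Matrix.updateRow_ne hr]
    exact hh r c

/-- Smooth Cholesky decomposition. -/
theorem exists_smooth_cholesky {k : ℕ} (h : Q → Matrix (Fin k) (Fin k) ℝ)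
    (hs : SmoothMatrixOn I h S) (hsymm : ∀ x ∈ S, ∀ i j, h x i j = h x j i)
    (hpos : ∀ x ∈ S, ∀ y : Fin k → ℝ, y ≠ 0 → 0 < pairing (h x) y y) :
    ∃ L : Q → Matrix (Fin k) (Fin k) ℝ, SmoothMatrixOn I L S ∧
      ∀ x ∈ S, (∀ i j, i < j → L x i j = 0) ∧ (∀ i, 0 < L x i i) ∧
        (L x).transpose * L x = h x := by
  induction k with
  | zero => exact ⟨fun _ => 0, fun i => i.elim0, fun x _ => ⟨fun i => i.elim0, fun i => i.elim0,
      by ext i; exact i.elim0⟩⟩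
  | succ k ih =>
    simp only [pairing_eq_sum] at hpos ih
    -- With `Lᵀ L = h` and `L` lower triangular, the last row of `h` involves only the last row `(l,
    -- d)` of `L`. So the induction splits off the last index: `d` is the root of the corner entry
    -- and `l` the rest of the row divided by `d`.
    set z := Fin.last k with hz
    have hd : ∀ x ∈ S, 0 < h x z z := by
      intro x hx
      have := hpos x hx (Pi.single z 1) (by
        intro h0; simpa using congrFun h0 z)
      simpa [Pi.single_apply] using this
    let d : Q → ℝ := fun x => √(h x z z)
    have hd0 : ∀ x ∈ S, 0 < d x := fun x hx => Real.sqrt_pos.2 (hd x hx)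
    have hdd : ∀ x ∈ S, d x * d x = h x z z := fun x hx => Real.mul_self_sqrt (hd x hx).le
    have hds : ContMDiffOn I 𝓘(ℝ, ℝ) ∞ d S := contMDiffOn_sqrt (hs z z) hd
    let l : Q → Fin k → ℝ := fun x t => h x z t.castSucc * (d x)⁻¹
    have hls : ∀ t, ContMDiffOn I 𝓘(ℝ, ℝ) ∞ (fun x => l x t) S := fun t =>
      (hs z t.castSucc).mul (contMDiffOn_inv_of_ne_zero hds fun x hx => (hd0 x hx).ne')
    have hld : ∀ x ∈ S, ∀ t, d x * l x t = h x z t.castSucc := fun x hx t => by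
      have := (hd0 x hx).ne'
      simp only [l]; field_simp
    -- The remaining block of `L` factorizes the Schur complement of the corner entry.
    obtain ⟨L, hL, hL'⟩ := ih (fun x => Matrix.of fun s t =>
        h x s.castSucc t.castSucc - l x s * l x t)
      (fun s t => (hs _ _).sub ((hls s).mul (hls t)))
      (fun x hx s t => by simp only [Matrix.of_apply]; rw [hsymm x hx]; ring)
      (fun x hx y hy => by
        -- The added coordinate `c` solves `d * c = -(l · y)`. Then the square completed in the last
        -- coordinate vanishes, and `h` on the extended vector equals the Schur complement on `y`.
        have h1 := hpos x hx (Fin.snoc y (-(∑ t, l x t * y t) * (d x)⁻¹) : Fin (k + 1) → ℝ) (by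
          intro h0
          apply hy
          ext t
          simpa using congrFun h0 t.castSucc)
        refine h1.trans_eq ?_
        set c := -(∑ t, l x t * y t) * (d x)⁻¹ with hc
        have hcd : d x * c = -(∑ t, l x t * y t) := by
          have := (hd0 x hx).ne'
          rw [hc]; field_simp
        have hsn : (Fin.snoc y c : Fin (k + 1) → ℝ) z = c := by simp [hz]
        simp only [Fin.sum_univ_castSucc, Fin.snoc_castSucc, ← hz, hsn]
        simp only [hsymm x hx _ z, ← hld x hx, ← hdd x hx, Matrix.of_apply, mul_sub, sub_mul,
          Finset.sum_sub_distrib, Finset.sum_add_distrib]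
        have e1 : ∑ t, y t * (d x * l x t) * c = d x * c * ∑ t, l x t * y t := by
          rw [Finset.mul_sum]; exact Finset.sum_congr rfl fun _ _ => by ring
        have e2 : ∑ t, c * (d x * l x t) * y t = d x * c * ∑ t, l x t * y t := by
          rw [Finset.mul_sum]; exact Finset.sum_congr rfl fun _ _ => by ring
        have e3 : ∑ s, ∑ t, y s * (l x s * l x t) * y t =
            (∑ t, l x t * y t) * ∑ t, l x t * y t := by
          rw [Finset.sum_mul_sum]
          exact Finset.sum_congr rfl fun _ _ => Finset.sum_congr rfl fun _ _ => by ring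
        rw [e1, e2, e3, show c * (d x * d x) * c = (d x * c) * (d x * c) by ring, hcd]
        ring)
    let L' : Q → Fin (k + 1) → Fin (k + 1) → ℝ := fun x =>
      Fin.snoc (α := fun _ => Fin (k + 1) → ℝ)
        (fun s => (Fin.snoc (L x s) 0 : Fin (k + 1) → ℝ)) (Fin.snoc (l x) (d x) : Fin (k + 1) → ℝ)
    have c1 : ∀ x s t, L' x (Fin.castSucc s) (Fin.castSucc t) = L x s t := by simp [L']
    have c2 : ∀ x s, L' x (Fin.castSucc s) z = 0 := by simp [L', hz]
    have c3 : ∀ x t, L' x z (Fin.castSucc t) = l x t := by simp [L', hz]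
    have c4 : ∀ x, L' x z z = d x := by simp [L', hz]
    refine ⟨fun x => Matrix.of (L' x), fun i j => ?_, fun x hx => ⟨fun i j hij => ?_, fun i => ?_,
      ?_⟩⟩
    · simp only [Matrix.of_apply]
      refine Fin.lastCases ?_ (fun s => ?_) i <;> refine Fin.lastCases ?_ (fun t => ?_) j
      · simpa only [← hz, c4] using hds
      · simpa only [← hz, c3] using hls t
      · simpa only [← hz, c2] using contMDiffOn_const
      · simpa only [c1] using hL s t
    · simp only [Matrix.of_apply]
      induction i using Fin.lastCases with
      | last => exact absurd hij (not_lt.2 (Fin.le_last _))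
      | cast s =>
        induction j using Fin.lastCases with
        | last => exact c2 x s
        | cast t => rw [c1]; exact (hL' x hx).1 s t (by simpa using hij)
    · simp only [Matrix.of_apply]
      induction i using Fin.lastCases with
      | last => rw [← hz, c4]; exact hd0 x hx
      | cast s => rw [c1]; exact (hL' x hx).2.1 s
    · have hp := fun s t => congrFun (congrFun (hL' x hx).2.2 s) t
      simp only [Matrix.mul_apply, Matrix.transpose_apply, Matrix.of_apply] at hp
      ext i j
      simp only [Matrix.mul_apply, Matrix.transpose_apply, Matrix.of_apply, Fin.sum_univ_castSucc,
        ← hz]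
      induction i using Fin.lastCases with
      | last =>
        induction j using Fin.lastCases with
        | last => simp only [← hz, c2, c4, mul_zero, Finset.sum_const_zero, zero_add, hdd x hx]
        | cast t => simp only [← hz, c2, c3, c4, zero_mul, Finset.sum_const_zero, zero_add,
            hld x hx]
      | cast s =>
        induction j using Fin.lastCases with
        | last =>
          simp only [← hz, c2, c3, c4, mul_zero, Finset.sum_const_zero, zero_add]
          rw [mul_comm, hld x hx, hsymm x hx]
        | cast t => simp only [c1, c3, hp]; ring

end SmoothMatrices

/-! ### Rotation times lower triangular. -/

theorem det_pos_of_lowerTriangular {k : ℕ} {L : Matrix (Fin k) (Fin k) ℝ}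
    (h0 : ∀ i j, i < j → L i j = 0) (hd : ∀ i, 0 < L i i) : 0 < L.det := by
  rw [Matrix.det_of_isLowerTriangular L (fun i j hij => h0 i j hij)]
  exact Finset.prod_pos fun i _ => hd i

/-- Gram-Schmidt orthonormalization of a matrix with positive determinant. -/
theorem exists_rotation_mul_lowerTriangular {k : ℕ} {M : Matrix (Fin k) (Fin k) ℝ}
    (hM : 0 < M.det) :
    ∃ R ∈ SO (1 : Matrix (Fin k) (Fin k) ℝ), ∃ L : Matrix (Fin k) (Fin k) ℝ,
      (∀ s t, s < t → L s t = 0) ∧ (∀ s, 0 < L s s) ∧ M = R * L := by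
  obtain ⟨L, -, hL⟩ := exists_smooth_cholesky (I := 𝓘(ℝ, ℝ)) (Q := ℝ) (S := Set.univ)
    (fun _ => M.transpose * M) (smoothMatrixOn_const _)
    (fun _ _ i j => by
      simp only [Matrix.mul_apply, Matrix.transpose_apply]
      exact Finset.sum_congr rfl fun _ _ => mul_comm _ _)
    (fun _ _ y hy => by
      have h1 := pairing_mulVec 1 M M y y
      rw [Matrix.mul_one] at h1
      rw [← h1, pairing, Matrix.one_mulVec]
      exact dotProduct_self_pos fun h0 => hy (Matrix.eq_zero_of_mulVec_eq_zero hM.ne' h0))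
  obtain ⟨h0, hd, hLL⟩ := hL 0 trivial
  have hdet := det_pos_of_lowerTriangular h0 hd
  have hLu : IsUnit (L 0).det := hdet.ne'.isUnit
  -- From `Lᵀ L = Mᵀ M` the matrix `M L⁻¹` is orthogonal; its determinant is positive, hence one.
  have hR : (M * (L 0)⁻¹).transpose * (M * (L 0)⁻¹) = 1 := by
    rw [Matrix.transpose_mul, Matrix.mul_assoc, ← Matrix.mul_assoc M.transpose, ← hLL,
      Matrix.mul_assoc, Matrix.mul_nonsing_inv _ hLu, Matrix.mul_one, ← Matrix.transpose_mul,
      Matrix.mul_nonsing_inv _ hLu, Matrix.transpose_one]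
  refine ⟨M * (L 0)⁻¹, ⟨by rw [Matrix.mul_one, hR], ?_⟩, L 0, h0, hd, ?_⟩
  · have h1 := congrArg Matrix.det hR
    rw [Matrix.det_mul, Matrix.det_transpose, Matrix.det_one] at h1
    have h2 : 0 < (M * (L 0)⁻¹).det := by
      rw [Matrix.det_mul, Matrix.det_nonsing_inv, Ring.inverse_eq_inv']
      exact mul_pos hM (inv_pos.2 hdet)
    nlinarith
  · rw [Matrix.mul_assoc, Matrix.nonsing_inv_mul _ hLu, Matrix.mul_one]

/-! ### Pullbacks of the Maurer–Cartan form and the product rule for the action. -/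

section MaurerCartan

variable {n k m : ℕ} {G P X ι N : Type*}
  [TopologicalSpace G] [ChartedSpace (EuclideanSpace ℝ (Fin k)) G] [CommGroup G]
  [LieGroup (𝓡 k) ∞ G]
  [TopologicalSpace P] [ChartedSpace (EuclideanSpace ℝ (Fin (m + 1 + k))) P]
  [IsManifold (𝓡 (m + 1 + k)) ∞ P] [MulAction G P]
  [TopologicalSpace N] [ChartedSpace (EuclideanSpace ℝ (Fin n)) N]
  [IsManifold (𝓡 n) ∞ N]

variable (n k) in
/-- The pullback of the Maurer-Cartan form along a map from a manifold of any dimension. -/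
def mcForm (u : N → G) : OneForm n N (LieAlg k) :=
  fun x => mfderiv (𝓡 n) (𝓡 k) (fun y => (u x)⁻¹ * u y) x

theorem mfderiv_congr_point {n' : ℕ} {M : Type*} [TopologicalSpace M]
    [ChartedSpace (EuclideanSpace ℝ (Fin n')) M] (f : N → M) {z z' : N} (h : z = z')
    (u : EuclideanSpace ℝ (Fin n)) :
    (mfderiv (𝓡 n) (𝓡 n') f z u : EuclideanSpace ℝ (Fin n')) = mfderiv (𝓡 n) (𝓡 n') f z' u := by
  subst h; rfl

theorem mfderiv_congr_fun {n' : ℕ} {M : Type*} [TopologicalSpace M]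
    [ChartedSpace (EuclideanSpace ℝ (Fin n')) M] {f f' : N → M} {z : N} (h : f =ᶠ[nhds z] f')
    (u : EuclideanSpace ℝ (Fin n)) :
    (mfderiv (𝓡 n) (𝓡 n') f z u : EuclideanSpace ℝ (Fin n')) = mfderiv (𝓡 n) (𝓡 n') f' z u := by
  rw [h.mfderiv_eq]
  rfl

theorem mfderiv_comp_eval {n' n'' : ℕ} {M M' : Type*} [TopologicalSpace M]
    [ChartedSpace (EuclideanSpace ℝ (Fin n')) M] [TopologicalSpace M']
    [ChartedSpace (EuclideanSpace ℝ (Fin n'')) M'] {g : M → M'} {f : N → M} {x : N}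
    (hg : MDifferentiableAt (𝓡 n') (𝓡 n'') g (f x)) (hf : MDifferentiableAt (𝓡 n) (𝓡 n') f x)
    (u : EuclideanSpace ℝ (Fin n)) :
    (mfderiv (𝓡 n) (𝓡 n'') (fun y => g (f y)) x u : EuclideanSpace ℝ (Fin n'')) =
      mfderiv (𝓡 n') (𝓡 n'') g (f x) (mfderiv (𝓡 n) (𝓡 n') f x u) :=
  mfderiv_comp_apply x hg hf u

theorem OneForm.congr_point {F : Type*} [NormedAddCommGroup F] [NormedSpace ℝ F]
    (α : OneForm n N F) {z z' : N} (h : z = z') (u : EuclideanSpace ℝ (Fin n)) :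
    α z u = α z' u := by
  subst h; rfl

theorem mdifferentiableAt_const_mul {u : N → G} {x : N}
    (hu : MDifferentiableAt (𝓡 n) (𝓡 k) u x) (g : G) :
    MDifferentiableAt (𝓡 n) (𝓡 k) (fun y => g * u y) x :=
  MDifferentiableAt.comp x ((contMDiff_mul_left (I := 𝓡 k) (n := ∞) (a := g)).mdifferentiableAt
    (by simp)) hu

/-- Commutativity regroups the product into two factors with value `1` at `x`, and the differential
of multiplication at the identity is addition. This is why no adjoint action appears in the gauge
transformations. -/
theorem mcForm_mul {u v : N → G} {x : N} (hu : MDifferentiableAt (𝓡 n) (𝓡 k) u x)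
    (hv : MDifferentiableAt (𝓡 n) (𝓡 k) v x) :
    mcForm n k (fun y => u y * v y) x = mcForm n k u x + mcForm n k v x := by
  ext1 w
  have hu' := mdifferentiableAt_const_mul hu (u x)⁻¹
  have hv' := mdifferentiableAt_const_mul hv (v x)⁻¹
  have h1 : (fun y => (u x * v x)⁻¹ * (u y * v y)) =
      (fun q : G × G => q.1 * q.2) ∘ (fun y => ((u x)⁻¹ * u y, (v x)⁻¹ * v y)) := by
    funext y; simp only [Function.comp, mul_inv]
    exact mul_mul_mul_comm _ _ _ _
  have hmul : MDifferentiableAt ((𝓡 k).prod (𝓡 k)) (𝓡 k) (fun q : G × G => q.1 * q.2)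
      ((u x)⁻¹ * u x, (v x)⁻¹ * v x) := (contMDiff_mul (𝓡 k) ∞).mdifferentiableAt (by simp)
  have h2 : mcForm n k (fun y => u y * v y) x w =
      mfderiv ((𝓡 k).prod (𝓡 k)) (𝓡 k) (fun q : G × G => q.1 * q.2)
        ((u x)⁻¹ * u x, (v x)⁻¹ * v x) (mcForm n k u x w, mcForm n k v x w) := by
    rw [mcForm, h1, mfderiv_comp x hmul (hu'.prodMk hv'), mfderiv_prodMk hu' hv']
    rfl
  refine h2.trans ((mfderiv_prod_eq_add_apply hmul).trans ?_)
  have h3 := mfderiv_congr_fun (N := G) (n := k) (n' := k) (z := (u x)⁻¹ * u x)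
    (f := fun z : G => z * ((v x)⁻¹ * v x)) (f' := id)
    (Filter.Eventually.of_forall fun z => by simp) (mcForm n k u x w)
  have h4 := mfderiv_congr_fun (N := G) (n := k) (n' := k) (z := (v x)⁻¹ * v x)
    (f := fun z : G => (u x)⁻¹ * u x * z) (f' := id)
    (Filter.Eventually.of_forall fun z => by simp) (mcForm n k v x w)
  rw [mfderiv_id] at h3 h4
  exact congrArg₂ (· + ·) h3 h4

theorem mcForm_comp {n' : ℕ} {M : Type*} [TopologicalSpace M]
    [ChartedSpace (EuclideanSpace ℝ (Fin n')) M] [IsManifold (𝓡 n') ∞ M]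
    {u : M → G} {f : N → M} {x : N}
    (hu : MDifferentiableAt (𝓡 n') (𝓡 k) u (f x)) (hf : MDifferentiableAt (𝓡 n) (𝓡 n') f x)
    (w : EuclideanSpace ℝ (Fin n)) :
    mcForm n k (fun y => u (f y)) x w = mcForm n' k u (f x) (mfderiv (𝓡 n) (𝓡 n') f x w) :=
  mfderiv_comp_eval (mdifferentiableAt_const_mul hu _) hf w

/-- Left translation by `v.1⁻¹` moves every tangent vector into the tangent space at `1`, where the
differential of the chart at `1` is the identity and supplies fixed coordinates. -/
theorem smoothFormOn_mcForm_id :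
    SmoothFormOn (mcForm k k (id : G → G)) Set.univ := by
  have h1 : ContMDiff (𝓡 k).tangent (𝓡 k).tangent ∞
      (fun v : TangentBundle (𝓡 k) G => (⟨v.1⁻¹, 0⟩ : TangentBundle (𝓡 k) G)) :=
    (Bundle.contMDiff_zeroSection ℝ _).comp ((contMDiff_inv (𝓡 k) ∞).comp (Bundle.contMDiff_proj _))
  have h2 := (contMDiff_tangent_prod (f := fun g h : G => g * h) (contMDiff_mul (𝓡 k) ∞)).comp
    (h1.prodMk contMDiff_id)
  have h3 := ContMDiffOn.comp (smoothFormOn_extChartAt (n := k) (1 : G)) h2.contMDiffOn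
    (s := {v | v.1 ∈ (Set.univ : Set G)}) (fun v _ => by
      simp only [Set.mem_ofPred_eq, Set.mem_preimage, Function.comp, inv_mul_cancel, id]
      exact mem_extChartAt_source (1 : G))
  refine h3.congr fun v _ => ?_
  simp only [Function.comp, map_zero, zero_add, id]
  refine ((mfderiv_congr_point (n' := k) (extChartAt (𝓡 k) (1 : G)) (inv_mul_cancel v.1) _).trans
    (mfderiv_extChartAt_self_apply (1 : G) _)).symm.trans ?_
  rfl

theorem smoothFormOn_mcForm {u : N → G} {U : Set N} (hU : IsOpen U)
    (hu : ContMDiffOn (𝓡 n) (𝓡 k) ∞ u U) : SmoothFormOn (mcForm n k u) U :=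
  (smoothFormOn_mcForm_id.pullback hU hu fun _ _ => trivial).congr fun x hx w =>
    mcForm_comp (u := id) mdifferentiableAt_id
      ((hu.contMDiffAt (hU.mem_nhds hx)).mdifferentiableAt (by simp)) w

/-- Writing `u y • p` as `((u x)⁻¹ * u y) • u x • p` moves the derivative of the orbit map to the
identity, where it is a fundamental vector. -/
theorem mfderiv_smul_const
    (hact : ContMDiff ((𝓡 k).prod (𝓡 (m + 1 + k))) (𝓡 (m + 1 + k)) ∞
      (fun q : G × P => q.1 • q.2)) {u : N → G} {x : N}
    (hu : MDifferentiableAt (𝓡 n) (𝓡 k) u x) (p : P) (w : EuclideanSpace ℝ (Fin n)) :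
    (mfderiv (𝓡 k) (𝓡 (m + 1 + k)) (fun g : G => g • p) (u x) (mfderiv (𝓡 n) (𝓡 k) u x w) :
      EuclideanSpace ℝ (Fin (m + 1 + k))) = fundamental G P (mcForm n k u x w) (u x • p) := by
  have hs : ∀ (q : P) (g : G), MDifferentiableAt (𝓡 k) (𝓡 (m + 1 + k)) (fun g : G => g • q) g :=
    fun q g => (contMDiff_smul_const_of_smul hact q).mdifferentiableAt (by simp)
  refine (mfderiv_comp_eval (hs p (u x)) hu w).symm.trans ?_
  refine (mfderiv_congr_fun (f' := fun y => ((u x)⁻¹ * u y) • u x • p)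
    (Filter.Eventually.of_forall fun y => ?_) w).trans ?_
  · change u y • p = ((u x)⁻¹ * u y) • u x • p
    rw [smul_smul, mul_right_comm, inv_mul_cancel, one_mul]
  · refine (mfderiv_comp_eval (g := fun h : G => h • u x • p) (hs _ _)
      (mdifferentiableAt_const_mul hu _) w).trans ?_
    exact mfderiv_congr_point _ (inv_mul_cancel (u x)) _

/-- The product rule for the action: `d(u • s) = u_* ds + (u⁻¹ du)^#`. -/
theorem mfderiv_smul_eq
    (hact : ContMDiff ((𝓡 k).prod (𝓡 (m + 1 + k))) (𝓡 (m + 1 + k)) ∞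
      (fun q : G × P => q.1 • q.2)) {u : N → G} {s : N → P} {x : N}
    (hu : MDifferentiableAt (𝓡 n) (𝓡 k) u x) (hs : MDifferentiableAt (𝓡 n) (𝓡 (m + 1 + k)) s x)
    (w : EuclideanSpace ℝ (Fin n)) :
    (mfderiv (𝓡 n) (𝓡 (m + 1 + k)) (fun y => u y • s y) x w :
      EuclideanSpace ℝ (Fin (m + 1 + k))) =
      mfderiv (𝓡 (m + 1 + k)) (𝓡 (m + 1 + k)) (fun q : P => u x • q) (s x)
        (mfderiv (𝓡 n) (𝓡 (m + 1 + k)) s x w) +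
      fundamental G P (mcForm n k u x w) (u x • s x) := by
  have hd : MDifferentiableAt ((𝓡 k).prod (𝓡 (m + 1 + k))) (𝓡 (m + 1 + k))
      (fun q : G × P => q.1 • q.2) (u x, s x) := hact.mdifferentiableAt (by simp)
  have h1 : (mfderiv (𝓡 n) (𝓡 (m + 1 + k)) (fun y => u y • s y) x w :
      EuclideanSpace ℝ (Fin (m + 1 + k))) =
      mfderiv ((𝓡 k).prod (𝓡 (m + 1 + k))) (𝓡 (m + 1 + k)) (fun q : G × P => q.1 • q.2) (u x, s x)
        (mfderiv (𝓡 n) (𝓡 k) u x w, mfderiv (𝓡 n) (𝓡 (m + 1 + k)) s x w) := by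
    refine (mfderiv_comp_apply x (f := fun y => (u y, s y)) hd (hu.prodMk hs) w).trans ?_
    rw [mfderiv_prodMk hu hs]
    rfl
  refine h1.trans ((mfderiv_prod_eq_add_apply hd).trans ((add_comm _ _).trans ?_))
  exact congrArg₂ (· + ·) rfl (mfderiv_smul_const hact hu (s x) w)

end MaurerCartan

/-! ### Tangent vectors of the principal bundle. -/

section Bundle

variable {k m : ℕ} {G P X ι A : Type*}
  [TopologicalSpace G] [ChartedSpace (EuclideanSpace ℝ (Fin k)) G] [CommGroup G]
  [LieGroup (𝓡 k) ∞ G]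
  [TopologicalSpace P] [ChartedSpace (EuclideanSpace ℝ (Fin (m + 1 + k))) P]
  [IsManifold (𝓡 (m + 1 + k)) ∞ P] [MulAction G P]
  [TopologicalSpace X] [ChartedSpace (EuclideanSpace ℝ (Fin (m + 1))) X]
  [IsManifold (𝓡 (m + 1)) ∞ X] {F : Type*} [NormedAddCommGroup F] [NormedSpace ℝ F]

variable (G) in
/-- The fundamental vector fields at a point, as a linear map. -/
def fundamentalL (p : P) : LieAlg k →L[ℝ] TangentSpace (𝓡 (m + 1 + k)) p :=
  mfderiv (𝓡 k) (𝓡 (m + 1 + k)) (fun g : G => g • p) 1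

theorem fundamentalL_apply (p : P) (a : LieAlg k) :
    fundamentalL (m := m) G p a = fundamental G P a p := rfl

/-- Translations commute with the orbit maps because the group is abelian. -/
theorem mfderiv_smul_fundamental
    (hact : ContMDiff ((𝓡 k).prod (𝓡 (m + 1 + k))) (𝓡 (m + 1 + k)) ∞
      (fun q : G × P => q.1 • q.2)) (g : G) (p : P) (a : LieAlg k) :
    mfderiv (𝓡 (m + 1 + k)) (𝓡 (m + 1 + k)) (fun q : P => g • q) p (fundamental G P a p) =
      fundamental G P a (g • p) := by
  have h1 := mfderiv_comp_eval (N := G) (f := fun h : G => h • p) (g := fun q : P => g • q)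
    (x := 1) ((contMDiff_const_smul_of_smul hact g).mdifferentiableAt (by simp))
    ((contMDiff_smul_const_of_smul hact p).mdifferentiableAt (by simp)) a
  refine (mfderiv_congr_point _ (one_smul G p).symm _).trans (h1.symm.trans ?_)
  exact mfderiv_congr_fun (Filter.Eventually.of_forall fun h => smul_comm g h p) a

theorem translate_fundamental
    (hact : ContMDiff ((𝓡 k).prod (𝓡 (m + 1 + k))) (𝓡 (m + 1 + k)) ∞
      (fun q : G × P => q.1 • q.2)) (α : OneForm (m + 1 + k) P F) (g : G) (p : P) (a : LieAlg k) :
    translate G α (fundamental G P a p) g = α (g • p) (fundamental G P a (g • p)) :=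
  congrArg (α (g • p)) (mfderiv_smul_fundamental hact g p a)

namespace PrincipalBundle

variable (B : PrincipalBundle k m G P X ι)

theorem mdifferentiableAt_proj (p : P) :
    MDifferentiableAt (𝓡 (m + 1 + k)) (𝓡 (m + 1)) B.proj p :=
  B.contMDiff_proj.mdifferentiableAt (by simp)

theorem isOpen_preimage {V : Set X} (hV : IsOpen V) : IsOpen (B.proj ⁻¹' V) :=
  hV.preimage B.contMDiff_proj.continuous

theorem mdifferentiableAt_sec {i : ι} {x : X} (hx : x ∈ B.U i) :
    MDifferentiableAt (𝓡 (m + 1)) (𝓡 (m + 1 + k)) (B.sec i) x :=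
  ((B.contMDiffOn_sec i).contMDiffAt ((B.isOpen_U i).mem_nhds hx)).mdifferentiableAt (by simp)

theorem mdifferentiableAt_triv {i : ι} {p : P} (hp : B.proj p ∈ B.U i) :
    MDifferentiableAt (𝓡 (m + 1 + k)) (𝓡 k) (B.triv i) p :=
  ((B.contMDiffOn_triv i).contMDiffAt
    ((B.isOpen_preimage (B.isOpen_U i)).mem_nhds hp)).mdifferentiableAt (by simp)

theorem mfderiv_proj_smul (g : G) (p : P) (v : EuclideanSpace ℝ (Fin (m + 1 + k))) :
    (mfderiv (𝓡 (m + 1 + k)) (𝓡 (m + 1)) B.proj (g • p)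
      (mfderiv (𝓡 (m + 1 + k)) (𝓡 (m + 1 + k)) (fun q : P => g • q) p v) :
      EuclideanSpace ℝ (Fin (m + 1))) = mfderiv (𝓡 (m + 1 + k)) (𝓡 (m + 1)) B.proj p v := by
  refine (mfderiv_comp_eval (f := fun q : P => g • q) (B.mdifferentiableAt_proj _)
    ((contMDiff_const_smul_of_smul B.contMDiff_smul g).mdifferentiableAt (by simp)) v).symm.trans ?_
  exact mfderiv_congr_fun (Filter.Eventually.of_forall fun q => B.proj_smul g q) v

theorem mfderiv_proj_fundamental (a : LieAlg k) (p : P) :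
    (mfderiv (𝓡 (m + 1 + k)) (𝓡 (m + 1)) B.proj p (fundamental G P a p) :
      EuclideanSpace ℝ (Fin (m + 1))) = 0 := by
  have h1 := mfderiv_comp_eval (N := G) (f := fun h : G => h • p) (g := B.proj)
    (x := 1) (B.mdifferentiableAt_proj _)
    ((contMDiff_smul_const_of_smul B.contMDiff_smul p).mdifferentiableAt (by simp)) a
  refine (mfderiv_congr_point _ (one_smul G p).symm _).trans (h1.symm.trans ?_)
  refine (mfderiv_congr_fun (f' := fun _ => B.proj p)
    (Filter.Eventually.of_forall fun h => B.proj_smul h p) a).trans ?_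
  rw [mfderiv_const]
  rfl

theorem mfderiv_proj_sec {i : ι} {x : X} (hx : x ∈ B.U i) (w : EuclideanSpace ℝ (Fin (m + 1))) :
    (mfderiv (𝓡 (m + 1 + k)) (𝓡 (m + 1)) B.proj (B.sec i x)
      (mfderiv (𝓡 (m + 1)) (𝓡 (m + 1 + k)) (B.sec i) x w) :
      EuclideanSpace ℝ (Fin (m + 1))) = w := by
  refine (mfderiv_comp_eval (B.mdifferentiableAt_proj _) (B.mdifferentiableAt_sec hx) w).symm.trans
    ?_
  refine (mfderiv_congr_fun (N := X) (M := X) (n := m + 1) (n' := m + 1) (z := x)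
    (f := fun y => B.proj (B.sec i y)) (f' := id) ?_ w).trans ?_
  · filter_upwards [(B.isOpen_U i).mem_nhds hx] with y hy using B.proj_sec i y hy
  · rw [mfderiv_id]
    rfl

/-- Decomposition of a tangent vector in a local trivialization. -/
theorem tangent_eq {i : ι} {p : P} (hp : B.proj p ∈ B.U i)
    (v : EuclideanSpace ℝ (Fin (m + 1 + k))) :
    v = (mfderiv (𝓡 (m + 1 + k)) (𝓡 (m + 1 + k)) (fun q : P => B.triv i p • q)
        (B.sec i (B.proj p)) (mfderiv (𝓡 (m + 1)) (𝓡 (m + 1 + k)) (B.sec i) (B.proj p)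
          (mfderiv (𝓡 (m + 1 + k)) (𝓡 (m + 1)) B.proj p v)) +
      fundamental G P (mcForm (m + 1 + k) k (B.triv i) p v) p :
        EuclideanSpace ℝ (Fin (m + 1 + k))) := by
  have hs : MDifferentiableAt (𝓡 (m + 1 + k)) (𝓡 (m + 1 + k)) (fun q => B.sec i (B.proj q)) p :=
    (B.mdifferentiableAt_sec hp).comp p (B.mdifferentiableAt_proj p)
  have h1 := mfderiv_smul_eq B.contMDiff_smul (B.mdifferentiableAt_triv hp) hs v
  have h2 := mfderiv_congr_fun (N := P) (M := P) (n := m + 1 + k) (n' := m + 1 + k)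
    (z := p) (f := fun q => B.triv i q • B.sec i (B.proj q)) (f' := id)
    (by
      filter_upwards [(B.isOpen_preimage (B.isOpen_U i)).mem_nhds hp] with q hq
      exact B.triv_smul_sec i q hq) v
  rw [mfderiv_id] at h2
  refine (h2.symm.trans h1).trans (congrArg₂ (· + ·) ?_ ?_)
  · exact congrArg (mfderiv (𝓡 (m + 1 + k)) (𝓡 (m + 1 + k)) (fun q : P => B.triv i p • q)
      (B.sec i (B.proj p))) (mfderiv_comp_eval (B.mdifferentiableAt_sec hp)
        (B.mdifferentiableAt_proj p) v)
  · have : ∀ z z' : P, z = z' → (fundamental G P (mcForm (m + 1 + k) k (B.triv i) p v) z :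
        EuclideanSpace ℝ (Fin (m + 1 + k))) =
        fundamental G P (mcForm (m + 1 + k) k (B.triv i) p v) z' := by rintro z _ rfl; rfl
    exact this _ _ (B.triv_smul_sec i p hp)

/-- In consequence an invariant form is determined by its pullback along a section and its values on
fundamental fields. -/
theorem form_eq (α : OneForm (m + 1 + k) P F) {i : ι} {p : P} (hp : B.proj p ∈ B.U i)
    (v : EuclideanSpace ℝ (Fin (m + 1 + k))) :
    α p v = translate G α (mfderiv (𝓡 (m + 1)) (𝓡 (m + 1 + k)) (B.sec i) (B.proj p)
          (mfderiv (𝓡 (m + 1 + k)) (𝓡 (m + 1)) B.proj p v)) (B.triv i p) +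
      α p (fundamental G P (mcForm (m + 1 + k) k (B.triv i) p v) p) := by
  have h1 := (congrArg (α p) (B.tangent_eq hp v)).trans (map_add (α p) _ _)
  refine h1.trans (congrArg₂ (· + ·) ?_ rfl)
  exact α.congr_point (B.triv_smul_sec i p hp).symm _

/-- For a vertical vector the summand of `tangent_eq` coming from the section drops out. -/
theorem eq_fundamental_of_mfderiv_proj_eq_zero {i : ι} {p : P} (hp : B.proj p ∈ B.U i)
    {v : EuclideanSpace ℝ (Fin (m + 1 + k))}
    (hv : (mfderiv (𝓡 (m + 1 + k)) (𝓡 (m + 1)) B.proj p v : EuclideanSpace ℝ (Fin (m + 1))) = 0) :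
    v = fundamental G P (mcForm (m + 1 + k) k (B.triv i) p v) p := by
  refine (B.tangent_eq hp v).trans ?_
  have h1 : ∀ L : EuclideanSpace ℝ (Fin (m + 1)) →L[ℝ] EuclideanSpace ℝ (Fin (m + 1 + k)),
      ∀ L' : EuclideanSpace ℝ (Fin (m + 1 + k)) →L[ℝ] EuclideanSpace ℝ (Fin (m + 1 + k)),
      ∀ u w, u = 0 → L' (L u) + w = w := by
    rintro L L' _ w rfl
    simp
  exact h1 (mfderiv (𝓡 (m + 1)) (𝓡 (m + 1 + k)) (B.sec i) (B.proj p))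
    (mfderiv (𝓡 (m + 1 + k)) (𝓡 (m + 1 + k)) (fun q : P => B.triv i p • q)
        (B.sec i (B.proj p))) _ _ hv

theorem triv_sec {i : ι} {x : X} (hx : x ∈ B.U i) : B.triv i (B.sec i x) = 1 :=
  B.free _ (B.sec i x) (by
    have h := B.triv_smul_sec i (B.sec i x) (by rwa [B.proj_sec i x hx])
    rwa [B.proj_sec i x hx] at h)

theorem proj_surjective (x : X) : ∃ p, B.proj p = x := by
  obtain ⟨i, hi⟩ := B.cover_U x
  exact ⟨B.sec i x, B.proj_sec i x hi⟩

theorem smul_cancel (B : PrincipalBundle k m G P X ι) {g h : G} {p : P} (e : g • p = h • p) : g = h := by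
  have := B.free (h⁻¹ * g) p (by rw [mul_smul, e, inv_smul_smul])
  rwa [inv_mul_eq_one, eq_comm] at this

theorem triv_eq_mul {i j : ι} {p : P} (hi : B.proj p ∈ B.U i) (hj : B.proj p ∈ B.U j) :
    B.triv i p = B.triv j p * B.transition i j (B.proj p) := by
  refine B.smul_cancel (p := B.sec i (B.proj p)) ?_
  have h := B.triv_smul_sec i (B.sec j (B.proj p)) (by rwa [B.proj_sec j _ hj])
  rw [B.proj_sec j _ hj] at h
  rw [B.triv_smul_sec i p hi, mul_smul, transition, h, B.triv_smul_sec j p hj]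

theorem transition_smul_sec {i j : ι} {x : X} (hi : x ∈ B.U i) (hj : x ∈ B.U j) :
    B.transition i j x • B.sec i x = B.sec j x := by
  have h := B.triv_smul_sec i (B.sec j x) (by rwa [B.proj_sec j _ hj])
  rwa [B.proj_sec j _ hj] at h

theorem contMDiffOn_transition (i j : ι) :
    ContMDiffOn (𝓡 (m + 1)) (𝓡 k) ∞ (B.transition i j) (B.U i ∩ B.U j) :=
  (B.contMDiffOn_triv i).comp ((B.contMDiffOn_sec j).mono Set.inter_subset_right)
    (fun x hx => by simpa [B.proj_sec j x hx.2] using hx.1)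

end PrincipalBundle

end Bundle

/-! ### Block matrices, component matrices, invertibility. -/

theorem fromBlocks_mem_SO {m k : ℕ} {γ : Matrix (Fin (m + 1)) (Fin (m + 1)) ℝ}
    (hγ : γ ∈ SO (minkowski m)) :
    Matrix.fromBlocks γ 0 0 (1 : Matrix (Fin k) (Fin k) ℝ) ∈ SO (minkowskiSum m k) := by
  refine ⟨?_, ?_⟩
  · rw [minkowskiSum, Matrix.fromBlocks_transpose, Matrix.fromBlocks_multiply,
      Matrix.fromBlocks_multiply]
    simp [hγ.1]
  · rw [Matrix.det_fromBlocks_zero₂₁, hγ.2, Matrix.det_one, one_mul]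

theorem componentMatrix_mulVec {k : ℕ} (b : Module.Basis (Fin k) ℝ (LieAlg k))
    (φ : LieAlg k →L[ℝ] (Fin k → ℝ)) (c : LieAlg k) :
    φ c = (componentMatrix b φ).mulVec (b.repr c) := by
  conv_lhs => rw [← b.sum_repr c]
  ext s
  simp only [map_sum, map_smul, Finset.sum_apply, Pi.smul_apply, smul_eq_mul, Matrix.mulVec,
    dotProduct, componentMatrix, Matrix.of_apply]
  exact Finset.sum_congr rfl fun _ _ => mul_comm _ _

theorem injective_of_det_componentMatrix {k : ℕ} {b : Module.Basis (Fin k) ℝ (LieAlg k)}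
    {φ : LieAlg k →L[ℝ] (Fin k → ℝ)} (h : (componentMatrix b φ).det ≠ 0) :
    Function.Injective φ := by
  rw [injective_iff_map_eq_zero]
  intro c hc
  rw [componentMatrix_mulVec b] at hc
  have := Matrix.eq_zero_of_mulVec_eq_zero h hc
  exact b.repr.map_eq_zero_iff.1 (Finsupp.ext fun i => congrFun this i)

theorem isInvertible_of_injective {n : ℕ} {M : Type*} [TopologicalSpace M]
    [ChartedSpace (EuclideanSpace ℝ (Fin n)) M] {x : M} {ν : Type*} [Fintype ν]
    (hν : Fintype.card ν = n) {e : TangentSpace (𝓡 n) x →L[ℝ] (ν → ℝ)}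
    (he : Function.Injective e) : e.IsInvertible := by
  have key : ∀ e : EuclideanSpace ℝ (Fin n) →L[ℝ] (ν → ℝ), Function.Injective e →
      e.IsInvertible := by
    intro e he
    exact ⟨(LinearEquiv.ofInjectiveOfFinrankEq e.toLinearMap he
      (by simp [hν])).toContinuousLinearEquiv, by ext; rfl⟩
  exact key e he

/-! ### Coframes of the form (π^* ê_h, Φ θ). -/

section Bundle

variable {k m : ℕ} {G P X ι A : Type*}
  [TopologicalSpace G] [ChartedSpace (EuclideanSpace ℝ (Fin k)) G] [CommGroup G]
  [LieGroup (𝓡 k) ∞ G]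
  [TopologicalSpace P] [ChartedSpace (EuclideanSpace ℝ (Fin (m + 1 + k))) P]
  [IsManifold (𝓡 (m + 1 + k)) ∞ P] [MulAction G P]
  [TopologicalSpace X] [ChartedSpace (EuclideanSpace ℝ (Fin (m + 1))) X]
  [IsManifold (𝓡 (m + 1)) ∞ X] {F : Type*} [NormedAddCommGroup F] [NormedSpace ℝ F]

/-- The coframe `(π^* ê_h, (Φ ∘ π) · θ)`. -/
def kkCoframe (B : PrincipalBundle k m G P X ι) (θ : OneForm (m + 1 + k) P (LieAlg k))
    (eh : A → OneForm (m + 1) X (Fin (m + 1) → ℝ)) (Φ : X → LieAlg k →L[ℝ] (Fin k → ℝ)) :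
    A → OneForm (m + 1 + k) P (Fin (m + 1) ⊕ Fin k → ℝ) :=
  fun a p => ContinuousLinearMap.pi fun s => Sum.elim
    (fun s => (ContinuousLinearMap.proj s).comp
      ((eh a (B.proj p)).comp (mfderiv (𝓡 (m + 1 + k)) (𝓡 (m + 1)) B.proj p)))
    (fun s => (ContinuousLinearMap.proj s).comp ((Φ (B.proj p)).comp (θ p))) s

/-- Over the preimages of `V`, the coframe `e` is of the form `(π^* ê_h, (Φ ∘ π) · θ)`. -/
def IsKKCoframe (B : PrincipalBundle k m G P X ι) (V : A → Set X)
    (θ : OneForm (m + 1 + k) P (LieAlg k))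
    (eh : A → OneForm (m + 1) X (Fin (m + 1) → ℝ)) (Φ : X → LieAlg k →L[ℝ] (Fin k → ℝ))
    (e : A → OneForm (m + 1 + k) P (Fin (m + 1) ⊕ Fin k → ℝ)) : Prop :=
  ∀ (a : A) (p : P), B.proj p ∈ V a → ∀ v, e a p v =
      Sum.elim (eh a (B.proj p) (mfderiv (𝓡 (m + 1 + k)) (𝓡 (m + 1)) B.proj p v))
        (Φ (B.proj p) (θ p v))

theorem isKKCoframe_kkCoframe (B : PrincipalBundle k m G P X ι) (V : A → Set X)
    (θ : OneForm (m + 1 + k) P (LieAlg k))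
    (eh : A → OneForm (m + 1) X (Fin (m + 1) → ℝ)) (Φ : X → LieAlg k →L[ℝ] (Fin k → ℝ)) :
    IsKKCoframe B V θ eh Φ (kkCoframe B θ eh Φ) := by
  intro a p _ v
  funext s
  cases s <;> rfl

namespace IsKKCoframe

variable {B : PrincipalBundle k m G P X ι} {b : Module.Basis (Fin k) ℝ (LieAlg k)} {V : A → Set X}
    {θ : OneForm (m + 1 + k) P (LieAlg k)}
    {eh : A → OneForm (m + 1) X (Fin (m + 1) → ℝ)} {Φ : X → LieAlg k →L[ℝ] (Fin k → ℝ)}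
    {e : A → OneForm (m + 1 + k) P (Fin (m + 1) ⊕ Fin k → ℝ)}

theorem apply_fundamental (h : IsKKCoframe B V θ eh Φ e) (hθ : IsConnection G θ) {a : A} {p : P}
    (hp : B.proj p ∈ V a) (c : LieAlg k) :
    e a p (fundamental G P c p) = Sum.elim (0 : Fin (m + 1) → ℝ) (Φ (B.proj p) c) := by
  rw [h a p hp, hθ.fundamental]
  have h0 : eh a (B.proj p) (mfderiv (𝓡 (m + 1 + k)) (𝓡 (m + 1)) B.proj p (fundamental G P c p))
      = 0 := (congrArg (eh a (B.proj p)) (B.mfderiv_proj_fundamental c p)).trans (map_zero _)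
  rw [h0]

theorem smooth (h : IsKKCoframe B V θ eh Φ e) (hθ : IsConnection G θ) (hV : ∀ a, IsOpen (V a))
    (heh : ∀ a, SmoothFormOn (eh a) (V a))
    (hΦ : ContMDiff (𝓡 (m + 1)) 𝓘(ℝ, LieAlg k →L[ℝ] (Fin k → ℝ)) ∞ Φ) (a : A) :
    SmoothFormOn (e a) (B.proj ⁻¹' V a) := by
  have h1 := (heh a).pullback (B.isOpen_preimage (hV a)) B.contMDiff_proj.contMDiffOn
    (fun _ hp => hp)
  have h2 := (hθ.smooth.mono (Set.subset_univ (B.proj ⁻¹' V a))).clm_apply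
    (Φ := fun p => Φ (B.proj p)) ((hΦ.comp B.contMDiff_proj).contMDiffOn)
  refine (SmoothFormOn.pi (α := kkCoframe B θ eh Φ a) fun s => ?_).congr fun p hp v => ?_
  · cases s with
    | inl s => exact contMDiffOn_pi_space.1 h1 s
    | inr s => exact contMDiffOn_pi_space.1 h2 s
  · rw [h a p hp, isKKCoframe_kkCoframe B V θ eh Φ a p hp]

/-- Both ingredients are invariant: the projection absorbs translations, and a connection for an
abelian group is invariant. -/
theorem translate_eq (h : IsKKCoframe B V θ eh Φ e) (hθ : IsConnection G θ) {a : A} {p : P}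
    (hp : B.proj p ∈ V a) (v : TangentSpace (𝓡 (m + 1 + k)) p) (g : G) :
    translate G (e a) v g = e a p v := by
  rw [translate, h a (g • p) (by rwa [B.proj_smul]), h a p hp, hθ.invariant]
  have key : ∀ x x' : X, x = x' → ∀ u u' : EuclideanSpace ℝ (Fin (m + 1)), u = u' →
      ∀ w, (Sum.elim (eh a x u) (Φ x w) : Fin (m + 1) ⊕ Fin k → ℝ) =
        Sum.elim (eh a x' u') (Φ x' w) := by rintro x _ rfl u _ rfl w; rfl
  exact key _ _ (B.proj_smul g p) _ _ (B.mfderiv_proj_smul g p v) _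

/-- A kernel vector is vertical and killed by θ, since `eh` and `Φ` are injective. So it is a
fundamental vector with parameter zero. -/
theorem isInvertible (h : IsKKCoframe B V θ eh Φ e) (hθ : IsConnection G θ)
    (heh : ∀ a, ∀ x ∈ V a, (eh a x).IsInvertible)
    (hΦ : ∀ x, 0 < (componentMatrix b (Φ x)).det) {a : A} {p : P} (hp : B.proj p ∈ V a) :
    (e a p).IsInvertible := by
  refine isInvertible_of_injective (by simp) ((injective_iff_map_eq_zero (e a p)).2 fun v hv => ?_)
  rw [h a p hp] at hv
  have h1 : eh a (B.proj p) (mfderiv (𝓡 (m + 1 + k)) (𝓡 (m + 1)) B.proj p v) = 0 := by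
    funext s; exact congrFun hv (Sum.inl s)
  have h2 : Φ (B.proj p) (θ p v) = 0 := by funext s; exact congrFun hv (Sum.inr s)
  have h3 := (heh a _ hp).injective (h1.trans (map_zero _).symm)
  have h4 := injective_of_det_componentMatrix (hΦ (B.proj p)).ne' (h2.trans (map_zero _).symm)
  obtain ⟨i, hi⟩ := B.cover_U (B.proj p)
  have h5 := B.eq_fundamental_of_mfderiv_proj_eq_zero hi h3
  have h6 : mcForm (m + 1 + k) k (B.triv i) p v = 0 := by
    rw [← hθ.fundamental (mcForm (m + 1 + k) k (B.triv i) p v) p]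
    exact (congrArg (θ p) h5).symm.trans h4
  refine h5.trans ?_
  rw [h6, ← fundamentalL_apply]
  exact map_zero (fundamentalL G p)

/-- Coframes `(π^* ê_h, (Φ ∘ π) · θ)` are partially gauge-fixed. -/
theorem isPartiallyGaugeFixed (h : IsKKCoframe B V θ eh Φ e) (hθ : IsConnection G θ)
    (hV : ∀ a, IsOpen (V a)) (hcov : ∀ x, ∃ a, x ∈ V a) (heh : ∀ a, SmoothFormOn (eh a) (V a))
    (hiso : ∀ a, ∀ x ∈ V a, (eh a x).IsInvertible)
    (hΦ : ContMDiff (𝓡 (m + 1)) 𝓘(ℝ, LieAlg k →L[ℝ] (Fin k → ℝ)) ∞ Φ)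
    (hdet : ∀ x, 0 < (componentMatrix b (Φ x)).det)
    (htr : ∀ a a' p, B.proj p ∈ V a → B.proj p ∈ V a' → ∃ γ ∈ SO (minkowskiSum m k),
      ∀ v, e a' p v = γ.mulVec (e a p v)) :
    IsPartiallyGaugeFixed B b V e where
  isOpen := hV
  coframe :=
    { isOpen := fun a => B.isOpen_preimage (hV a)
      cover := fun p => hcov (B.proj p)
      smooth := h.smooth hθ hV heh hΦ
      iso := fun a p hp => h.isInvertible hθ hiso hdet hp
      transition := fun a a' p hp => htr a a' p hp.1 hp.2 }
  invariant := fun c a => lieDerivVanishesOn_of_translate_eq B.contMDiff_smul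
    (B.isOpen_preimage (hV a)) (h.smooth hθ hV heh hΦ a)
    (fun _ hp v g => h.translate_eq hθ hp v g) c
  horizontal := fun c a p hp s => by rw [h.apply_fundamental hθ hp]; rfl
  vertical_global := fun a a' p hp hp' v s => by rw [h a p hp, h a' p hp']; rfl
  vertical_gramSchmidt := fun a p hp => by
    obtain ⟨R, hR, L, h0, hd, hRL⟩ := exists_rotation_mul_lowerTriangular (hdet (B.proj p))
    refine ⟨R, hR, L, h0, hd, hRL ▸ ?_⟩
    ext s t
    simp only [Matrix.of_apply, h.apply_fundamental hθ hp]
    rfl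

theorem exists_transition (h : IsKKCoframe B V θ eh Φ e) (heh : IsCoframe (minkowski m) V eh)
    (a a' : A) (p : P) (ha : B.proj p ∈ V a) (ha' : B.proj p ∈ V a') :
    ∃ γ ∈ SO (minkowskiSum m k), ∀ v, e a' p v = γ.mulVec (e a p v) := by
  obtain ⟨γ, hγ, hv⟩ := heh.transition a a' _ ⟨ha, ha'⟩
  refine ⟨_, fromBlocks_mem_SO hγ, fun v => ?_⟩
  rw [h a p ha, h a' p ha', hv, Matrix.fromBlocks_mulVec]
  simp [Function.comp_def]

/-- The pairing of `e v` with `e c^#` is `Φ (θ v) · Φ c`, and taking `c = θ v` shows that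
orthogonality to the fibres forces `θ v = 0`. Thus the orthogonality clause of `Encodes` is
automatic for coframes of this form. -/
theorem encodes (h : IsKKCoframe B V θ eh Φ e) (hθ : IsConnection G θ)
    (hdet : ∀ x, 0 < (componentMatrix b (Φ x)).det) {F : KKFields k m X ι A}
    (hFeh : ∀ a, ∀ x ∈ V a, ∀ w, F.eh a x w = eh a x w) (hFΦ : F.scalar = Φ)
    (hF : ∀ i, ∀ x ∈ B.U i, ∀ w, F.gauge i x w =
      θ (B.sec i x) (mfderiv (𝓡 (m + 1)) (𝓡 (m + 1 + k)) (B.sec i) x w)) : Encodes B V e F := by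
  refine ⟨θ, hθ, fun a p hp v => ?_, hF, fun a p hp v => by
    rw [h a p hp, hFeh a _ hp, hFΦ]⟩
  have h1 : ∀ c : LieAlg k, pairing (minkowskiSum m k) (e a p v) (e a p (fundamental G P c p)) =
      Φ (B.proj p) (θ p v) ⬝ᵥ Φ (B.proj p) c := by
    intro c
    rw [h.apply_fundamental hθ hp, h a p hp, pairing_minkowskiSum]
    simp [pairing]
  simp only [h1]
  constructor
  · intro h0 c
    rw [h0, map_zero, zero_dotProduct]
  · intro h0
    exact injective_of_det_componentMatrix (hdet (B.proj p)).ne'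
      ((dotProduct_self_eq_zero.1 (h0 (θ p v))).trans (map_zero _).symm)

end IsKKCoframe

end Bundle

/-! ### Linear maps with prescribed matrices. -/

section MatrixCLM

variable {V W ν μ : Type*} [NormedAddCommGroup V] [NormedSpace ℝ V] [FiniteDimensional ℝ V]
  [NormedAddCommGroup W] [NormedSpace ℝ W] [Fintype ν] [Fintype μ]

/-- The linear map with matrix `M` with respect to a basis `b` of the source and a family `f` of
vectors of the target. -/
def matrixCLM (b : Module.Basis μ ℝ V) (f : ν → W) (M : Matrix ν μ ℝ) : V →L[ℝ] W :=
  ∑ s, ∑ t, M s t • (LinearMap.toContinuousLinearMap (b.coord t)).smulRight (f s)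

theorem matrixCLM_apply (b : Module.Basis μ ℝ V) (f : ν → W) (M : Matrix ν μ ℝ) (c : V) :
    matrixCLM b f M c = ∑ s, (M.mulVec (b.repr c)) s • f s := by
  simp only [matrixCLM, FunLike.coe_sum, Finset.sum_apply, smul_apply,
    ContinuousLinearMap.smulRight_apply, LinearMap.coe_toContinuousLinearMap',
    Module.Basis.coord_apply, Matrix.mulVec, dotProduct, Finset.sum_smul, smul_smul]

theorem matrixCLM_single (b : Module.Basis μ ℝ V) [DecidableEq ν] (M : Matrix ν μ ℝ) (c : V) :
    matrixCLM b (fun s => Pi.single s (1 : ℝ)) M c = M.mulVec (b.repr c) := by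
  rw [matrixCLM_apply, ← pi_eq_sum_univ']

theorem contMDiffOn_matrixCLM {E H Q : Type*} [NormedAddCommGroup E] [NormedSpace ℝ E]
    [TopologicalSpace H] [TopologicalSpace Q] [ChartedSpace H Q] {I : ModelWithCorners ℝ E H}
    {S : Set Q} (b : Module.Basis μ ℝ V) (f : ν → W) {M : Q → Matrix ν μ ℝ}
    (hM : SmoothMatrixOn I M S) :
    ContMDiffOn I 𝓘(ℝ, V →L[ℝ] W) ∞ (fun x => matrixCLM b f (M x)) S := by
  unfold matrixCLM
  exact contMDiffOn_finsetSum fun s _ => contMDiffOn_finsetSum fun t _ =>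
    (hM s t).smul contMDiffOn_const

end MatrixCLM

theorem componentMatrix_matrixCLM {k : ℕ} (b : Module.Basis (Fin k) ℝ (LieAlg k))
    (M : Matrix (Fin k) (Fin k) ℝ) :
    componentMatrix b (matrixCLM b (fun s => Pi.single s (1 : ℝ)) M) = M := by
  ext s t
  rw [componentMatrix, Matrix.of_apply, matrixCLM_single, b.repr_self]
  simp [Matrix.mulVec, dotProduct, Finsupp.single_apply]

/-- The inverse of `φ` is written through the inverse matrix, so that smooth dependence on a
parameter follows from Cramer's rule. -/
theorem matrixCLM_inv_apply {k : ℕ} {b : Module.Basis (Fin k) ℝ (LieAlg k)}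
    {φ : LieAlg k →L[ℝ] (Fin k → ℝ)} (h : (componentMatrix b φ).det ≠ 0) (y : Fin k → ℝ) :
    φ (matrixCLM (Pi.basisFun ℝ (Fin k)) b (componentMatrix b φ)⁻¹ y) = y := by
  rw [componentMatrix_mulVec b, matrixCLM_apply, b.repr_sum_self]
  have h1 : ((Pi.basisFun ℝ (Fin k)).repr y : Fin k → ℝ) = y := by ext; simp
  rw [h1]
  refine (Matrix.mulVec_mulVec _ _ _).trans ?_
  rw [Matrix.mul_nonsing_inv _ (isUnit_iff_ne_zero.2 h), Matrix.one_mulVec]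

/-- Change of basis; it reduces positivity for all bases of the given orientation to positivity for
`b`. -/
theorem det_componentMatrix {k : ℕ} (b b' : Module.Basis (Fin k) ℝ (LieAlg k))
    (φ : LieAlg k →L[ℝ] (Fin k → ℝ)) :
    (componentMatrix b' φ).det = (componentMatrix b φ).det * b.det b' := by
  rw [Module.Basis.det_apply, ← Matrix.det_mul]
  congr 1
  ext s t
  refine (congrFun (componentMatrix_mulVec b φ (b' t)) s).trans ?_
  simp [Matrix.mul_apply, Matrix.mulVec, dotProduct, Module.Basis.toMatrix_apply]

/-- The upper left block of an isometry that does not change the last components. -/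
theorem exists_mem_SO_minkowski {m k : ℕ}
    {γ : Matrix (Fin (m + 1) ⊕ Fin k) (Fin (m + 1) ⊕ Fin k) ℝ} (hγ : γ ∈ SO (minkowskiSum m k))
    (h : ∀ u s, γ.mulVec u (Sum.inr s) = u (Sum.inr s)) :
    ∃ A ∈ SO (minkowski m), ∀ u : Fin (m + 1) → ℝ, ∀ s,
      γ.mulVec (Sum.elim u 0) (Sum.inl s) = A.mulVec u s := by
  have h21 : γ.toBlocks₂₁ = 0 := by
    ext s t
    have := h (Pi.single (Sum.inl t) 1) s
    simpa [Matrix.toBlocks₂₁] using this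
  have h22 : γ.toBlocks₂₂ = 1 := by
    ext s t
    have := h (Pi.single (Sum.inr t) 1) s
    rw [Matrix.mulVec_single_one] at this
    simpa [Matrix.toBlocks₂₂, Matrix.one_apply, Pi.single_apply] using this
  have hb : γ = Matrix.fromBlocks γ.toBlocks₁₁ γ.toBlocks₁₂ 0 1 := by
    rw [← h21, ← h22, Matrix.fromBlocks_toBlocks]
  refine ⟨γ.toBlocks₁₁, ⟨?_, ?_⟩, fun u s => ?_⟩
  · have h1 := hγ.1
    rw [hb, minkowskiSum, Matrix.fromBlocks_transpose, Matrix.fromBlocks_multiply,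
      Matrix.fromBlocks_multiply] at h1
    simpa using (Matrix.fromBlocks_inj.1 h1).1
  · have h1 := hγ.2
    rwa [hb, Matrix.det_fromBlocks_zero₂₁, Matrix.det_one, mul_one] at h1
  · conv_lhs => rw [hb, Matrix.fromBlocks_mulVec]
    simp only [Sum.elim_comp_inl, Sum.elim_comp_inr, Matrix.mulVec_zero, add_zero, Sum.elim_inl]

/-! ### Recovering the fields on the base. -/

section Bundle

variable {k m : ℕ} {G P X ι A : Type*}
  [TopologicalSpace G] [ChartedSpace (EuclideanSpace ℝ (Fin k)) G] [CommGroup G]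
  [LieGroup (𝓡 k) ∞ G]
  [TopologicalSpace P] [ChartedSpace (EuclideanSpace ℝ (Fin (m + 1 + k))) P]
  [IsManifold (𝓡 (m + 1 + k)) ∞ P] [MulAction G P]
  [TopologicalSpace X] [ChartedSpace (EuclideanSpace ℝ (Fin (m + 1))) X]
  [IsManifold (𝓡 (m + 1)) ∞ X]

/-- Pullback of a connection along a pointwise product of a function and a map. -/
theorem IsConnection.apply_mfderiv_smul {θ : OneForm (m + 1 + k) P (LieAlg k)}
    (hθ : IsConnection G θ)
    (hact : ContMDiff ((𝓡 k).prod (𝓡 (m + 1 + k))) (𝓡 (m + 1 + k)) ∞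
      (fun q : G × P => q.1 • q.2)) {n : ℕ} {N : Type*} [TopologicalSpace N]
    [ChartedSpace (EuclideanSpace ℝ (Fin n)) N] [IsManifold (𝓡 n) ∞ N]
    {u : N → G} {s : N → P} {x : N}
    (hu : MDifferentiableAt (𝓡 n) (𝓡 k) u x) (hs : MDifferentiableAt (𝓡 n) (𝓡 (m + 1 + k)) s x)
    (w : EuclideanSpace ℝ (Fin n)) :
    θ (u x • s x) (mfderiv (𝓡 n) (𝓡 (m + 1 + k)) (fun y => u y • s y) x w) =
      θ (s x) (mfderiv (𝓡 n) (𝓡 (m + 1 + k)) s x w) + mcForm n k u x w := by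
  refine (congrArg (θ (u x • s x)) (mfderiv_smul_eq hact hu hs w)).trans ?_
  refine (map_add (θ (u x • s x)) _ _).trans ?_
  exact congrArg₂ (· + ·) (hθ.invariant _ _ _) (hθ.fundamental _ _)

namespace IsKKCoframe

variable {B : PrincipalBundle k m G P X ι} {b : Module.Basis (Fin k) ℝ (LieAlg k)} {V : A → Set X}
    {θ θ' : OneForm (m + 1 + k) P (LieAlg k)}
    {eh eh' : A → OneForm (m + 1) X (Fin (m + 1) → ℝ)} {Φ Φ' : X → LieAlg k →L[ℝ] (Fin k → ℝ)}
    {e : A → OneForm (m + 1 + k) P (Fin (m + 1) ⊕ Fin k → ℝ)}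

/-- The horizontal part of the coframe is a pullback along local sections. -/
theorem eh_apply (h : IsKKCoframe B V θ eh Φ e) {a : A} {x : X} {i : ι} (ha : x ∈ V a)
    (hi : x ∈ B.U i) (w : EuclideanSpace ℝ (Fin (m + 1))) (s : Fin (m + 1)) :
    eh a x w s = e a (B.sec i x)
      (mfderiv (𝓡 (m + 1)) (𝓡 (m + 1 + k)) (B.sec i) x w) (Sum.inl s) := by
  rw [h a _ (by rwa [B.proj_sec i x hi])]
  refine congrFun (?_ : _ = _) s
  refine ((eh a).congr_point (B.proj_sec i x hi).symm w).trans ?_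
  exact congrArg (eh a (B.proj (B.sec i x))) (B.mfderiv_proj_sec hi w).symm

/-- Every ingredient is read off from `e`: `Φ` from fundamental vectors, `eh` along local sections,
and `θ` from the vertical components by injectivity of `Φ`. -/
theorem unique (h : IsKKCoframe B V θ eh Φ e) (hθ : IsConnection G θ)
    (hdet : ∀ x, 0 < (componentMatrix b (Φ x)).det) (hcov : ∀ x, ∃ a, x ∈ V a)
    (h' : IsKKCoframe B V θ' eh' Φ' e) (hθ' : IsConnection G θ') :
    (∀ a, ∀ x ∈ V a, ∀ w, eh a x w = eh' a x w) ∧ Φ = Φ' ∧ ∀ p v, θ p v = θ' p v := by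
  have hΦ : Φ = Φ' := by
    funext x
    obtain ⟨p, rfl⟩ := B.proj_surjective x
    obtain ⟨a, ha⟩ := hcov (B.proj p)
    ext c s
    have h1 := h.apply_fundamental hθ ha c
    rw [h'.apply_fundamental hθ' ha c] at h1
    exact (congrFun h1 (Sum.inr s)).symm
  subst hΦ
  refine ⟨fun a x hx w => ?_, rfl, fun p v => ?_⟩
  · obtain ⟨i, hi⟩ := B.cover_U x
    funext s
    exact (h.eh_apply hx hi w s).trans (h'.eh_apply hx hi w s).symm
  · obtain ⟨a, ha⟩ := hcov (B.proj p)
    have h1 := h a p ha v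
    rw [h' a p ha v] at h1
    refine injective_of_det_componentMatrix (hdet (B.proj p)).ne' ?_
    funext s
    exact (congrFun h1 (Sum.inr s)).symm

/-- Horizontal lifts. -/
theorem exists_horizontal (B : PrincipalBundle k m G P X ι) (hθ : IsConnection G θ) {x : X} {i : ι}
    (hi : x ∈ B.U i) (w : EuclideanSpace ℝ (Fin (m + 1))) :
    ∃ v : TangentSpace (𝓡 (m + 1 + k)) (B.sec i x),
      (mfderiv (𝓡 (m + 1 + k)) (𝓡 (m + 1)) B.proj (B.sec i x) v : EuclideanSpace ℝ (Fin (m + 1))) =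
        w ∧ θ (B.sec i x) v = 0 := by
  let z : EuclideanSpace ℝ (Fin (m + 1 + k)) :=
    mfderiv (𝓡 (m + 1)) (𝓡 (m + 1 + k)) (B.sec i) x w
  let f : EuclideanSpace ℝ (Fin (m + 1 + k)) :=
    fundamental G P (θ (B.sec i x) z) (B.sec i x)
  refine ⟨z - f, ?_, ?_⟩
  · refine (map_sub (mfderiv (𝓡 (m + 1 + k)) (𝓡 (m + 1)) B.proj (B.sec i x)) z f).trans ?_
    have h1 := B.mfderiv_proj_sec hi w
    have h2 := B.mfderiv_proj_fundamental (θ (B.sec i x) z) (B.sec i x)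
    exact (congrArg₂ (fun u v : EuclideanSpace ℝ (Fin (m + 1)) => u - v) h1 h2).trans (sub_zero w)
  · refine (map_sub (θ (B.sec i x)) z f).trans ?_
    exact sub_eq_zero.2 (hθ.fundamental _ _).symm

/-- The base coframe of a coframe `(π^* ê_h, (Φ ∘ π) · θ)`. -/
theorem isCoframe (h : IsKKCoframe B V θ eh Φ e) (hθ : IsConnection G θ)
    (hV : ∀ a, IsOpen (V a))
    (he : IsCoframe (minkowskiSum m k) (fun a => B.proj ⁻¹' V a) e) :
    IsCoframe (minkowski m) V eh where
  isOpen := hV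
  cover := fun x => by
    obtain ⟨p, rfl⟩ := B.proj_surjective x
    exact he.cover p
  smooth := fun a => smoothFormOn_of_locally fun x hx => by
    obtain ⟨i, hi⟩ := B.cover_U x
    refine ⟨V a ∩ B.U i, (hV a).inter (B.isOpen_U i), ⟨hx, hi⟩, ?_⟩
    have h1 := (he.smooth a).pullback ((hV a).inter (B.isOpen_U i))
      ((B.contMDiffOn_sec i).mono Set.inter_subset_right)
      (fun y hy => by simpa [B.proj_sec i y hy.2] using hy.1)
    refine contMDiffOn_pi_space.2 fun s => ?_
    refine (contMDiffOn_pi_space.1 h1 (Sum.inl s)).congr fun v hv => ?_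
    exact h.eh_apply hv.1 hv.2 v.2 s
  iso := fun a x hx => by
    refine isInvertible_of_injective (by simp) ((injective_iff_map_eq_zero (eh a x)).2 fun w hw => ?_)
    obtain ⟨i, hi⟩ := B.cover_U x
    -- On a horizontal lift the vertical components of `e` vanish, so `e` sees only `eh`.
    obtain ⟨v, hv, hv0⟩ := exists_horizontal B hθ hi w
    have hp : B.proj (B.sec i x) ∈ V a := by rwa [B.proj_sec i x hi]
    have h1 : e a (B.sec i x) v = 0 := by
      rw [h a _ hp, hv0, map_zero]
      have h2 : eh a (B.proj (B.sec i x))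
          (mfderiv (𝓡 (m + 1 + k)) (𝓡 (m + 1)) B.proj (B.sec i x) v) = 0 :=
        (congrArg (eh a (B.proj (B.sec i x))) hv).trans
          (((eh a).congr_point (B.proj_sec i x hi) w).trans hw)
      rw [h2]
      funext s; cases s <;> rfl
    have h2 := (he.iso a _ hp).injective (h1.trans (map_zero _).symm)
    refine hv.symm.trans ((congrArg (mfderiv (𝓡 (m + 1 + k)) (𝓡 (m + 1)) B.proj
      (B.sec i x)) h2).trans (map_zero _))
  transition := fun a a' x hx => by
    obtain ⟨i, hi⟩ := B.cover_U x
    have hp : ∀ {a}, x ∈ V a → B.proj (B.sec i x) ∈ V a := fun h => by rwa [B.proj_sec i x hi]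
    obtain ⟨γ, hγ, hγe⟩ := he.transition a a' (B.sec i x) ⟨hp hx.1, hp hx.2⟩
    -- Both representatives have the same last components `Φ θ`, so `γ` fixes these and restricts to
    -- a Lorentz matrix on the first ones.
    obtain ⟨C, hC, hCγ⟩ := exists_mem_SO_minkowski hγ fun u s => by
      obtain ⟨v, rfl⟩ := (he.iso a (B.sec i x) (hp hx.1)).surjective u
      rw [← hγe, h a' _ (hp hx.2), h a _ (hp hx.1)]
      rfl
    refine ⟨C, hC, fun w => ?_⟩
    obtain ⟨v, hv, hv0⟩ := exists_horizontal B hθ hi w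
    have key : ∀ a, eh a (B.proj (B.sec i x))
        (mfderiv (𝓡 (m + 1 + k)) (𝓡 (m + 1)) B.proj (B.sec i x) v) = eh a x w := fun a =>
      (congrArg (eh a (B.proj (B.sec i x))) hv).trans ((eh a).congr_point (B.proj_sec i x hi) w)
    have h1 := hγe v
    rw [h a' _ (hp hx.2), h a _ (hp hx.1), hv0, map_zero, key, key] at h1
    funext s
    rw [← hCγ, ← h1]
    rfl

end IsKKCoframe

namespace IsPartiallyGaugeFixed

variable {B : PrincipalBundle k m G P X ι} {b : Module.Basis (Fin k) ℝ (LieAlg k)} {V : A → Set X}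
    {e : A → OneForm (m + 1 + k) P (Fin (m + 1) ⊕ Fin k → ℝ)}

theorem translate_eq [ConnectedSpace G] (h : IsPartiallyGaugeFixed B b V e) {a : A} {p : P}
    (hp : B.proj p ∈ V a) (v : TangentSpace (𝓡 (m + 1 + k)) p) (g : G) :
    translate G (e a) v g = e a p v :=
  translate_eq_of_lieDerivVanishesOn B.contMDiff_smul (B.isOpen_preimage (h.isOpen a))
    (h.coframe.smooth a) (fun g q hq => by simpa [B.proj_smul] using hq)
    (fun c => h.invariant c a) hp v g

theorem cover (h : IsPartiallyGaugeFixed B b V e) (x : X) : ∃ a, x ∈ V a := by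
  obtain ⟨p, rfl⟩ := B.proj_surjective x
  exact h.coframe.cover p

/-- Invariance of `e`, and of the fundamental fields under translation, makes the vertical
components on fundamental vectors constant along fibres; they are also independent of the
representative. Local sections give smoothness, and the Gram–Schmidt condition gives the sign of the
determinant. -/
theorem exists_scalar [ConnectedSpace G] (h : IsPartiallyGaugeFixed B b V e) :
    ∃ Φ : X → LieAlg k →L[ℝ] (Fin k → ℝ),
      ContMDiff (𝓡 (m + 1)) 𝓘(ℝ, LieAlg k →L[ℝ] (Fin k → ℝ)) ∞ Φ ∧
      (∀ x, 0 < (componentMatrix b (Φ x)).det) ∧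
      ∀ (a : A) (p : P), B.proj p ∈ V a → ∀ c s,
        e a p (fundamental G P c p) (Sum.inr s) = Φ (B.proj p) c s := by
  choose i hi using B.cover_U
  choose a ha using h.cover
  let M : X → Matrix (Fin k) (Fin k) ℝ := fun x => Matrix.of fun s t =>
    e (a x) (B.sec (i x) x) (fundamental G P (b t) (B.sec (i x) x)) (Sum.inr s)
  have hMe : ∀ (c : A) (p : P), B.proj p ∈ V c → ∀ s t,
      e c p (fundamental G P (b t) p) (Sum.inr s) = M (B.proj p) s t := by
    intro c p hp s t
    have h0 : B.proj (B.sec (i (B.proj p)) (B.proj p)) = B.proj p :=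
      B.proj_sec _ _ (hi (B.proj p))
    have h1 := h.translate_eq (a := c) (p := B.sec (i (B.proj p)) (B.proj p)) (by rwa [h0])
      (fundamental G P (b t) _) (B.triv (i (B.proj p)) p)
    rw [translate_fundamental B.contMDiff_smul, B.triv_smul_sec _ p (hi _)] at h1
    rw [h1]
    exact h.vertical_global _ _ _ (by rwa [h0]) (by rw [h0]; exact ha _) _ _
  have hMs : SmoothMatrixOn (𝓡 (m + 1)) M Set.univ := by
    intro s t
    rw [contMDiffOn_univ]
    intro x
    have hS : V (a x) ∩ B.U (i x) ∈ nhds x :=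
      ((h.isOpen _).inter (B.isOpen_U _)).mem_nhds ⟨ha x, hi x⟩
    have h1 := (h.coframe.smooth (a x)).apply (f := B.sec (i x))
      (Y := fun y => fundamental G P (b t) (B.sec (i x) y)) (S := V (a x) ∩ B.U (i x))
      ((contMDiff_fundamental B.contMDiff_smul (b t)).comp_contMDiffOn
        ((B.contMDiffOn_sec (i x)).mono Set.inter_subset_right))
      (fun y hy => by simpa [B.proj_sec _ y hy.2] using hy.1)
    refine ((contMDiffOn_pi_space.1 h1 (Sum.inr s)).congr fun y hy => ?_).contMDiffAt hS
    have h2 := hMe (a x) (B.sec (i x) y) (by rw [B.proj_sec _ y hy.2]; exact hy.1) s t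
    rw [B.proj_sec _ y hy.2] at h2
    exact h2.symm
  refine ⟨fun x => matrixCLM b (fun s => Pi.single s (1 : ℝ)) (M x),
    contMDiffOn_univ.1 (contMDiffOn_matrixCLM b _ hMs), fun x => ?_, fun c p hp y s => ?_⟩
  · rw [componentMatrix_matrixCLM]
    obtain ⟨p, rfl⟩ := B.proj_surjective x
    obtain ⟨R, hR, L, h0, hd, hRL⟩ := h.vertical_gramSchmidt _ p (ha _)
    have h1 : M (B.proj p) = R * L := by
      rw [← hRL]
      ext s t
      exact (hMe _ p (ha _) s t).symm
    rw [h1, Matrix.det_mul, hR.2, one_mul]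
    exact det_pos_of_lowerTriangular h0 hd
  · rw [matrixCLM_single]
    conv_lhs => rw [← b.sum_repr y, ← fundamentalL_apply]
    simp only [map_sum, map_smul, Finset.sum_apply, Pi.smul_apply, smul_eq_mul, fundamentalL_apply]
    simp only [Matrix.mulVec, dotProduct]
    refine Finset.sum_congr rfl fun t _ => ?_
    rw [hMe c p hp, mul_comm]

/-- Here `θ` is `Φ⁻¹` applied to the vertical components, and `eh` is the pullback of the horizontal
ones along a section. By `form_eq`, invariance and horizontality, projecting back to the total space
recovers the horizontal components. -/
theorem exists_isKKCoframe [ConnectedSpace G] (h : IsPartiallyGaugeFixed B b V e) :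
    ∃ (θ : OneForm (m + 1 + k) P (LieAlg k)) (eh : A → OneForm (m + 1) X (Fin (m + 1) → ℝ))
      (Φ : X → LieAlg k →L[ℝ] (Fin k → ℝ)), IsKKCoframe B V θ eh Φ e ∧ IsConnection G θ ∧
      ContMDiff (𝓡 (m + 1)) 𝓘(ℝ, LieAlg k →L[ℝ] (Fin k → ℝ)) ∞ Φ ∧
      (∀ x, 0 < (componentMatrix b (Φ x)).det) := by
  obtain ⟨Φ, hΦ, hdet, hΦe⟩ := h.exists_scalar
  choose i hi using B.cover_U
  choose a ha using h.cover
  have hinj := fun x => injective_of_det_componentMatrix (hdet x).ne'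
  let Ψ : X → (Fin k → ℝ) →L[ℝ] LieAlg k := fun x =>
    matrixCLM (Pi.basisFun ℝ (Fin k)) b (componentMatrix b (Φ x))⁻¹
  have hΨ : ContMDiff (𝓡 (m + 1)) 𝓘(ℝ, (Fin k → ℝ) →L[ℝ] LieAlg k) ∞ Ψ := by
    refine contMDiffOn_univ.1 (contMDiffOn_matrixCLM _ _
      (SmoothMatrixOn.inv (fun s t => ?_) fun x _ => (hdet x).ne'))
    exact contMDiffOn_pi_space.1 (hΦ.contMDiffOn.clm_apply contMDiffOn_const) s
  let π₂ : (Fin (m + 1) ⊕ Fin k → ℝ) →L[ℝ] (Fin k → ℝ) :=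
    ContinuousLinearMap.pi fun s => ContinuousLinearMap.proj (Sum.inr s)
  let π₁ : (Fin (m + 1) ⊕ Fin k → ℝ) →L[ℝ] (Fin (m + 1) → ℝ) :=
    ContinuousLinearMap.pi fun s => ContinuousLinearMap.proj (Sum.inl s)
  let θ : OneForm (m + 1 + k) P (LieAlg k) := fun p =>
    (Ψ (B.proj p)).comp (π₂.comp (e (a (B.proj p)) p))
  let eh : A → OneForm (m + 1) X (Fin (m + 1) → ℝ) := fun c x =>
    π₁.comp ((e c (B.sec (i x) x)).comp
      (mfderiv (𝓡 (m + 1)) (𝓡 (m + 1 + k)) (B.sec (i x)) x))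
  have hθe : ∀ (c : A) (p : P), B.proj p ∈ V c → ∀ v,
      θ p v = Ψ (B.proj p) (π₂ (e c p v)) := fun c p hp v =>
    congrArg (Ψ (B.proj p)) (funext fun s => h.vertical_global _ _ p (ha _) hp v s)
  have hΦθ : ∀ (c : A) (p : P), B.proj p ∈ V c → ∀ v,
      Φ (B.proj p) (θ p v) = π₂ (e c p v) := fun c p hp v =>
    (congrArg (Φ (B.proj p)) (hθe c p hp v)).trans (matrixCLM_inv_apply (hdet _).ne' _)
  refine ⟨θ, eh, Φ, fun c p hp v => ?_, ⟨?_, fun g p v => ?_, fun c p => ?_⟩, hΦ, hdet⟩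
  · funext s
    cases s with
    | inr s => exact (congrFun (hΦθ c p hp v) s).symm
    | inl s =>
      have h1 := B.form_eq (e c) (hi (B.proj p)) v
      rw [h.translate_eq (by rwa [B.proj_sec _ _ (hi _)])] at h1
      refine (congrFun h1 (Sum.inl s)).trans ?_
      rw [Pi.add_apply, h.horizontal _ c p hp s, add_zero]
      rfl
  · refine smoothFormOn_of_locally fun p _ => ⟨B.proj ⁻¹' V (a (B.proj p)),
      B.isOpen_preimage (h.isOpen _), ha _, ?_⟩
    refine (((h.coframe.smooth (a (B.proj p))).clm_apply (Φ := fun _ => π₂)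
      contMDiffOn_const).clm_apply (Φ := fun q => Ψ (B.proj q))
      (hΨ.comp B.contMDiff_proj).contMDiffOn).congr fun q hq v => hθe _ q hq v
  · refine hinj (B.proj p) ?_
    rw [hΦθ _ p (ha _)]
    have h1 := hΦθ (a (B.proj p)) (g • p) (by rw [B.proj_smul]; exact ha _)
      (mfderiv (𝓡 (m + 1 + k)) (𝓡 (m + 1 + k)) (fun q : P => g • q) p v)
    rw [B.proj_smul] at h1
    rw [h1]
    exact congrArg π₂ (h.translate_eq (ha _) v g)
  · refine hinj (B.proj p) ?_
    rw [hΦθ _ p (ha _)]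
    exact funext fun s => hΦe _ p (ha _) c s

end IsPartiallyGaugeFixed

/-- The transition law of the gauge fields is `θ` evaluated on the derivative of `sec j = γ_ij • sec
i`. -/
theorem isKKFields_of_isKKCoframe {B : PrincipalBundle k m G P X ι}
    {b : Module.Basis (Fin k) ℝ (LieAlg k)} {V : A → Set X}
    {e : A → OneForm (m + 1 + k) P (Fin (m + 1) ⊕ Fin k → ℝ)}
    {θ : OneForm (m + 1 + k) P (LieAlg k)}
    {eh : A → OneForm (m + 1) X (Fin (m + 1) → ℝ)} {Φ : X → LieAlg k →L[ℝ] (Fin k → ℝ)}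
    (h : IsKKCoframe B V θ eh Φ e) (hθ : IsConnection G θ) (hV : ∀ a, IsOpen (V a))
    (he : IsCoframe (minkowskiSum m k) (fun a => B.proj ⁻¹' V a) e)
    (hΦ : ContMDiff (𝓡 (m + 1)) 𝓘(ℝ, LieAlg k →L[ℝ] (Fin k → ℝ)) ∞ Φ)
    (hdet : ∀ x, 0 < (componentMatrix b (Φ x)).det) :
    IsKKFields B b V ⟨eh, fun i x => (θ (B.sec i x)).comp
      (mfderiv (𝓡 (m + 1)) (𝓡 (m + 1 + k)) (B.sec i) x), Φ⟩ where
  coframe := h.isCoframe hθ hV he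
  gauge_smooth := fun i => hθ.smooth.pullback (B.isOpen_U i) (B.contMDiffOn_sec i)
    fun _ _ => trivial
  gauge_transition := fun i j x hx => by
    have hU := (B.isOpen_U i).inter (B.isOpen_U j)
    ext1 w
    have h1 := hθ.apply_mfderiv_smul B.contMDiff_smul (u := B.transition i j) (s := B.sec i)
      (((B.contMDiffOn_transition i j).contMDiffAt (hU.mem_nhds hx)).mdifferentiableAt (by simp))
      (B.mdifferentiableAt_sec hx.1) w
    refine Eq.trans ?_ h1
    refine Eq.trans ?_ (θ.congr_point (B.transition_smul_sec hx.1 hx.2).symm _)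
    refine congrArg (θ (B.sec j x)) (mfderiv_congr_fun ?_ w)
    filter_upwards [hU.mem_nhds hx] with y hy
    exact (B.transition_smul_sec hy.1 hy.2).symm
  scalar_smooth := hΦ
  scalar_det_pos := fun x b' hb' => by
    rw [det_componentMatrix b b']
    exact mul_pos (hdet x) hb'

end Bundle

/-! ### Flat local connections, and the correspondence with fields on the base. -/

section Bundle

variable {k m : ℕ} {G P X ι A : Type*}
  [TopologicalSpace G] [ChartedSpace (EuclideanSpace ℝ (Fin k)) G] [CommGroup G]
  [LieGroup (𝓡 k) ∞ G]
  [TopologicalSpace P] [ChartedSpace (EuclideanSpace ℝ (Fin (m + 1 + k))) P]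
  [IsManifold (𝓡 (m + 1 + k)) ∞ P] [MulAction G P]
  [TopologicalSpace X] [ChartedSpace (EuclideanSpace ℝ (Fin (m + 1))) X]
  [IsManifold (𝓡 (m + 1)) ∞ X]

theorem mcForm_congr {n : ℕ} {N : Type*} [TopologicalSpace N]
    [ChartedSpace (EuclideanSpace ℝ (Fin n)) N] [IsManifold (𝓡 n) ∞ N] {u v : N → G} {x : N} (h : u =ᶠ[nhds x] v)
    (w : EuclideanSpace ℝ (Fin n)) : mcForm n k u x w = mcForm n k v x w :=
  mfderiv_congr_fun (h.mono fun y hy => by rw [hy, h.eq_of_nhds]) w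

theorem mcForm_const_mul {n : ℕ} {N : Type*} [TopologicalSpace N]
    [ChartedSpace (EuclideanSpace ℝ (Fin n)) N] [IsManifold (𝓡 n) ∞ N] (g : G) (u : N → G) (x : N)
    (w : EuclideanSpace ℝ (Fin n)) : mcForm n k (fun y => g * u y) x w = mcForm n k u x w :=
  mfderiv_congr_fun (Filter.Eventually.of_forall fun y => by
    simp only [mul_inv_rev, mul_assoc, inv_mul_cancel_left]) w

theorem mcForm_const {n : ℕ} {N : Type*} [TopologicalSpace N]
    [ChartedSpace (EuclideanSpace ℝ (Fin n)) N] [IsManifold (𝓡 n) ∞ N] (g : G) (x : N)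
    (w : EuclideanSpace ℝ (Fin n)) : mcForm n k (fun _ : N => g) x w = 0 := by
  have h : mcForm n k (fun _ : N => g) x = 0 := mfderiv_const
  rw [h]
  rfl

namespace PrincipalBundle

theorem triv_smul (B : PrincipalBundle k m G P X ι) {i : ι} {p : P} (hp : B.proj p ∈ B.U i)
    (g : G) : B.triv i (g • p) = g * B.triv i p := by
  refine B.smul_cancel (p := B.sec i (B.proj p)) ?_
  have h := B.triv_smul_sec i (g • p) (by rwa [B.proj_smul])
  rw [B.proj_smul] at h
  rw [h, mul_smul, B.triv_smul_sec i p hp]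

/-- Together with the next two lemmas: the Maurer–Cartan form pulled back by `triv i` is the flat
connection of the trivialization, that is, invariant, normalized on fundamental fields, and zero
along `sec i`. -/
theorem mcForm_triv_smul (B : PrincipalBundle k m G P X ι) {i : ι} {p : P}
    (hp : B.proj p ∈ B.U i) (g : G) (v : EuclideanSpace ℝ (Fin (m + 1 + k))) :
    mcForm (m + 1 + k) k (B.triv i) (g • p)
      (mfderiv (𝓡 (m + 1 + k)) (𝓡 (m + 1 + k)) (fun q : P => g • q) p v) =
      mcForm (m + 1 + k) k (B.triv i) p v := by
  refine (mcForm_comp (u := B.triv i) (f := fun q : P => g • q) (x := p)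
    (B.mdifferentiableAt_triv (by rwa [B.proj_smul]))
    ((contMDiff_const_smul_of_smul B.contMDiff_smul g).mdifferentiableAt (by simp)) v).symm.trans ?_
  refine (mcForm_congr ?_ v).trans (mcForm_const_mul g (B.triv i) p v)
  filter_upwards [(B.isOpen_preimage (B.isOpen_U i)).mem_nhds hp] with q hq
  exact B.triv_smul hq g

theorem mcForm_triv_fundamental (B : PrincipalBundle k m G P X ι) {i : ι} {p : P}
    (hp : B.proj p ∈ B.U i) (c : LieAlg k) :
    mcForm (m + 1 + k) k (B.triv i) p (fundamental G P c p) = c := by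
  have h1 := mcForm_comp (n := k) (u := B.triv i) (f := fun g : G => g • p) (x := 1)
    (B.mdifferentiableAt_triv (by rwa [B.proj_smul]))
    ((contMDiff_smul_const_of_smul B.contMDiff_smul p).mdifferentiableAt (by simp)) c
  refine (OneForm.congr_point _ (one_smul G p).symm _).trans (h1.symm.trans ?_)
  refine (mfderiv_congr_fun (N := G) (M := G) (n := k) (n' := k) (z := 1)
    (f := fun g => (B.triv i ((1 : G) • p))⁻¹ * B.triv i (g • p)) (f' := id)
    (Filter.Eventually.of_forall fun g => ?_) c).trans ?_
  · change (B.triv i ((1 : G) • p))⁻¹ * B.triv i (g • p) = g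
    rw [one_smul, B.triv_smul hp, mul_comm g, inv_mul_cancel_left]
  · rw [mfderiv_id]
    rfl

theorem mcForm_triv_sec (B : PrincipalBundle k m G P X ι) {i : ι} {x : X} (hx : x ∈ B.U i)
    (w : EuclideanSpace ℝ (Fin (m + 1))) :
    mcForm (m + 1 + k) k (B.triv i) (B.sec i x)
      (mfderiv (𝓡 (m + 1)) (𝓡 (m + 1 + k)) (B.sec i) x w) = 0 := by
  refine (mcForm_comp (u := B.triv i) (f := B.sec i) (x := x)
    (B.mdifferentiableAt_triv (by rwa [B.proj_sec i x hx])) (B.mdifferentiableAt_sec hx) w).symm.trans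
    ?_
  refine (mcForm_congr ?_ w).trans (mcForm_const 1 x w)
  filter_upwards [(B.isOpen_U i).mem_nhds hx] with y hy
  exact B.triv_sec hy

/-- Two flat connections differ by a form from the base, because `triv i` is `triv j` times the
transition function composed with the projection. -/
theorem mcForm_triv_eq (B : PrincipalBundle k m G P X ι) {i j : ι} {p : P}
    (hi : B.proj p ∈ B.U i) (hj : B.proj p ∈ B.U j) (v : EuclideanSpace ℝ (Fin (m + 1 + k))) :
    mcForm (m + 1 + k) k (B.triv i) p v = mcForm (m + 1 + k) k (B.triv j) p v +
      mcForm (m + 1) k (B.transition i j) (B.proj p)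
        (mfderiv (𝓡 (m + 1 + k)) (𝓡 (m + 1)) B.proj p v) := by
  have hU := (B.isOpen_U i).inter (B.isOpen_U j)
  have ht : MDifferentiableAt (𝓡 (m + 1)) (𝓡 k) (B.transition i j) (B.proj p) :=
    ((B.contMDiffOn_transition i j).contMDiffAt (hU.mem_nhds ⟨hi, hj⟩)).mdifferentiableAt (by simp)
  have h1 := mcForm_mul (B.mdifferentiableAt_triv hj) (ht.comp p (B.mdifferentiableAt_proj p))
  refine (mcForm_congr (v := fun q => B.triv j q * (B.transition i j ∘ B.proj) q) ?_ v).trans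
    ((congrArg (fun L : EuclideanSpace ℝ (Fin (m + 1 + k)) →L[ℝ] LieAlg k => L v) h1).trans ?_)
  · filter_upwards [(B.isOpen_preimage hU).mem_nhds ⟨hi, hj⟩] with q hq
    exact B.triv_eq_mul hq.1 hq.2
  · exact congrArg (mcForm (m + 1 + k) k (B.triv j) p v + ·)
      (mcForm_comp ht (B.mdifferentiableAt_proj p) v)

end PrincipalBundle

/-- A connection is determined by its local gauge fields. -/
theorem IsConnection.form_eq {B : PrincipalBundle k m G P X ι}
    {θ : OneForm (m + 1 + k) P (LieAlg k)} (hθ : IsConnection G θ) {i : ι} {p : P}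
    (hp : B.proj p ∈ B.U i) (v : EuclideanSpace ℝ (Fin (m + 1 + k))) :
    θ p v = θ (B.sec i (B.proj p)) (mfderiv (𝓡 (m + 1)) (𝓡 (m + 1 + k)) (B.sec i) (B.proj p)
      (mfderiv (𝓡 (m + 1 + k)) (𝓡 (m + 1)) B.proj p v)) +
        mcForm (m + 1 + k) k (B.triv i) p v :=
  (B.form_eq θ hp v).trans (congrArg₂ (· + ·) (hθ.invariant _ _ _) (hθ.fundamental _ _))

/-- Local gauge fields with the transition law of a bundle are pullbacks of a connection. -/
theorem exists_connection {B : PrincipalBundle k m G P X ι} {α : ι → OneForm (m + 1) X (LieAlg k)}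
    (hα : ∀ i, SmoothFormOn (α i) (B.U i))
    (htr : ∀ i j, ∀ x ∈ B.U i ∩ B.U j, α j x = α i x + pullbackMC (B.transition i j) x) :
    ∃ θ : OneForm (m + 1 + k) P (LieAlg k), IsConnection G θ ∧
      ∀ i, ∀ x ∈ B.U i, ∀ w, α i x w =
        θ (B.sec i x) (mfderiv (𝓡 (m + 1)) (𝓡 (m + 1 + k)) (B.sec i) x w) := by
  choose i hi using B.cover_U
  -- The pullback of `α i` plus the flat connection of `triv i`. On overlaps the jump of `α` cancels
  -- the jump of the flat connections.
  let θ' : ι → OneForm (m + 1 + k) P (LieAlg k) := fun i p =>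
    (α i (B.proj p)).comp (mfderiv (𝓡 (m + 1 + k)) (𝓡 (m + 1)) B.proj p) +
      mcForm (m + 1 + k) k (B.triv i) p
  have key : ∀ i j p, B.proj p ∈ B.U i → B.proj p ∈ B.U j → ∀ v, θ' i p v = θ' j p v := by
    intro i j p hi hj v
    have h1 := congrArg (fun L : EuclideanSpace ℝ (Fin (m + 1)) →L[ℝ] LieAlg k =>
      L (mfderiv (𝓡 (m + 1 + k)) (𝓡 (m + 1)) B.proj p v)) (htr i j _ ⟨hi, hj⟩)
    have h2 := B.mcForm_triv_eq hi hj v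
    change α i (B.proj p) (mfderiv (𝓡 (m + 1 + k)) (𝓡 (m + 1)) B.proj p v) +
      mcForm (m + 1 + k) k (B.triv i) p v = α j (B.proj p)
        (mfderiv (𝓡 (m + 1 + k)) (𝓡 (m + 1)) B.proj p v) + mcForm (m + 1 + k) k (B.triv j) p v
    refine (congrArg (_ + ·) h2).trans (Eq.trans ?_ (congrArg (· + _) h1.symm))
    change _ = (_ + mcForm (m + 1) k (B.transition i j) (B.proj p) _) + _
    exact (fun a b c => by abel : ∀ a b c : LieAlg k, a + (b + c) = (a + c) + b) _ _ _
  let θ : OneForm (m + 1 + k) P (LieAlg k) := fun p => θ' (i (B.proj p)) p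
  have hθ : ∀ j p, B.proj p ∈ B.U j → ∀ v, θ p v = θ' j p v := fun j p hp v =>
    key _ _ p (hi _) hp v
  refine ⟨θ, ⟨?_, fun g p v => ?_, fun c p => ?_⟩, fun j x hx w => ?_⟩
  · refine smoothFormOn_of_locally fun p _ => ⟨B.proj ⁻¹' B.U (i (B.proj p)),
      B.isOpen_preimage (B.isOpen_U _), hi _, ?_⟩
    refine SmoothFormOn.congr (α := θ' (i (B.proj p))) (SmoothFormOn.add ?_ ?_)
      fun q hq v => hθ _ q hq v
    · exact (hα _).pullback (B.isOpen_preimage (B.isOpen_U _)) B.contMDiff_proj.contMDiffOn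
        fun _ hq => hq
    · exact smoothFormOn_mcForm (B.isOpen_preimage (B.isOpen_U _)) (B.contMDiffOn_triv _)
  · have hp := hi (B.proj p)
    refine (hθ (i (B.proj p)) (g • p) (by rwa [B.proj_smul]) _).trans ?_
    refine congrArg₂ (· + ·) ?_ (B.mcForm_triv_smul hp g v)
    refine (congrArg (α (i (B.proj p)) (B.proj (g • p))) (B.mfderiv_proj_smul g p v)).trans ?_
    exact OneForm.congr_point _ (B.proj_smul g p) _
  · refine (congrArg₂ (· + ·) ?_ (B.mcForm_triv_fundamental (hi _) c)).trans (zero_add c)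
    exact (congrArg (α (i (B.proj p)) (B.proj p)) (B.mfderiv_proj_fundamental c p)).trans
      (map_zero _)
  · refine Eq.symm ((hθ j _ (by rwa [B.proj_sec j x hx]) _).trans ?_)
    refine (congrArg₂ (· + ·) ?_ (B.mcForm_triv_sec hx w)).trans (add_zero (α j x w))
    refine (congrArg (α j (B.proj (B.sec j x))) (B.mfderiv_proj_sec hx w)).trans ?_
    exact OneForm.congr_point _ (B.proj_sec j x hx) _

theorem Encodes.exists_isKKCoframe {B : PrincipalBundle k m G P X ι} {V : A → Set X}
    {e : A → OneForm (m + 1 + k) P (Fin (m + 1) ⊕ Fin k → ℝ)} {F : KKFields k m X ι A}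
    (h : Encodes B V e F) : ∃ θ : OneForm (m + 1 + k) P (LieAlg k), IsConnection G θ ∧
      IsKKCoframe B V θ F.eh F.scalar e ∧ (∀ i, ∀ x ∈ B.U i, ∀ w, F.gauge i x w =
      θ (B.sec i x) (mfderiv (𝓡 (m + 1)) (𝓡 (m + 1 + k)) (B.sec i) x w)) := by
  obtain ⟨θ, hθ, -, h1, h2⟩ := h
  exact ⟨θ, hθ, h2, h1⟩

/-- Partially gauge-fixed coframes have Kosmann-invariant representatives. -/
theorem IsPartiallyGaugeFixed.kosmannInvariant {B : PrincipalBundle k m G P X ι}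
    {b : Module.Basis (Fin k) ℝ (LieAlg k)} {V : A → Set X}
    {e : A → OneForm (m + 1 + k) P (Fin (m + 1) ⊕ Fin k → ℝ)}
    (h : IsPartiallyGaugeFixed B b V e) : KosmannInvariant G (fun a => B.proj ⁻¹' V a) e :=
  fun c a _ hp v => kosmannLieDeriv_eq_zero (B.isOpen_preimage (h.isOpen a)) (h.coframe.smooth a)
    (h.coframe.iso a) (h.invariant c a) hp v

/-- On fundamental vectors the metric is `Φ c · Φ c`, and `Φ` is injective. -/
theorem IsPartiallyGaugeFixed.spacelikeFibers [ConnectedSpace G] {B : PrincipalBundle k m G P X ι}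
    {b : Module.Basis (Fin k) ℝ (LieAlg k)} {V : A → Set X}
    {e : A → OneForm (m + 1 + k) P (Fin (m + 1) ⊕ Fin k → ℝ)}
    (h : IsPartiallyGaugeFixed B b V e) : SpacelikeFibers G (fun a => B.proj ⁻¹' V a) e := by
  obtain ⟨θ, eh, Φ, he, hθ, -, hdet⟩ := h.exists_isKKCoframe
  intro c hc a p hp
  rw [he.apply_fundamental hθ hp, pairing_minkowskiSum, Sum.elim_comp_inl, Sum.elim_comp_inr]
  have h1 : pairing (minkowski m) 0 0 = 0 := by simp [pairing]
  rw [h1, zero_add]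
  exact dotProduct_self_pos fun h0 => hc
    (injective_of_det_componentMatrix (hdet (B.proj p)).ne' (h0.trans (map_zero _).symm))

theorem IsPartiallyGaugeFixed.exists_encodes [ConnectedSpace G] {B : PrincipalBundle k m G P X ι}
    {b : Module.Basis (Fin k) ℝ (LieAlg k)} {V : A → Set X}
    {e : A → OneForm (m + 1 + k) P (Fin (m + 1) ⊕ Fin k → ℝ)}
    (h : IsPartiallyGaugeFixed B b V e) :
    ∃ F : KKFields k m X ι A, IsKKFields B b V F ∧ Encodes B V e F ∧
      ∀ F' : KKFields k m X ι A, Encodes B V e F' → KKFields.Agree B V F F' := by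
  obtain ⟨θ, eh, Φ, he, hθ, hΦ, hdet⟩ := h.exists_isKKCoframe
  refine ⟨_, isKKFields_of_isKKCoframe he hθ h.isOpen h.coframe hΦ hdet,
    he.encodes hθ hdet (fun _ _ _ _ => rfl) rfl (fun _ _ _ _ => rfl), fun F' hF' => ?_⟩
  obtain ⟨θ', hθ', he', hF⟩ := hF'.exists_isKKCoframe
  obtain ⟨h1, h2, h3⟩ := he.unique hθ hdet h.cover he' hθ'
  exact ⟨fun a x hx => by ext1 w; exact h1 a x hx w,
    fun i x hx => by ext1 w; exact (h3 _ _).trans (hF i x hx w).symm, h2⟩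

/-- Every collection of fields is encoded by a unique partially gauge-fixed coframe. -/
theorem IsKKFields.exists_encodes {B : PrincipalBundle k m G P X ι}
    {b : Module.Basis (Fin k) ℝ (LieAlg k)} {V : A → Set X} {F : KKFields k m X ι A}
    (h : IsKKFields B b V F) :
    ∃ e : A → OneForm (m + 1 + k) P (Fin (m + 1) ⊕ Fin k → ℝ),
      IsPartiallyGaugeFixed B b V e ∧ Encodes B V e F ∧
      ∀ e' : A → OneForm (m + 1 + k) P (Fin (m + 1) ⊕ Fin k → ℝ),
        Encodes B V e' F → ∀ (a : A) (p : P), B.proj p ∈ V a → e' a p = e a p := by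
  obtain ⟨θ, hθ, hF⟩ := exists_connection h.gauge_smooth h.gauge_transition
  have hdet : ∀ x, 0 < (componentMatrix b (F.scalar x)).det := fun x =>
    h.scalar_det_pos x b (by rw [b.det_self]; exact one_pos)
  have he := isKKCoframe_kkCoframe B V θ F.eh F.scalar
  refine ⟨kkCoframe B θ F.eh F.scalar, he.isPartiallyGaugeFixed hθ h.coframe.isOpen h.coframe.cover
    h.coframe.smooth h.coframe.iso h.scalar_smooth hdet (he.exists_transition h.coframe),
    he.encodes hθ hdet (fun _ _ _ _ => rfl) rfl hF, fun e' he' a p hp => ?_⟩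
  obtain ⟨θ', hθ', he', hF'⟩ := he'.exists_isKKCoframe
  ext1 v
  rw [he' a p hp, he a p hp]
  obtain ⟨i, hi⟩ := B.cover_U (B.proj p)
  have h1 : θ' p v = θ p v := by
    refine (hθ'.form_eq hi v).trans (Eq.trans (congrArg (· + _) ?_) (hθ.form_eq hi v).symm)
    exact (hF' i _ hi _).symm.trans (hF i _ hi _)
  rw [h1]

end Bundle

/-! ### Gauge transformations, rotations and changes of sections. -/

section Bundle

variable {k m : ℕ} {G P X ι A : Type*}
  [TopologicalSpace G] [ChartedSpace (EuclideanSpace ℝ (Fin k)) G] [CommGroup G]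
  [LieGroup (𝓡 k) ∞ G]
  [TopologicalSpace P] [ChartedSpace (EuclideanSpace ℝ (Fin (m + 1 + k))) P]
  [IsManifold (𝓡 (m + 1 + k)) ∞ P] [MulAction G P]
  [TopologicalSpace X] [ChartedSpace (EuclideanSpace ℝ (Fin (m + 1))) X]
  [IsManifold (𝓡 (m + 1)) ∞ X]

theorem mulVecL_apply {ν : Type*} [Fintype ν] [DecidableEq ν] (C : Matrix ν ν ℝ) (v : ν → ℝ) :
    mulVecL C v = C.mulVec v := rfl

theorem contMDiffOn_mulVecL {E H Q ν : Type*} [Fintype ν] [DecidableEq ν]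
    [NormedAddCommGroup E] [NormedSpace ℝ E]
    [TopologicalSpace H] [TopologicalSpace Q] [ChartedSpace H Q] {I : ModelWithCorners ℝ E H}
    {S : Set Q} {M : Q → Matrix ν ν ℝ} (hM : SmoothMatrixOn I M S) :
    ContMDiffOn I 𝓘(ℝ, (ν → ℝ) →L[ℝ] (ν → ℝ)) ∞ (fun x => mulVecL (M x)) S := by
  refine (contMDiffOn_matrixCLM (Pi.basisFun ℝ ν) (fun s => Pi.single s (1 : ℝ)) hM).congr
    fun x _ => ?_
  ext1 v
  rw [mulVecL_apply, matrixCLM_single]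
  congr 1

/-- Coframes are invariant under local gauge transformations. -/
theorem IsCoframe.mulVecL {n : ℕ} {M ν : Type*} [TopologicalSpace M]
    [ChartedSpace (EuclideanSpace ℝ (Fin n)) M] [IsManifold (𝓡 n) ∞ M] [Fintype ν] [DecidableEq ν]
    {η : Matrix ν ν ℝ} {V : A → Set M} {e : A → OneForm n M (ν → ℝ)} (he : IsCoframe η V e)
    (hν : Fintype.card ν = n) {C : A → M → Matrix ν ν ℝ}
    (hC : ∀ a, SmoothMatrixOn (𝓡 n) (C a) (V a)) (hSO : ∀ a, ∀ x ∈ V a, C a x ∈ SO η) :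
    IsCoframe η V (fun a x => (mulVecL (C a x)).comp (e a x)) where
  isOpen := he.isOpen
  cover := he.cover
  smooth := fun a => (he.smooth a).clm_apply (contMDiffOn_mulVecL (hC a))
  iso := fun a x hx => by
    refine isInvertible_of_injective hν fun v w hvw => (he.iso a x hx).injective ?_
    have h1 : (C a x)⁻¹.mulVec ((C a x).mulVec (e a x v)) =
      (C a x)⁻¹.mulVec ((C a x).mulVec (e a x w)) := congrArg _ hvw
    rwa [Matrix.mulVec_mulVec, Matrix.mulVec_mulVec, SO.inv_mul (hSO a x hx), Matrix.one_mulVec,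
      Matrix.one_mulVec] at h1
  transition := fun a a' x hx => by
    obtain ⟨γ, hγ, hγe⟩ := he.transition a a' x hx
    refine ⟨C a' x * γ * (C a x)⁻¹, SO.mul_mem (SO.mul_mem (hSO a' x hx.2) hγ)
      (SO.inv_mem (hSO a x hx.1)), fun v => ?_⟩
    change (C a' x).mulVec (e a' x v) = Matrix.mulVec _ ((C a x).mulVec (e a x v))
    rw [hγe, Matrix.mulVec_mulVec, Matrix.mulVec_mulVec, Matrix.mul_assoc (C a' x * γ),
      SO.inv_mul (hSO a x hx.1), Matrix.mul_one]

theorem mfderiv_proj_gaugeAut (B : PrincipalBundle k m G P X ι) {u : X → G} {p : P}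
    (hu : MDifferentiableAt (𝓡 (m + 1)) (𝓡 k) u (B.proj p))
    (v : EuclideanSpace ℝ (Fin (m + 1 + k))) :
    (mfderiv (𝓡 (m + 1 + k)) (𝓡 (m + 1)) B.proj (gaugeAut B u p)
      (mfderiv (𝓡 (m + 1 + k)) (𝓡 (m + 1 + k)) (gaugeAut B u) p v) :
        EuclideanSpace ℝ (Fin (m + 1))) =
      mfderiv (𝓡 (m + 1 + k)) (𝓡 (m + 1)) B.proj p v := by
  have h1 : MDifferentiableAt (𝓡 (m + 1 + k)) (𝓡 (m + 1 + k)) (gaugeAut B u) p :=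
    (B.contMDiff_smul.mdifferentiableAt (by simp)).comp p
      ((hu.comp p (B.mdifferentiableAt_proj p)).prodMk mdifferentiableAt_id)
  refine (mfderiv_comp_eval (B.mdifferentiableAt_proj _) h1 v).symm.trans ?_
  exact mfderiv_congr_fun (Filter.Eventually.of_forall fun q => B.proj_smul _ q) v

/-- A form pulled back from the base is invariant and vanishes on fundamental fields. It is applied
with `α = u⁻¹ du`. -/
theorem IsConnection.gauge_transform {B : PrincipalBundle k m G P X ι}
    {θ : OneForm (m + 1 + k) P (LieAlg k)} (hθ : IsConnection G θ) {α : OneForm (m + 1) X (LieAlg k)}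
    (hα : SmoothFormOn α Set.univ) :
    IsConnection G (fun p => θ p +
      (α (B.proj p)).comp (mfderiv (𝓡 (m + 1 + k)) (𝓡 (m + 1)) B.proj p) :
        OneForm (m + 1 + k) P (LieAlg k)) where
  smooth := hθ.smooth.add (hα.pullback isOpen_univ B.contMDiff_proj.contMDiffOn fun _ _ => trivial)
  invariant := fun g p v => by
    refine congrArg₂ (· + ·) (hθ.invariant g p v) ?_
    refine (congrArg (α (B.proj (g • p))) (B.mfderiv_proj_smul g p v)).trans ?_
    exact OneForm.congr_point _ (B.proj_smul g p) _
  fundamental := fun c p => by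
    refine (congrArg₂ (· + ·) (hθ.fundamental c p) ?_).trans (add_zero c)
    exact (congrArg (α (B.proj p)) (B.mfderiv_proj_fundamental c p)).trans (map_zero _)

/-- Pulling back along the bundle automorphism preserves dπ and adds the pullback of `u⁻¹ du` to
`θ`; the rotations act only on `eh` and on the scalar. So the result is again of the form
`IsKKCoframe`, from which both claims follow. -/
theorem IsPartiallyGaugeFixed.transform [ConnectedSpace G] {B : PrincipalBundle k m G P X ι}
    {b : Module.Basis (Fin k) ℝ (LieAlg k)} {V : A → Set X}
    {e : A → OneForm (m + 1 + k) P (Fin (m + 1) ⊕ Fin k → ℝ)} {F : KKFields k m X ι A}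
    (h : IsPartiallyGaugeFixed B b V e) (hF : Encodes B V e F) {u : X → G}
    {Λ : A → X → Matrix (Fin (m + 1)) (Fin (m + 1)) ℝ} {R : X → Matrix (Fin k) (Fin k) ℝ}
    (hu : ContMDiff (𝓡 (m + 1)) (𝓡 k) ∞ u) (hΛ : ∀ a, SmoothMatrixOn (𝓡 (m + 1)) (Λ a) (V a))
    (hΛSO : ∀ a, ∀ x ∈ V a, Λ a x ∈ SO (minkowski m))
    (hR : SmoothMatrixOn (𝓡 (m + 1)) R Set.univ)
    (hRSO : ∀ x, R x ∈ SO (1 : Matrix (Fin k) (Fin k) ℝ)) :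
    IsPartiallyGaugeFixed B b V (transformCoframe B u Λ R e) ∧
      Encodes B V (transformCoframe B u Λ R e) (KKFields.transform u Λ R F) := by
  obtain ⟨θ₀, eh₀, Φ₀, he₀, hθ₀, hΦ, hdet⟩ := h.exists_isKKCoframe
  obtain ⟨θ, hθ, he, hg⟩ := hF.exists_isKKCoframe
  -- `Encodes` does not contain smoothness or the determinant condition for `F.scalar`; identifying
  -- it with the scalar obtained from gauge fixing supplies both.
  obtain rfl := (he₀.unique hθ₀ hdet h.cover he hθ).2.1
  have hmc : SmoothFormOn (mcForm (m + 1) k u) Set.univ :=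
    smoothFormOn_mcForm isOpen_univ hu.contMDiffOn
  have hud : ∀ x, MDifferentiableAt (𝓡 (m + 1)) (𝓡 k) u x := fun x =>
    hu.mdifferentiableAt (by simp)
  have hθ' := hθ.gauge_transform (B := B) hmc
  have heh := (he.isCoframe hθ h.isOpen h.coframe).mulVecL (by simp) hΛ hΛSO
  have hdet' : ∀ x, 0 < (componentMatrix b ((KKFields.transform u Λ R F).scalar x)).det := by
    intro x
    have h1 : componentMatrix b ((KKFields.transform u Λ R F).scalar x) =
        R x * componentMatrix b (F.scalar x) := rfl
    rw [h1, Matrix.det_mul, (hRSO x).2, one_mul]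
    exact hdet x
  have hΦ' : ContMDiff (𝓡 (m + 1)) 𝓘(ℝ, LieAlg k →L[ℝ] (Fin k → ℝ)) ∞
      (KKFields.transform u Λ R F).scalar :=
    (contMDiffOn_univ.1 (contMDiffOn_mulVecL hR)).clm_comp hΦ
  have hKK : IsKKCoframe B V (fun p => θ p +
      (mcForm (m + 1) k u (B.proj p)).comp (mfderiv (𝓡 (m + 1 + k)) (𝓡 (m + 1)) B.proj p))
      (KKFields.transform u Λ R F).eh (KKFields.transform u Λ R F).scalar
      (transformCoframe B u Λ R e) := by
    intro a p hp v
    have key : e a (gaugeAut B u p)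
        (mfderiv (𝓡 (m + 1 + k)) (𝓡 (m + 1 + k)) (gaugeAut B u) p v) =
        Sum.elim (F.eh a (B.proj p) (mfderiv (𝓡 (m + 1 + k)) (𝓡 (m + 1)) B.proj p v))
          (F.scalar (B.proj p) (θ p v + mcForm (m + 1) k u (B.proj p)
            (mfderiv (𝓡 (m + 1 + k)) (𝓡 (m + 1)) B.proj p v))) := by
      have hπ : B.proj (gaugeAut B u p) = B.proj p := B.proj_smul _ p
      rw [he a _ (by rwa [hπ])]
      refine congrArg₂ Sum.elim ?_ ?_
      · refine (congrArg (F.eh a (B.proj (gaugeAut B u p)))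
          (mfderiv_proj_gaugeAut B (hud _) v)).trans ?_
        exact OneForm.congr_point _ hπ _
      · rw [hπ]
        refine congrArg (F.scalar (B.proj p)) ?_
        refine (hθ.apply_mfderiv_smul B.contMDiff_smul (u := fun q => u (B.proj q)) (s := id)
          ((hud _).comp p (B.mdifferentiableAt_proj p)) mdifferentiableAt_id v).trans ?_
        refine congrArg₂ (· + ·) ?_ (mcForm_comp (hud _) (B.mdifferentiableAt_proj p) v)
        rw [mfderiv_id]
        rfl
    refine (congrArg (Matrix.mulVec _) key).trans ?_
    rw [Matrix.fromBlocks_mulVec, Sum.elim_comp_inl, Sum.elim_comp_inr, Matrix.zero_mulVec,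
      Matrix.zero_mulVec, add_zero, zero_add]
    rfl
  refine ⟨hKK.isPartiallyGaugeFixed hθ' h.isOpen h.cover heh.smooth heh.iso hΦ' hdet'
    (hKK.exists_transition heh), hKK.encodes hθ' hdet' (fun _ _ _ _ => rfl) rfl fun i x hx w => ?_⟩
  refine congrArg₂ (· + ·) (hg i x hx w) (Eq.symm ?_)
  refine (congrArg (mcForm (m + 1) k u (B.proj (B.sec i x))) (B.mfderiv_proj_sec hx w)).trans ?_
  exact OneForm.congr_point _ (B.proj_sec i x hx) _

theorem Encodes.changeSections {B : PrincipalBundle k m G P X ι} {V : A → Set X}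
    {e : A → OneForm (m + 1 + k) P (Fin (m + 1) ⊕ Fin k → ℝ)} {F : KKFields k m X ι A}
    (hF : Encodes B V e F) {u : ι → X → G}
    (hu : ∀ i, ContMDiffOn (𝓡 (m + 1)) (𝓡 k) ∞ (u i) (B.U i)) :
    Encodes (B.changeSections u hu) V e (KKFields.changeSections u F) := by
  obtain ⟨θ, hθ, hort, hg, he⟩ := hF
  refine ⟨θ, hθ, hort, fun i x hx w => ?_, he⟩
  refine Eq.trans ?_ (hθ.apply_mfderiv_smul B.contMDiff_smul
    (((hu i).contMDiffAt ((B.isOpen_U i).mem_nhds hx)).mdifferentiableAt (by simp))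
    (B.mdifferentiableAt_sec hx) w).symm
  exact congrArg (· + _) (hg i x hx w)

end Bundle

/-! ### Timelike vectors and their orthogonal complements. -/

theorem minkowskiSum_eq_diagonal (m k : ℕ) :
    minkowskiSum m k = Matrix.diagonal (Sum.elim (Fin.cons (-1) (fun _ => 1)) (fun _ => 1)) := by
  rw [minkowskiSum, minkowski, ← Matrix.diagonal_one, Matrix.fromBlocks_diagonal]

/-- The Minkowski form is positive on the orthogonal complement of a timelike vector. -/
theorem pairing_pos_of_orthogonal {m k : ℕ} {u y : Fin (m + 1) ⊕ Fin k → ℝ}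
    (hu : pairing (minkowskiSum m k) u u < 0) (huy : pairing (minkowskiSum m k) u y = 0)
    (hy : y ≠ 0) : 0 < pairing (minkowskiSum m k) y y := by
  have key : ∀ v w : Fin (m + 1) ⊕ Fin k → ℝ, pairing (minkowskiSum m k) v w =
      -(v (Sum.inl 0) * w (Sum.inl 0)) +
        ∑ i : Fin m ⊕ Fin k, v (Sum.map Fin.succ id i) * w (Sum.map Fin.succ id i) := by
    intro v w
    rw [minkowskiSum_eq_diagonal, pairing, dotProduct, Fintype.sum_sum_type, Fin.sum_univ_succ,
      Fintype.sum_sum_type]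
    simp [Matrix.mulVec_diagonal, add_assoc]
  rw [key] at hu huy ⊢
  -- Cauchy–Schwarz on the spatial parts. If `y` were not spacelike, then T² ≤ U Y with T = u₀ y₀
  -- and U < u₀² would force y₀ = 0, then Y = 0, and so `y = 0`.
  have hcs := Finset.sum_mul_sq_le_sq_mul_sq Finset.univ
    (fun i : Fin m ⊕ Fin k => u (Sum.map Fin.succ id i)) (fun i => y (Sum.map Fin.succ id i))
  simp only [pow_two] at hcs
  set U := ∑ i : Fin m ⊕ Fin k, u (Sum.map Fin.succ id i) * u (Sum.map Fin.succ id i)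
  set Y := ∑ i : Fin m ⊕ Fin k, y (Sum.map Fin.succ id i) * y (Sum.map Fin.succ id i) with hYdef
  set T := ∑ i : Fin m ⊕ Fin k, u (Sum.map Fin.succ id i) * y (Sum.map Fin.succ id i)
  have hU : 0 ≤ U := Finset.sum_nonneg fun i _ => mul_self_nonneg _
  have hY : 0 ≤ Y := Finset.sum_nonneg fun i _ => mul_self_nonneg _
  by_contra hle
  have hle : Y ≤ y (Sum.inl 0) * y (Sum.inl 0) := by linarith
  have hT : T = u (Sum.inl 0) * y (Sum.inl 0) := by linarith
  rw [hT] at hcs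
  have h0 : y (Sum.inl 0) * y (Sum.inl 0) = 0 := by
    have h1 : U * Y ≤ U * (y (Sum.inl 0) * y (Sum.inl 0)) := mul_le_mul_of_nonneg_left hle hU
    have h2 : (u (Sum.inl 0) * u (Sum.inl 0) - U) * (y (Sum.inl 0) * y (Sum.inl 0)) ≤ 0 := by
      linarith
    exact le_antisymm (nonpos_of_mul_nonpos_right h2 (by linarith)) (mul_self_nonneg _)
  have hY0 : Y = 0 := le_antisymm (hle.trans h0.le) hY
  refine hy (funext fun i => ?_)
  have h1 := (Finset.sum_eq_zero_iff_of_nonneg fun i _ => mul_self_nonneg _).1 hY0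
  rcases i with i | s
  · refine Fin.cases (mul_self_eq_zero.1 h0) (fun j => ?_) i
    exact mul_self_eq_zero.1 (h1 (Sum.inl j) (Finset.mem_univ _))
  · exact mul_self_eq_zero.1 (h1 (Sum.inr s) (Finset.mem_univ _))

/-! ### Orthogonal projection and smooth Gram–Schmidt with a sign. -/

section GramSchmidt

variable {E H Q : Type*} [NormedAddCommGroup E] [NormedSpace ℝ E] [TopologicalSpace H]
  [TopologicalSpace Q] [ChartedSpace H Q] {I : ModelWithCorners ℝ E H} {S : Set Q}
  {ν κ μ : Type*} [Fintype ν] [DecidableEq ν] [Fintype κ] [DecidableEq κ] [Fintype μ]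

theorem SmoothMatrixOn.sub {h h' : Q → Matrix ν μ ℝ} (hh : SmoothMatrixOn I h S)
    (hh' : SmoothMatrixOn I h' S) : SmoothMatrixOn I (fun x => h x - h' x) S :=
  fun i j => (hh i j).sub (hh' i j)

theorem SmoothMatrixOn.smul {c : Q → ℝ} {h : Q → Matrix ν μ ℝ} (hc : ContMDiffOn I 𝓘(ℝ, ℝ) ∞ c S)
    (hh : SmoothMatrixOn I h S) : SmoothMatrixOn I (fun x => c x • h x) S :=
  fun i j => hc.mul (hh i j)

theorem transpose_mul_mul_apply (η : Matrix ν ν ℝ) (N : Matrix ν κ ℝ) (N' : Matrix ν μ ℝ) (s : κ)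
    (t : μ) : (N.transpose * η * N') s t = pairing η (N.transpose s) (N'.transpose t) := by
  rw [pairing, Matrix.dotProduct_mulVec]
  rfl

/-- The columns of `C`, projected to the orthogonal complement of the columns of `N`, where the
latter have the Gram matrix `D` with `D * D = 1`. -/
def orthogonalPart (η : Matrix ν ν ℝ) (D : Matrix κ κ ℝ) (N : Matrix ν κ ℝ) (C : Matrix ν μ ℝ) :
    Matrix ν μ ℝ :=
  C - N * (D * N.transpose * η * C)

theorem orthogonalPart_orthogonal {η : Matrix ν ν ℝ} {D : Matrix κ κ ℝ} {N : Matrix ν κ ℝ}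
    (hD : D * D = 1) (hN : N.transpose * η * N = D) (C : Matrix ν μ ℝ) :
    N.transpose * η * orthogonalPart η D N C = 0 := by
  rw [orthogonalPart, Matrix.mul_sub, ← Matrix.mul_assoc, hN, ← Matrix.mul_assoc D,
    ← Matrix.mul_assoc D, ← Matrix.mul_assoc D, hD, Matrix.one_mul, sub_self]

theorem smoothMatrixOn_orthogonalPart (η : Matrix ν ν ℝ) (D : Matrix κ κ ℝ) {N : Q → Matrix ν κ ℝ}
    (hN : SmoothMatrixOn I N S) (C : Matrix ν μ ℝ) :
    SmoothMatrixOn I (fun x => orthogonalPart η D (N x) C) S :=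
  (smoothMatrixOn_const C).sub (hN.mul ((((smoothMatrixOn_const D).mul hN.transpose).mul
    (smoothMatrixOn_const η)).mul (smoothMatrixOn_const C)))

/-- Columns are multiplied by the inverse Cholesky factor of `ε` times their Gram matrix. The sign
treats timelike lines and spacelike families alike. -/
theorem exists_smooth_gramSchmidt {η : Matrix ν ν ℝ} (hη : η.transpose = η) {ε : ℝ}
    (hε : ε * ε = 1) {l : ℕ} {w : Q → Matrix ν (Fin l) ℝ} (hw : SmoothMatrixOn I w S)
    (hpos : ∀ x ∈ S, ∀ y ≠ 0, 0 < ε * pairing η ((w x).mulVec y) ((w x).mulVec y)) :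
    ∃ L : Q → Matrix (Fin l) (Fin l) ℝ, SmoothMatrixOn I (fun x => w x * L x) S ∧
      ∀ x ∈ S, (w x * L x).transpose * η * (w x * L x) = ε • (1 : Matrix (Fin l) (Fin l) ℝ) := by
  have hsm : SmoothMatrixOn I (fun x => ε • ((w x).transpose * η * w x)) S :=
    SmoothMatrixOn.smul contMDiffOn_const ((hw.transpose.mul (smoothMatrixOn_const η)).mul hw)
  obtain ⟨L, hL, hLs⟩ := exists_smooth_cholesky (I := I) (S := S)
    (fun x => ε • ((w x).transpose * η * w x)) hsm
    (fun x _ i j => by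
      have h1 : ((w x).transpose * η * w x).transpose = (w x).transpose * η * w x := by
        rw [Matrix.transpose_mul, Matrix.transpose_mul, Matrix.transpose_transpose, hη,
          Matrix.mul_assoc]
      exact congrArg (ε * ·) (congrFun (congrFun h1.symm i) j))
    (fun x hx y hy => by
      have h1 := hpos x hx y hy
      rw [pairing_mulVec] at h1
      rwa [pairing, Matrix.smul_mulVec, dotProduct_smul])
  have hdet : ∀ x ∈ S, (L x).det ≠ 0 := fun x hx =>
    (det_pos_of_lowerTriangular (hLs x hx).1 (hLs x hx).2.1).ne'
  refine ⟨fun x => (L x)⁻¹, hw.mul (hL.inv hdet), fun x hx => ?_⟩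
  have hLL := (hLs x hx).2.2
  have h1 : (w x).transpose * η * w x = ε • ((L x).transpose * L x) := by
    rw [hLL, smul_smul, hε, one_smul]
  have hinv := Matrix.mul_nonsing_inv (L x) (isUnit_iff_ne_zero.2 (hdet x hx))
  calc (w x * (L x)⁻¹).transpose * η * (w x * (L x)⁻¹)
      = (L x)⁻¹.transpose * ((w x).transpose * η * w x) * (L x)⁻¹ := by
        rw [Matrix.transpose_mul]; simp only [Matrix.mul_assoc]
    _ = ε • ((L x * (L x)⁻¹).transpose * (L x * (L x)⁻¹)) := by
        rw [h1, Matrix.transpose_mul, Matrix.mul_smul, Matrix.smul_mul]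
        simp only [Matrix.mul_assoc]
    _ = ε • 1 := by rw [hinv, Matrix.transpose_one, Matrix.one_mul]

/-- Completion of orthonormal columns to a basis. -/
theorem exists_completion {η : Matrix ν ν ℝ} {D : Matrix κ κ ℝ} {N : Matrix ν κ ℝ}
    (hD : D * D = 1) (hN : N.transpose * η * N = D) {l : ℕ}
    (hl : Fintype.card κ + l = Fintype.card ν) :
    ∃ C : Matrix ν (Fin l) ℝ, ∀ y z, C.mulVec y = N.mulVec z → y = 0 := by
  have hinj : Function.Injective N.mulVecLin := by
    refine (injective_iff_map_eq_zero _).2 fun g hg => ?_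
    have h1 : N.mulVec g = 0 := hg
    have h2 : D.mulVec g = 0 := by
      rw [← hN, ← Matrix.mulVec_mulVec, h1, Matrix.mulVec_zero]
    rw [← Matrix.one_mulVec g, ← hD, ← Matrix.mulVec_mulVec, h2, Matrix.mulVec_zero]
  obtain ⟨q, hq⟩ := Submodule.exists_isCompl (LinearMap.range N.mulVecLin)
  have hfr : Module.finrank ℝ q = l := by
    have h1 := Submodule.finrank_add_eq_of_isCompl hq
    rw [LinearMap.finrank_range_of_inj hinj, Module.finrank_fintype_fun_eq_card,
      Module.finrank_fintype_fun_eq_card] at h1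
    omega
  let β := Module.finBasisOfFinrankEq ℝ q hfr
  refine ⟨Matrix.of fun i j => (β j : ν → ℝ) i, fun y z hyz => ?_⟩
  have h1 : (Matrix.of fun i j => (β j : ν → ℝ) i).mulVec y = ((∑ j, y j • β j : q) : ν → ℝ) := by
    ext i
    simp [Matrix.mulVec, dotProduct, mul_comm]
  have h2 : ((∑ j, y j • β j : q) : ν → ℝ) = 0 := by
    refine (Submodule.disjoint_def.1 hq.disjoint) _ ?_ (Subtype.property _)
    rw [← h1, hyz]
    exact ⟨z, rfl⟩
  exact funext (Fintype.linearIndependent_iff.1 β.linearIndependent y (Subtype.ext h2))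

end GramSchmidt

theorem pairing_comm {ν : Type*} [Fintype ν] {η : Matrix ν ν ℝ} (hη : η.transpose = η)
    (v w : ν → ℝ) : pairing η v w = pairing η w v := by
  rw [pairing, pairing, dotProduct_comm, Matrix.dotProduct_mulVec, ← Matrix.mulVec_transpose, hη]

/-! ### Smooth local Lorentz frames with prescribed last vectors. -/

section LorentzFrame

variable {E H Q : Type*} [NormedAddCommGroup E] [NormedSpace ℝ E] [TopologicalSpace H]
  [TopologicalSpace Q] [ChartedSpace H Q] {I : ModelWithCorners ℝ E H} {S : Set Q}
  {m k : ℕ}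

/-- The change of sign of the timelike column that makes the determinant one. -/
theorem exists_mem_SO_minkowskiSum {R : Q → Matrix (Fin (m + 1) ⊕ Fin k) (Fin (m + 1) ⊕ Fin k) ℝ}
    (hR : SmoothMatrixOn I R S)
    (hRη : ∀ x ∈ S, (R x).transpose * minkowskiSum m k * R x = minkowskiSum m k) :
    ∃ R' : Q → Matrix (Fin (m + 1) ⊕ Fin k) (Fin (m + 1) ⊕ Fin k) ℝ, SmoothMatrixOn I R' S ∧
      ∀ x ∈ S, R' x ∈ SO (minkowskiSum m k) ∧
        ∀ z, (R' x).mulVec (Sum.elim 0 z) = (R x).mulVec (Sum.elim 0 z) := by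
  let d : Q → Fin (m + 1) ⊕ Fin k → ℝ := fun x =>
    Function.update (fun _ => 1) (Sum.inl 0) (R x).det
  have hd : SmoothMatrixOn I (fun x => Matrix.diagonal (d x)) S := by
    intro i j
    by_cases hij : i = j
    · subst hij
      simp only [Matrix.diagonal_apply_eq, d]
      by_cases hi : i = Sum.inl 0
      · subst hi
        simpa only [Function.update_self] using hR.det
      · simpa only [Function.update_of_ne hi] using contMDiffOn_const
    · simpa only [Matrix.diagonal_apply_ne _ hij] using contMDiffOn_const
  have hdet : ∀ x ∈ S, (R x).det * (R x).det = 1 := by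
    intro x hx
    have h1 := congrArg Matrix.det (hRη x hx)
    rw [Matrix.det_mul, Matrix.det_mul, Matrix.det_transpose] at h1
    refine mul_right_cancel₀ (isUnit_det_minkowskiSum m k).ne_zero ?_
    rw [one_mul]
    exact Eq.trans (by ring) h1
  refine ⟨fun x => R x * Matrix.diagonal (d x), hR.mul hd, fun x hx => ⟨⟨?_, ?_⟩, fun z => ?_⟩⟩
  · have h1 : (R x * Matrix.diagonal (d x)).transpose * minkowskiSum m k *
        (R x * Matrix.diagonal (d x)) = Matrix.diagonal (d x) *
          ((R x).transpose * minkowskiSum m k * R x) * Matrix.diagonal (d x) := by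
      rw [Matrix.transpose_mul, Matrix.diagonal_transpose]
      simp only [Matrix.mul_assoc]
    rw [h1, hRη x hx, minkowskiSum_eq_diagonal, Matrix.diagonal_mul_diagonal,
      Matrix.diagonal_mul_diagonal]
    congr 1
    ext i
    by_cases hi : i = Sum.inl 0
    · subst hi
      simp only [d, Function.update_self]
      rw [mul_right_comm, hdet x hx, one_mul]
    · simp only [d, Function.update_of_ne hi, one_mul, mul_one]
  · rw [Matrix.det_mul, Matrix.det_diagonal, Finset.prod_update_of_mem (Finset.mem_univ _)]
    simp only [Finset.prod_const_one, mul_one]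
    exact hdet x hx
  · rw [← Matrix.mulVec_mulVec]
    congr 1
    ext i
    rw [Matrix.mulVec_diagonal]
    by_cases hi : i = Sum.inl 0
    · subst hi
      simp
    · simp only [d, Function.update_of_ne hi, one_mul]

/-- The normalized part of a timelike vector orthogonal to an orthonormal family of spacelike
vectors. -/
theorem exists_smooth_timelike {f : Q → Matrix (Fin (m + 1) ⊕ Fin k) (Fin k) ℝ}
    (hf : SmoothMatrixOn I f S)
    (hfη : ∀ x ∈ S, (f x).transpose * minkowskiSum m k * f x = 1) :
    ∃ u : Q → Matrix (Fin (m + 1) ⊕ Fin k) (Fin 1) ℝ, SmoothMatrixOn I u S ∧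
      ∀ x ∈ S, (u x).transpose * minkowskiSum m k * u x = -1 ∧
        (f x).transpose * minkowskiSum m k * u x = 0 := by
  -- A constant timelike unit vector. Projecting it off the columns of `f` gives `w` with ⟨w, w⟩ =
  -- -1 - |fᵀ η c|², so `w` is timelike everywhere.
  let c : Matrix (Fin (m + 1) ⊕ Fin k) (Fin 1) ℝ := Matrix.of fun i _ =>
    (Pi.single (Sum.inl 0) 1 : Fin (m + 1) ⊕ Fin k → ℝ) i
  have hc : c.transpose * minkowskiSum m k * c = -1 := by
    ext s t
    have h1 : ∀ s, c.transpose s = Pi.single (Sum.inl 0) 1 := fun s => rfl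
    rw [transpose_mul_mul_apply, h1, h1, pairing_single, minkowskiSum_eq_diagonal,
      Matrix.diagonal_apply_eq, Subsingleton.elim s t]
    simp
  let w : Q → Matrix (Fin (m + 1) ⊕ Fin k) (Fin 1) ℝ := fun x =>
    orthogonalPart (minkowskiSum m k) 1 (f x) c
  have hw := smoothMatrixOn_orthogonalPart (minkowskiSum m k) 1 hf c
  have horth : ∀ x ∈ S, (f x).transpose * minkowskiSum m k * w x = 0 := fun x hx =>
    orthogonalPart_orthogonal (one_mul 1) (hfη x hx) c
  obtain ⟨L, hL, hLS⟩ := exists_smooth_gramSchmidt (minkowskiSum_transpose m k) (ε := -1) (by simp)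
    hw (fun x hx y hy => by
      have h1 : (w x).transpose * minkowskiSum m k * w x =
          -1 - ((f x).transpose * minkowskiSum m k * c).transpose *
            ((f x).transpose * minkowskiSum m k * c) := by
        have hwx : w x = c - f x * ((f x).transpose * minkowskiSum m k * c) := by
          simp only [w, orthogonalPart, Matrix.one_mul]
        have h2 : (c.transpose * minkowskiSum m k * f x) =
            ((f x).transpose * minkowskiSum m k * c).transpose := by
          rw [Matrix.transpose_mul, Matrix.transpose_mul, Matrix.transpose_transpose,
            minkowskiSum_transpose, Matrix.mul_assoc]
        have h3 : (w x).transpose * minkowskiSum m k * w x = c.transpose * minkowskiSum m k * w x -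
            ((f x).transpose * minkowskiSum m k * c).transpose *
              ((f x).transpose * minkowskiSum m k * w x) := by
          conv_lhs => enter [1, 1]; rw [hwx]
          rw [Matrix.transpose_sub, Matrix.sub_mul, Matrix.sub_mul, Matrix.transpose_mul]
          simp only [Matrix.mul_assoc]
        rw [h3, horth x hx, Matrix.mul_zero, sub_zero, ← h2, ← hc, hwx, Matrix.mul_sub]
        simp only [Matrix.mul_assoc]
      change 0 < -1 * pairing _ ((w x).mulVec y) ((w x).mulVec y)
      rw [pairing_mulVec, h1, pairing, Matrix.sub_mulVec, dotProduct_sub, Matrix.neg_mulVec,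
        Matrix.one_mulVec, ← Matrix.mulVec_mulVec, Matrix.dotProduct_mulVec, ← Matrix.mulVec_transpose,
        Matrix.transpose_transpose, dotProduct_neg]
      have h4 := dotProduct_self_pos hy
      have h5 : 0 ≤ ((f x).transpose * minkowskiSum m k * c).mulVec y ⬝ᵥ
        ((f x).transpose * minkowskiSum m k * c).mulVec y :=
        Finset.sum_nonneg fun i _ => mul_self_nonneg _
      linarith)
  refine ⟨_, hL, fun x hx => ⟨?_, ?_⟩⟩
  · rw [hLS x hx, neg_one_smul]
  · rw [← Matrix.mul_assoc]
    exact (congrArg (· * L x) (horth x hx)).trans (Matrix.zero_mul _)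

/-- An orthonormal family of spacelike vectors extends locally to an oriented Lorentz frame. -/
theorem exists_smooth_lorentz_frame {f : Q → Matrix (Fin (m + 1) ⊕ Fin k) (Fin k) ℝ} (hS : IsOpen S)
    (hf : SmoothMatrixOn I f S)
    (hfη : ∀ x ∈ S, (f x).transpose * minkowskiSum m k * f x = 1) {x₀ : Q} (hx₀ : x₀ ∈ S) :
    ∃ V ⊆ S, IsOpen V ∧ x₀ ∈ V ∧
      ∃ R : Q → Matrix (Fin (m + 1) ⊕ Fin k) (Fin (m + 1) ⊕ Fin k) ℝ, SmoothMatrixOn I R V ∧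
        ∀ x ∈ V, R x ∈ SO (minkowskiSum m k) ∧
          ∀ z, (R x).mulVec (Sum.elim 0 z) = (f x).mulVec z := by
  obtain ⟨u, hu, huS⟩ := exists_smooth_timelike hf hfη
  let N : Q → Matrix (Fin (m + 1) ⊕ Fin k) (Fin k ⊕ Fin 1) ℝ := fun x =>
    Matrix.fromCols (f x) (u x)
  let D : Matrix (Fin k ⊕ Fin 1) (Fin k ⊕ Fin 1) ℝ := Matrix.fromBlocks 1 0 0 (-1)
  have hDD : D * D = 1 := by simp [D, Matrix.fromBlocks_multiply]
  have hη := minkowskiSum_transpose m k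
  have hN : SmoothMatrixOn I N S := by
    rintro i (s | s)
    · exact hf i s
    · exact hu i s
  have hND : ∀ x ∈ S, (N x).transpose * minkowskiSum m k * N x = D := by
    intro x hx
    have h1 : (u x).transpose * minkowskiSum m k * f x = 0 := by
      rw [← Matrix.transpose_inj, Matrix.transpose_mul, Matrix.transpose_mul,
        Matrix.transpose_transpose, hη, ← Matrix.mul_assoc, (huS x hx).2, Matrix.transpose_zero]
    simp only [N, Matrix.transpose_fromCols, Matrix.fromRows_mul, Matrix.mul_fromCols,
      hfη x hx, huS x hx, h1, D, Matrix.fromCols_fromRows_eq_fromBlocks]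
  -- `C` is constant and completes the columns only at `x₀`. Its projections stay independent where
  -- their Gram determinant is nonzero, hence only near `x₀`.
  obtain ⟨C, hC⟩ := exists_completion hDD (hND x₀ hx₀) (l := m) (by simp; ring)
  let w : Q → Matrix (Fin (m + 1) ⊕ Fin k) (Fin m) ℝ := fun x =>
    orthogonalPart (minkowskiSum m k) D (N x) C
  have hw : SmoothMatrixOn I w S := smoothMatrixOn_orthogonalPart (minkowskiSum m k) D hN C
  have horth : ∀ x ∈ S, (f x).transpose * minkowskiSum m k * w x = 0 ∧
      (u x).transpose * minkowskiSum m k * w x = 0 := by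
    intro x hx
    have h1 : (N x).transpose * minkowskiSum m k * w x = 0 :=
      orthogonalPart_orthogonal hDD (hND x hx) C
    simp only [N, Matrix.transpose_fromCols, Matrix.fromRows_mul] at h1
    exact ⟨Matrix.ext fun i j => congrFun (congrFun h1 (Sum.inl i)) j,
      Matrix.ext fun i j => congrFun (congrFun h1 (Sum.inr i)) j⟩
  have hpos : ∀ x ∈ S, ∀ y, (w x).mulVec y ≠ 0 →
      0 < pairing (minkowskiSum m k) ((w x).mulVec y) ((w x).mulVec y) := by
    intro x hx y hy
    -- The projected columns are orthogonal to the timelike vector `u`, so their span is positive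
    -- definite wherever nonzero.
    refine pairing_pos_of_orthogonal (u := (u x).mulVec 1) ?_ ?_ hy
    · rw [pairing_mulVec, (huS x hx).1]
      simp [pairing, Matrix.neg_mulVec]
    · rw [pairing, Matrix.mulVec_mulVec, ← Matrix.vecMul_transpose, ← Matrix.dotProduct_mulVec,
        Matrix.mulVec_mulVec, ← Matrix.mul_assoc, (horth x hx).2, Matrix.zero_mulVec,
        dotProduct_zero]
  have hK : SmoothMatrixOn I (fun x => (w x).transpose * minkowskiSum m k * w x) S :=
    (hw.transpose.mul (smoothMatrixOn_const _)).mul hw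
  let V : Set Q := S ∩ {x | ((w x).transpose * minkowskiSum m k * w x).det ≠ 0}
  have hV : IsOpen V := hK.det.continuousOn.isOpen_inter_preimage hS isOpen_ne
  have hVS : V ⊆ S := Set.inter_subset_left
  have hx₀V : x₀ ∈ V := by
    refine ⟨hx₀, fun h0 => ?_⟩
    obtain ⟨y, hy, hy0⟩ := Matrix.exists_mulVec_eq_zero_iff.2 h0
    have h1 : pairing (minkowskiSum m k) ((w x₀).mulVec y) ((w x₀).mulVec y) = 0 := by
      rw [pairing_mulVec, pairing, hy0, dotProduct_zero]
    have h2 : (w x₀).mulVec y = 0 := by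
      by_contra h
      exact (hpos x₀ hx₀ y h).ne' h1
    -- A combination with zero projection lies in the span of the columns of `N x₀`, which `C` meets
    -- only in zero.
    refine hy (hC y ((D * (N x₀).transpose * minkowskiSum m k * C).mulVec y) ?_)
    rw [Matrix.mulVec_mulVec]
    exact sub_eq_zero.1 ((Matrix.sub_mulVec _ _ _).symm.trans h2)
  obtain ⟨L, hL, hLV⟩ := exists_smooth_gramSchmidt hη (ε := 1) (by simp)
    (fun i j => (hw i j).mono hVS) (fun x hx y hy => by
      rw [one_mul]
      refine hpos x hx.1 y fun h0 => hx.2 (Matrix.exists_mulVec_eq_zero_iff.1 ⟨y, hy, ?_⟩)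
      rw [← Matrix.mulVec_mulVec, h0, Matrix.mulVec_zero])
  let R : Q → Matrix (Fin (m + 1) ⊕ Fin k) (Fin (m + 1) ⊕ Fin k) ℝ := fun x =>
    Matrix.of fun i => Sum.elim (Fin.cons (u x i 0) ((w x * L x) i)) (f x i)
  have hR : SmoothMatrixOn I R V := by
    rintro i (s | s)
    · refine Fin.cases ?_ (fun j => ?_) s
      · exact (hu i 0).mono hVS
      · exact hL i j
    · exact (hf i s).mono hVS
  have hRη : ∀ x ∈ V, (R x).transpose * minkowskiSum m k * R x = minkowskiSum m k := by
    intro x hx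
    have huu : pairing (minkowskiSum m k) ((u x).transpose 0) ((u x).transpose 0) = -1 := by
      rw [← transpose_mul_mul_apply, (huS x hx.1).1]; simp
    have hff : ∀ s t, pairing (minkowskiSum m k) ((f x).transpose s) ((f x).transpose t) =
        (1 : Matrix (Fin k) (Fin k) ℝ) s t := fun s t => by
      rw [← transpose_mul_mul_apply, hfη x hx.1]
    have hfu : ∀ s, pairing (minkowskiSum m k) ((f x).transpose s) ((u x).transpose 0) = 0 :=
      fun s => by rw [← transpose_mul_mul_apply, (huS x hx.1).2]; rfl
    have hww : ∀ i j, pairing (minkowskiSum m k) ((w x * L x).transpose i)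
        ((w x * L x).transpose j) = (1 : Matrix (Fin m) (Fin m) ℝ) i j := fun i j => by
      rw [← transpose_mul_mul_apply, hLV x hx, one_smul]
    have hfw : ∀ s j, pairing (minkowskiSum m k) ((f x).transpose s)
        ((w x * L x).transpose j) = 0 := fun s j => by
      rw [← transpose_mul_mul_apply, ← Matrix.mul_assoc, (horth x hx.1).1, Matrix.zero_mul]; rfl
    have huw : ∀ j, pairing (minkowskiSum m k) ((u x).transpose 0)
        ((w x * L x).transpose j) = 0 := fun j => by
      rw [← transpose_mul_mul_apply, ← Matrix.mul_assoc, (horth x hx.1).2, Matrix.zero_mul]; rfl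
    have h0 : (R x).transpose (Sum.inl 0) = (u x).transpose 0 := rfl
    have h1 : ∀ j : Fin m, (R x).transpose (Sum.inl j.succ) = (w x * L x).transpose j :=
      fun j => rfl
    have h2 : ∀ s : Fin k, (R x).transpose (Sum.inr s) = (f x).transpose s := fun s => rfl
    ext c d
    rw [transpose_mul_mul_apply]
    conv_rhs => rw [minkowskiSum_eq_diagonal]
    rcases c with c | s <;> rcases d with d | t
    · refine Fin.cases ?_ (fun i => ?_) c <;> refine Fin.cases ?_ (fun j => ?_) d
      · rw [h0, huu]; simp
      · rw [h0, h1, huw]; simp [(Fin.succ_ne_zero j).symm]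
      · rw [h0, h1, pairing_comm hη, huw]; simp [Fin.succ_ne_zero]
      · rw [h1, h1, hww]; simp [Matrix.diagonal_apply, Matrix.one_apply]
    · refine Fin.cases ?_ (fun i => ?_) c
      · rw [h0, h2, pairing_comm hη, hfu]; simp
      · rw [h1, h2, pairing_comm hη, hfw]; simp
    · refine Fin.cases ?_ (fun j => ?_) d
      · rw [h0, h2, hfu]; simp
      · rw [h1, h2, hfw]; simp
    · rw [h2, h2, hff]; simp [Matrix.diagonal_apply, Matrix.one_apply]
  obtain ⟨R', hR', hR'V⟩ := exists_mem_SO_minkowskiSum hR hRη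
  refine ⟨V, hVS, hV, hx₀V, R', hR', fun x hx => ⟨(hR'V x hx).1, fun z => ?_⟩⟩
  rw [(hR'V x hx).2]
  ext i
  simp [Matrix.mulVec, dotProduct, R]

end LorentzFrame

/-! ### Pairings as smooth functions and as linear forms. -/

theorem contMDiffOn_pairing {E H Q ν : Type*} [NormedAddCommGroup E] [NormedSpace ℝ E]
    [TopologicalSpace H] [TopologicalSpace Q] [ChartedSpace H Q] {I : ModelWithCorners ℝ E H}
    {S : Set Q} [Fintype ν] (η : Matrix ν ν ℝ) {f g : Q → ν → ℝ}
    (hf : ∀ i, ContMDiffOn I 𝓘(ℝ, ℝ) ∞ (fun x => f x i) S)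
    (hg : ∀ i, ContMDiffOn I 𝓘(ℝ, ℝ) ∞ (fun x => g x i) S) :
    ContMDiffOn I 𝓘(ℝ, ℝ) ∞ (fun x => pairing η (f x) (g x)) S := by
  simp only [pairing_eq_sum]
  exact contMDiffOn_sum fun i _ => contMDiffOn_sum fun j _ =>
    ((hf i).mul contMDiffOn_const).mul (hg j)

/-- The linear form `v ↦ η(v, w)`. -/
def pairingL {ν : Type*} [Fintype ν] (η : Matrix ν ν ℝ) (w : ν → ℝ) : (ν → ℝ) →L[ℝ] ℝ :=
  ∑ r, (η.mulVec w) r • ContinuousLinearMap.proj r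

theorem pairingL_apply {ν : Type*} [Fintype ν] (η : Matrix ν ν ℝ) (v w : ν → ℝ) :
    pairingL η w v = pairing η v w := by
  simp only [pairingL, FunLike.coe_sum, Finset.sum_apply, smul_apply,
    ContinuousLinearMap.proj_apply, smul_eq_mul, pairing, dotProduct]
  exact Finset.sum_congr rfl fun _ _ => mul_comm _ _

theorem eq_of_forall_dotProduct {k : ℕ} {b : Module.Basis (Fin k) ℝ (LieAlg k)}
    {φ : LieAlg k →L[ℝ] (Fin k → ℝ)} (h : (componentMatrix b φ).det ≠ 0) {y z : Fin k → ℝ}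
    (hyz : ∀ c, y ⬝ᵥ φ c = z ⬝ᵥ φ c) : y = z := by
  have h1 := hyz (matrixCLM (Pi.basisFun ℝ (Fin k)) b (componentMatrix b φ)⁻¹ (y - z))
  rw [matrixCLM_inv_apply h, ← sub_eq_zero, ← sub_dotProduct] at h1
  exact sub_eq_zero.1 (dotProduct_self_eq_zero.1 h1)

/-! ### Scalar field and connection from the invariant metric. -/

section Bundle

variable {k m : ℕ} {G P X ι A : Type*}
  [TopologicalSpace G] [ChartedSpace (EuclideanSpace ℝ (Fin k)) G] [CommGroup G]
  [LieGroup (𝓡 k) ∞ G]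
  [TopologicalSpace P] [ChartedSpace (EuclideanSpace ℝ (Fin (m + 1 + k))) P]
  [IsManifold (𝓡 (m + 1 + k)) ∞ P] [MulAction G P]
  [TopologicalSpace X] [ChartedSpace (EuclideanSpace ℝ (Fin (m + 1))) X]
  [IsManifold (𝓡 (m + 1)) ∞ X] {ν : Type*} [Fintype ν]

variable (G) in
/-- The values of a one-form on the fundamental vector fields of a basis. -/
def fundamentalMatrix (b : Module.Basis (Fin k) ℝ (LieAlg k))
    (α : OneForm (m + 1 + k) P (ν → ℝ)) (p : P) : Matrix ν (Fin k) ℝ :=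
  Matrix.of fun r t => α p (fundamental G P (b t) p) r

theorem fundamentalMatrix_mulVec (b : Module.Basis (Fin k) ℝ (LieAlg k))
    (α : OneForm (m + 1 + k) P (ν → ℝ)) (p : P) (c : LieAlg k) :
    α p (fundamental G P c p) = (fundamentalMatrix G b α p).mulVec (b.repr c) := by
  conv_lhs => rw [← b.sum_repr c, ← fundamentalL_apply]
  ext r
  simp only [map_sum, map_smul, Finset.sum_apply, Pi.smul_apply, smul_eq_mul, fundamentalL_apply,
    Matrix.mulVec, dotProduct, fundamentalMatrix, Matrix.of_apply]
  exact Finset.sum_congr rfl fun _ _ => mul_comm _ _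

theorem smoothMatrixOn_fundamentalMatrix (B : PrincipalBundle k m G P X ι)
    (b : Module.Basis (Fin k) ℝ (LieAlg k)) {α : OneForm (m + 1 + k) P (ν → ℝ)} {U : Set P}
    (hα : SmoothFormOn α U) {i : ι} {S : Set X} (hS : S ⊆ B.U i)
    (hSU : ∀ x ∈ S, B.sec i x ∈ U) :
    SmoothMatrixOn (𝓡 (m + 1)) (fun x => fundamentalMatrix G b α (B.sec i x)) S := fun r t =>
  contMDiffOn_pi_space.1 (hα.apply (f := B.sec i)
    (Y := fun y => fundamental G P (b t) (B.sec i y)) (S := S)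
    ((contMDiff_fundamental B.contMDiff_smul (b t)).comp_contMDiffOn
      ((B.contMDiffOn_sec i).mono hS)) hSU) r

theorem PrincipalBundle.isOpen_sec_preimage (B : PrincipalBundle k m G P X ι) (i : ι) {U : Set P}
    (hU : IsOpen U) : IsOpen (B.U i ∩ B.sec i ⁻¹' U) :=
  (B.contMDiffOn_sec i).continuousOn.isOpen_inter_preimage (B.isOpen_U i) hU

/-- Decomposition of tangent vectors along a local section. -/
theorem PrincipalBundle.exists_form_eq_add {F : Type*} [NormedAddCommGroup F] [NormedSpace ℝ F]
    (B : PrincipalBundle k m G P X ι) (α : OneForm (m + 1 + k) P F) {i : ι} {x : X}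
    (hx : x ∈ B.U i) (v : EuclideanSpace ℝ (Fin (m + 1 + k))) :
    ∃ c : LieAlg k, α (B.sec i x) v = α (B.sec i x) (mfderiv (𝓡 (m + 1)) (𝓡 (m + 1 + k)) (B.sec i) x
      (mfderiv (𝓡 (m + 1 + k)) (𝓡 (m + 1)) B.proj (B.sec i x) v)) +
        α (B.sec i x) (fundamental G P c (B.sec i x)) := by
  let v' : EuclideanSpace ℝ (Fin (m + 1 + k)) :=
    mfderiv (𝓡 (m + 1)) (𝓡 (m + 1 + k)) (B.sec i) x
      (mfderiv (𝓡 (m + 1 + k)) (𝓡 (m + 1)) B.proj (B.sec i x) v)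
  have h1 := B.eq_fundamental_of_mfderiv_proj_eq_zero (i := i) (p := B.sec i x) (v := v - v')
    (by rwa [B.proj_sec i x hx]) (by
      refine (map_sub (mfderiv (𝓡 (m + 1 + k)) (𝓡 (m + 1)) B.proj (B.sec i x)) v v').trans ?_
      exact sub_eq_zero.2 (B.mfderiv_proj_sec hx _).symm)
  refine ⟨_, Eq.trans ?_ (congrArg (α (B.sec i x) v' + ·) (congrArg (α (B.sec i x)) h1))⟩
  refine Eq.trans ?_ (map_add (α (B.sec i x)) v' (v - v'))
  exact congrArg (α (B.sec i x)) (add_sub_cancel v' v).symm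

variable {B : PrincipalBundle k m G P X ι} (b : Module.Basis (Fin k) ℝ (LieAlg k)) {W : A → Set P}
  {e : A → OneForm (m + 1 + k) P (Fin (m + 1) ⊕ Fin k → ℝ)}

/-- The metric of an invariant coframe on the fibres descends to a scalar field. -/
theorem exists_scalar_of_kosmannInvariant [ConnectedSpace G] (B : PrincipalBundle k m G P X ι)
    (he : IsCoframe (minkowskiSum m k) W e)
    (hK : KosmannInvariant G W e) (hS : SpacelikeFibers G W e) :
    ∃ Φ : X → LieAlg k →L[ℝ] (Fin k → ℝ),
      ContMDiff (𝓡 (m + 1)) 𝓘(ℝ, LieAlg k →L[ℝ] (Fin k → ℝ)) ∞ Φ ∧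
      (∀ x, 0 < (componentMatrix b (Φ x)).det) ∧
      ∀ (a : A), ∀ p ∈ W a, ∀ c c', pairing (minkowskiSum m k) (e a p (fundamental G P c p))
        (e a p (fundamental G P c' p)) = Φ (B.proj p) c ⬝ᵥ Φ (B.proj p) c' := by
  choose i hi using B.cover_U
  choose a ha using he.cover
  let gram : A → P → Matrix (Fin k) (Fin k) ℝ := fun c p =>
    (fundamentalMatrix G b (e c) p).transpose * minkowskiSum m k * fundamentalMatrix G b (e c) p
  let h : X → Matrix (Fin k) (Fin k) ℝ := fun x =>
    gram (a (B.sec (i x) x)) (B.sec (i x) x)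
  have hgram : ∀ c p y z, pairing (gram c p) (b.repr y) (b.repr z) =
      pairing (minkowskiSum m k) (e c p (fundamental G P y p)) (e c p (fundamental G P z p)) :=
    fun c p y z => by
      rw [fundamentalMatrix_mulVec b, fundamentalMatrix_mulVec b, pairing_mulVec]
  have hgh : ∀ c p, p ∈ W c → gram c p = h (B.proj p) := by
    intro c p hp
    ext s t
    have h1 := pairing_translate B.contMDiff_smul (minkowskiSum_transpose m k)
      (isUnit_det_minkowskiSum m k) he hK (c := c) (g := B.triv (i (B.proj p)) p) (ha _)
      (by rwa [B.triv_smul_sec _ p (hi _)])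
      (fundamental G P (b s) (B.sec (i (B.proj p)) (B.proj p)))
      (fundamental G P (b t) (B.sec (i (B.proj p)) (B.proj p)))
    rw [translate_fundamental B.contMDiff_smul, translate_fundamental B.contMDiff_smul,
      B.triv_smul_sec _ p (hi _)] at h1
    have h2 : ∀ c p, gram c p s t = pairing (minkowskiSum m k) (e c p (fundamental G P (b s) p))
        (e c p (fundamental G P (b t) p)) := fun c p => transpose_mul_mul_apply _ _ _ s t
    exact (h2 c p).trans (h1.trans (h2 _ _).symm)
  have hhs : SmoothMatrixOn (𝓡 (m + 1)) h Set.univ := by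
    intro s t
    rw [contMDiffOn_univ]
    intro x
    have hO := B.isOpen_sec_preimage (i x) (he.isOpen (a (B.sec (i x) x)))
    have hE := smoothMatrixOn_fundamentalMatrix B b (he.smooth (a (B.sec (i x) x))) (i := i x)
      (S := B.U (i x) ∩ B.sec (i x) ⁻¹' W (a (B.sec (i x) x)))
      Set.inter_subset_left (fun y hy => hy.2)
    refine ((((hE.transpose.mul (smoothMatrixOn_const (minkowskiSum m k))).mul hE) s t).congr
      fun y hy => ?_).contMDiffAt (hO.mem_nhds ⟨hi x, ha _⟩)
    have h1 := hgh _ _ hy.2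
    rw [B.proj_sec _ y hy.1] at h1
    exact (congrFun (congrFun h1 s) t).symm
  -- The Gram matrix is factorized on all of `X` at once, so the vertical part of the new coframe
  -- will be globally defined.
  obtain ⟨L, hL, hLh⟩ := exists_smooth_cholesky h hhs
    (fun x _ s t => by
      have h1 : (h x).transpose = h x := by
        simp only [h, gram, Matrix.transpose_mul, Matrix.transpose_transpose,
          minkowskiSum_transpose, Matrix.mul_assoc]
      exact congrFun (congrFun h1.symm s) t)
    (fun x _ y hy => by
      obtain ⟨c, rfl⟩ : ∃ c, y = b.repr c := ⟨b.equivFun.symm y,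
        (b.equivFun.apply_symm_apply y).symm⟩
      have hc : c ≠ 0 := by
        rintro rfl
        exact hy (by simp)
      exact (hS c hc _ _ (ha _)).trans_eq (hgram _ _ c c).symm)
  refine ⟨fun x => matrixCLM b (fun s => Pi.single s (1 : ℝ)) (L x),
    contMDiffOn_univ.1 (contMDiffOn_matrixCLM b _ hL), fun x => ?_, fun c p hp y z => ?_⟩
  · rw [componentMatrix_matrixCLM]
    exact det_pos_of_lowerTriangular (hLh x trivial).1 (hLh x trivial).2.1
  · rw [matrixCLM_single, matrixCLM_single, ← hgram, hgh c p hp, ← (hLh _ trivial).2.2]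
    have h1 := pairing_mulVec 1 (L (B.proj p)) (L (B.proj p)) (b.repr y) (b.repr z)
    rw [Matrix.mul_one, pairing, Matrix.one_mulVec] at h1
    exact h1.symm

/-- The metric of an invariant coframe defines a connection. -/
theorem exists_connection_of_kosmannInvariant [ConnectedSpace G]
    (he : IsCoframe (minkowskiSum m k) W e) (hK : KosmannInvariant G W e)
    {Φ : X → LieAlg k →L[ℝ] (Fin k → ℝ)}
    (hΦ : ContMDiff (𝓡 (m + 1)) 𝓘(ℝ, LieAlg k →L[ℝ] (Fin k → ℝ)) ∞ Φ)
    (hdet : ∀ x, 0 < (componentMatrix b (Φ x)).det)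
    (hΦe : ∀ (a : A), ∀ p ∈ W a, ∀ c c', pairing (minkowskiSum m k) (e a p (fundamental G P c p))
        (e a p (fundamental G P c' p)) = Φ (B.proj p) c ⬝ᵥ Φ (B.proj p) c') :
    ∃ θ : OneForm (m + 1 + k) P (LieAlg k), IsConnection G θ ∧
      ∀ (a : A), ∀ p ∈ W a, ∀ v c, pairing (minkowskiSum m k) (e a p v)
        (e a p (fundamental G P c p)) = Φ (B.proj p) (θ p v) ⬝ᵥ Φ (B.proj p) c := by
  choose a ha using he.cover
  have hinj := fun x => injective_of_det_componentMatrix (hdet x).ne'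
  let M : X → Matrix (Fin k) (Fin k) ℝ := fun x => componentMatrix b (Φ x)
  have hM : SmoothMatrixOn (𝓡 (m + 1)) M Set.univ := fun s t =>
    contMDiffOn_pi_space.1 (hΦ.contMDiffOn.clm_apply contMDiffOn_const) s
  have hMi := hM.inv fun x _ => (hdet x).ne'
  -- With `M` the matrix of `Φ` and `Y v` the pairings of `v` with the basis fields, `θ = M⁻¹ M⁻ᵀ Y`
  -- is the solution of `Y v · c = Φ (θ v) · Φ c`, with `c` written in the basis `b`.
  let Ψ : X → (Fin k → ℝ) →L[ℝ] LieAlg k := fun x =>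
    (matrixCLM (Pi.basisFun ℝ (Fin k)) b (M x)⁻¹).comp (mulVecL (M x)⁻¹.transpose)
  have hΨ : ContMDiff (𝓡 (m + 1)) 𝓘(ℝ, (Fin k → ℝ) →L[ℝ] LieAlg k) ∞ Ψ :=
    contMDiffOn_univ.1 ((contMDiffOn_matrixCLM _ _ hMi).clm_comp
      (contMDiffOn_mulVecL hMi.transpose))
  let Y : A → OneForm (m + 1 + k) P (Fin k → ℝ) := fun c p => ContinuousLinearMap.pi fun t =>
    (pairingL (minkowskiSum m k) (e c p (fundamental G P (b t) p))).comp (e c p)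
  have hY : ∀ c p v t, Y c p v t =
      pairing (minkowskiSum m k) (e c p v) (e c p (fundamental G P (b t) p)) :=
    fun c p v t => pairingL_apply _ _ _
  let θ : OneForm (m + 1 + k) P (LieAlg k) := fun p => (Ψ (B.proj p)).comp (Y (a p) p)
  have hθ : ∀ c p, p ∈ W c → ∀ v, θ p v = Ψ (B.proj p) (Y c p v) := fun c p hp v =>
    congrArg (Ψ (B.proj p)) (funext fun t =>
      (hY _ p v t).trans ((pairing_transition he (ha p) hp _ _).trans (hY c p v t).symm))
  have hθe : ∀ c, ∀ p ∈ W c, ∀ v y, pairing (minkowskiSum m k) (e c p v)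
      (e c p (fundamental G P y p)) = Φ (B.proj p) (θ p v) ⬝ᵥ Φ (B.proj p) y := by
    intro c p hp v y
    have h1 : Φ (B.proj p) (θ p v) = (M (B.proj p))⁻¹.transpose.mulVec (Y c p v) :=
      (congrArg (Φ (B.proj p)) (hθ c p hp v)).trans (matrixCLM_inv_apply (hdet _).ne' _)
    rw [h1, componentMatrix_mulVec b (Φ (B.proj p)) y, Matrix.mulVec_transpose,
      ← Matrix.dotProduct_mulVec, Matrix.mulVec_mulVec,
      Matrix.nonsing_inv_mul _ (isUnit_iff_ne_zero.2 (hdet (B.proj p)).ne'), Matrix.one_mulVec]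
    have h2 : Y c p v = Matrix.vecMul (e c p v)
        (minkowskiSum m k * fundamentalMatrix G b (e c) p) := funext fun t => hY c p v t
    rw [h2, ← Matrix.dotProduct_mulVec, ← Matrix.mulVec_mulVec, ← fundamentalMatrix_mulVec]
    rfl
  -- Pairings with fundamental vectors determine `θ p v`, so invariance and normalization of `θ` can
  -- be checked on pairings.
  have huniq : ∀ p v z, (∀ y, pairing (minkowskiSum m k) (e (a p) p v)
      (e (a p) p (fundamental G P y p)) = Φ (B.proj p) z ⬝ᵥ Φ (B.proj p) y) → θ p v = z :=
    fun p v z h => hinj (B.proj p) (eq_of_forall_dotProduct (hdet (B.proj p)).ne' fun y =>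
      (hθe (a p) p (ha p) v y).symm.trans (h y))
  refine ⟨θ, ⟨?_, fun g p v => ?_, fun c p => ?_⟩, hθe⟩
  · refine smoothFormOn_of_locally fun p _ => ⟨W (a p), he.isOpen _, ha p, ?_⟩
    refine SmoothFormOn.congr (SmoothFormOn.clm_apply (α := Y (a p)) ?_
      (Φ := fun q => Ψ (B.proj q)) (hΨ.comp B.contMDiff_proj).contMDiffOn)
      fun q hq v => hθ _ q hq v
    refine SmoothFormOn.pi fun t => ?_
    refine (contMDiffOn_pairing (minkowskiSum m k)
      (fun r => contMDiffOn_pi_space.1 (he.smooth (a p)) r) fun r => ?_).congr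
        fun v _ => hY (a p) v.1 v.2 t
    have h1 := (he.smooth (a p)).apply (f := id) (Y := fun q => fundamental G P (b t) q)
      (S := W (a p)) (contMDiff_fundamental B.contMDiff_smul (b t)).contMDiffOn (fun _ hq => hq)
    exact (contMDiffOn_pi_space.1 h1 r).comp (Bundle.contMDiff_proj _).contMDiffOn
      (fun _ hv => hv)
  · refine huniq _ _ _ fun y => ?_
    have h1 := pairing_translate B.contMDiff_smul (minkowskiSum_transpose m k)
      (isUnit_det_minkowskiSum m k) he hK (g := g) (ha p) (ha (g • p)) v (fundamental G P y p)
    rw [translate_fundamental B.contMDiff_smul, hθe _ _ (ha p)] at h1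
    rw [B.proj_smul]
    exact h1
  · exact huniq _ _ _ fun y => hΦe _ p (ha p) c y

end Bundle

/-! ### Gauge fixing of Kosmann-invariant coframes. -/

section Bundle

variable {k m : ℕ} {G P X ι A : Type*}
  [TopologicalSpace G] [ChartedSpace (EuclideanSpace ℝ (Fin k)) G] [CommGroup G]
  [LieGroup (𝓡 k) ∞ G]
  [TopologicalSpace P] [ChartedSpace (EuclideanSpace ℝ (Fin (m + 1 + k))) P]
  [IsManifold (𝓡 (m + 1 + k)) ∞ P] [MulAction G P]
  [TopologicalSpace X] [ChartedSpace (EuclideanSpace ℝ (Fin (m + 1))) X]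
  [IsManifold (𝓡 (m + 1)) ∞ X]
  {B : PrincipalBundle k m G P X ι} (b : Module.Basis (Fin k) ℝ (LieAlg k)) {W : A → Set P}
  {e : A → OneForm (m + 1 + k) P (Fin (m + 1) ⊕ Fin k → ℝ)}

/-- Local Lorentz frames along a section, the last vectors of which are vertical. -/
theorem exists_adapted_frame (B : PrincipalBundle k m G P X ι)
    (he : IsCoframe (minkowskiSum m k) W e) {Φ : X → LieAlg k →L[ℝ] (Fin k → ℝ)}
    (hΦ : ContMDiff (𝓡 (m + 1)) 𝓘(ℝ, LieAlg k →L[ℝ] (Fin k → ℝ)) ∞ Φ)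
    (hdet : ∀ x, 0 < (componentMatrix b (Φ x)).det)
    (hΦe : ∀ (a : A), ∀ p ∈ W a, ∀ c c', pairing (minkowskiSum m k) (e a p (fundamental G P c p))
        (e a p (fundamental G P c' p)) = Φ (B.proj p) c ⬝ᵥ Φ (B.proj p) c') (x₀ : X) :
    ∃ (V : Set X) (i : ι) (a : A), IsOpen V ∧ x₀ ∈ V ∧ V ⊆ B.U i ∧ (∀ x ∈ V, B.sec i x ∈ W a) ∧
      ∃ R : X → Matrix (Fin (m + 1) ⊕ Fin k) (Fin (m + 1) ⊕ Fin k) ℝ,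
        SmoothMatrixOn (𝓡 (m + 1)) R V ∧ ∀ x ∈ V, R x ∈ SO (minkowskiSum m k) ∧
          ∀ c, e a (B.sec i x) (fundamental G P c (B.sec i x)) =
            (R x).mulVec (Sum.elim 0 (Φ x c)) := by
  obtain ⟨i, hi⟩ := B.cover_U x₀
  obtain ⟨a, ha⟩ := he.cover (B.sec i x₀)
  have hO := B.isOpen_sec_preimage i (he.isOpen a)
  have hE := smoothMatrixOn_fundamentalMatrix B b (he.smooth a) (i := i)
    (S := B.U i ∩ B.sec i ⁻¹' W a) Set.inter_subset_left (fun y hy => hy.2)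
  have hM : SmoothMatrixOn (𝓡 (m + 1)) (fun x => componentMatrix b (Φ x))
      (B.U i ∩ B.sec i ⁻¹' W a) := fun s t =>
    contMDiffOn_pi_space.1 (hΦ.contMDiffOn.clm_apply contMDiffOn_const) s
  have hunit : ∀ x, IsUnit (componentMatrix b (Φ x)).det := fun x =>
    isUnit_iff_ne_zero.2 (hdet x).ne'
  -- With `E` the values of `e` on the basis fields and `M` the matrix of `Φ`, the columns of `E
  -- M⁻¹` are orthonormal because `Eᵀ η E = Mᵀ M`.
  have hf := hE.mul (hM.inv fun x _ => (hdet x).ne')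
  obtain ⟨V, hVO, hV, hx, R, hR, hRV⟩ := exists_smooth_lorentz_frame hO hf (fun x hx => by
      have h1 : (fundamentalMatrix G b (e a) (B.sec i x)).transpose * minkowskiSum m k *
          fundamentalMatrix G b (e a) (B.sec i x) =
          (componentMatrix b (Φ x)).transpose * componentMatrix b (Φ x) := by
        ext s t
        refine (transpose_mul_mul_apply _ _ _ s t).trans ((hΦe a _ hx.2 (b s) (b t)).trans ?_)
        rw [B.proj_sec i x hx.1]
        rfl
      have hinv := Matrix.mul_nonsing_inv _ (hunit x)
      have h2 : ∀ C D : Matrix (Fin k) (Fin k) ℝ, C * D = 1 → D.transpose * (C.transpose * C) * D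
          = 1 := fun C D h => by
        rw [← Matrix.mul_assoc, Matrix.mul_assoc, h, ← Matrix.transpose_mul, h,
          Matrix.transpose_one, Matrix.mul_one]
      refine Eq.trans ?_ (h2 _ _ hinv)
      rw [← h1, Matrix.transpose_mul]
      simp only [Matrix.mul_assoc]) ⟨hi, ha⟩
  refine ⟨V, i, a, hV, hx, fun x hx => (hVO hx).1, fun x hx => (hVO hx).2, R, hR,
    fun x hx => ⟨(hRV x hx).1, fun c => ?_⟩⟩
  rw [(hRV x hx).2, fundamentalMatrix_mulVec b, componentMatrix_mulVec b (Φ x) c,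
    Matrix.mulVec_mulVec, Matrix.mul_assoc, Matrix.nonsing_inv_mul _ (hunit x), Matrix.mul_one]

/-- Kosmann-invariant coframes with spacelike fibres are gauge equivalent to partially gauge-fixed
coframes. -/
theorem exists_isPartiallyGaugeFixed [ConnectedSpace G] (B : PrincipalBundle k m G P X ι)
    (he : IsCoframe (minkowskiSum m k) W e) (hK : KosmannInvariant G W e)
    (hS : SpacelikeFibers G W e) :
    ∃ (V : X → Set X) (e' : X → OneForm (m + 1 + k) P (Fin (m + 1) ⊕ Fin k → ℝ)),
      IsPartiallyGaugeFixed B b V e' ∧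
      GaugeEquivalent (minkowskiSum m k) W e (fun x => B.proj ⁻¹' V x) e' := by
  obtain ⟨Φ, hΦ, hdet, hΦe⟩ := exists_scalar_of_kosmannInvariant b B he hK hS
  obtain ⟨θ, hθ, hθe⟩ := exists_connection_of_kosmannInvariant b he hK hΦ hdet hΦe
  choose V i a hV hxV hVU hVW R hR hRV using exists_adapted_frame b B he hΦ hdet hΦe
  let π₁ : (Fin (m + 1) ⊕ Fin k → ℝ) →L[ℝ] (Fin (m + 1) → ℝ) :=
    ContinuousLinearMap.pi fun s => ContinuousLinearMap.proj (Sum.inl s)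
  -- The first components of `R⁻¹ e` along the section. They vanish on fundamental vectors, since
  -- `R` carries the vertical vector `Φ c` to `e c^#`.
  let eh : X → OneForm (m + 1) X (Fin (m + 1) → ℝ) := fun z x =>
    (π₁.comp (mulVecL (R z x)⁻¹)).comp ((e (a z) (B.sec (i z) x)).comp
      (mfderiv (𝓡 (m + 1)) (𝓡 (m + 1 + k)) (B.sec (i z)) x))
  have heh : ∀ z, SmoothFormOn (eh z) (V z) := by
    intro z
    have h1 := (he.smooth (a z)).pullback (hV z) ((B.contMDiffOn_sec (i z)).mono (hVU z)) (hVW z)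
    refine h1.clm_apply (Φ := fun x => π₁.comp (mulVecL (R z x)⁻¹)) ?_
    refine contMDiffOn_const.clm_comp (contMDiffOn_mulVecL ((hR z).inv fun x hx => ?_))
    rw [((hRV z x hx).1).2]
    exact one_ne_zero
  have hKK := isKKCoframe_kkCoframe B V θ eh Φ
  have hmem : ∀ {z x}, x ∈ V z → B.proj (B.sec (i z) x) ∈ V z := fun {z x} hx => by
    rwa [B.proj_sec _ x (hVU z hx)]
  -- Along the section the new coframe is `R⁻¹ e`: the first components agree because the
  -- fundamental part of `v` does not contribute, the last ones because they have the same products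
  -- with all `Φ c`.
  have hsec : ∀ z, ∀ x ∈ V z, ∀ v, kkCoframe B θ eh Φ z (B.sec (i z) x) v =
      (R z x)⁻¹.mulVec (e (a z) (B.sec (i z) x) v) := by
    intro z x hx v
    have hπ := B.proj_sec _ x (hVU z hx)
    have hRSO := (hRV z x hx).1
    have hinv : ∀ y, (R z x)⁻¹.mulVec ((R z x).mulVec y) = y := fun y => by
      rw [Matrix.mulVec_mulVec, SO.inv_mul hRSO, Matrix.one_mulVec]
    have hinv' : ∀ y, (R z x).mulVec ((R z x)⁻¹.mulVec y) = y := fun y => by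
      rw [Matrix.mulVec_mulVec, Matrix.mul_nonsing_inv _ (by rw [hRSO.2]; exact isUnit_one),
        Matrix.one_mulVec]
    rw [hKK z _ (hmem hx)]
    funext s
    rcases s with s | s
    · obtain ⟨c, hc⟩ := B.exists_form_eq_add (e (a z)) (hVU z hx) v
      rw [hc, Matrix.mulVec_add, (hRV z x hx).2, hinv, Pi.add_apply, Sum.elim_inl, Sum.elim_inl,
        Pi.zero_apply, add_zero]
      exact congrFun (OneForm.congr_point (eh z) hπ _) s
    · refine congrFun (?_ : Φ (B.proj (B.sec (i z) x)) (θ (B.sec (i z) x) v) =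
        (R z x)⁻¹.mulVec (e (a z) (B.sec (i z) x) v) ∘ Sum.inr) s
      refine eq_of_forall_dotProduct (hdet (B.proj (B.sec (i z) x))).ne' fun c => ?_
      rw [← hθe (a z) _ (hVW z x hx), (hRV z x hx).2, ← hinv' (e (a z) (B.sec (i z) x) v),
        SO.pairing_eq hRSO, pairing_minkowskiSum, Sum.elim_comp_inl, Sum.elim_comp_inr, hπ, hinv']
      simp [pairing]
  have hiso : ∀ z, ∀ x ∈ V z, (kkCoframe B θ eh Φ z (B.sec (i z) x)).IsInvertible := by
    intro z x hx
    refine isInvertible_of_injective (by simp) fun v v' hv => (he.iso _ _ (hVW z x hx)).injective ?_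
    rw [hsec z x hx, hsec z x hx] at hv
    have h1 := congrArg (R z x).mulVec hv
    rwa [Matrix.mulVec_mulVec, Matrix.mulVec_mulVec,
      Matrix.mul_nonsing_inv _ (by rw [((hRV z x hx).1).2]; exact isUnit_one), Matrix.one_mulVec,
      Matrix.one_mulVec] at h1
  have hehiso : ∀ z, ∀ x ∈ V z, (eh z x).IsInvertible := by
    intro z x hx
    refine isInvertible_of_injective (by simp) ((injective_iff_map_eq_zero (eh z x)).2 fun w hw => ?_)
    obtain ⟨v, hv, hv0⟩ := IsKKCoframe.exists_horizontal B hθ (hVU z hx) w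
    have h1 : kkCoframe B θ eh Φ z (B.sec (i z) x) v = 0 := by
      rw [hKK z _ (hmem hx), hv0, map_zero]
      have h2 : eh z (B.proj (B.sec (i z) x))
          (mfderiv (𝓡 (m + 1 + k)) (𝓡 (m + 1)) B.proj (B.sec (i z) x) v) = 0 :=
        (congrArg (eh z (B.proj (B.sec (i z) x))) hv).trans
          (((eh z).congr_point (B.proj_sec _ x (hVU z hx)) w).trans hw)
      rw [h2]
      funext s; cases s <;> rfl
    have h2 := (hiso z x hx).injective (h1.trans (map_zero _).symm)
    exact hv.symm.trans ((congrArg (mfderiv (𝓡 (m + 1 + k)) (𝓡 (m + 1)) B.proj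
      (B.sec (i z) x)) h2).trans (map_zero _))
  have hgauge : GaugeEquivalent (minkowskiSum m k) W e (fun x => B.proj ⁻¹' V x)
      (kkCoframe B θ eh Φ) := by
    intro c z p hp
    have key : ∀ (x : X) (g : G), x ∈ V z → ∀ q, q = g • B.sec (i z) x → q ∈ W c →
        ∃ r ∈ SO (minkowskiSum m k), ∀ v, kkCoframe B θ eh Φ z q v = r.mulVec (e c q v) := by
      rintro x g hx _ rfl hq
      -- Translation by `g` changes `e` by `T` and leaves the new coframe unchanged, so at the
      -- translated point the gauge transformation is `R⁻¹ T⁻¹`.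
      obtain ⟨T, hT, hTe⟩ := exists_translate_eq_mulVec B.contMDiff_smul
        (minkowskiSum_transpose m k) (isUnit_det_minkowskiSum m k) he hK (hVW z x hx) hq
      have htr := fun v => hKK.translate_eq hθ (p := B.sec (i z) x) (hmem hx) v g
      have hsurj : Function.Surjective
          (mfderiv (𝓡 (m + 1 + k)) (𝓡 (m + 1 + k)) (fun q : P => g • q) (B.sec (i z) x)) := by
        have h1 : ∀ L : EuclideanSpace ℝ (Fin (m + 1 + k)) →L[ℝ] EuclideanSpace ℝ (Fin (m + 1 + k)),
            Function.Injective L → Function.Surjective L := fun L hL =>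
          (LinearMap.injective_iff_surjective (f := L.toLinearMap)).1 hL
        refine h1 _ fun v v' hv => (hiso z x hx).injective ?_
        exact (htr v).symm.trans
          ((congrArg (kkCoframe B θ eh Φ z (g • B.sec (i z) x)) hv).trans (htr v'))
      refine ⟨(R z x)⁻¹ * T⁻¹, SO.mul_mem (SO.inv_mem (hRV z x hx).1) (SO.inv_mem hT), fun v => ?_⟩
      obtain ⟨v, rfl⟩ := hsurj v
      refine (htr v).trans ((hsec z x hx v).trans ?_)
      refine Eq.trans ?_ (congrArg (Matrix.mulVec _) (hTe v)).symm
      rw [Matrix.mulVec_mulVec, Matrix.mul_assoc, SO.inv_mul hT, Matrix.mul_one]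
    exact key (B.proj p) (B.triv (i z) p) hp.2 p (B.triv_smul_sec _ p (hVU z hp.2)).symm hp.1
  refine ⟨V, kkCoframe B θ eh Φ, hKK.isPartiallyGaugeFixed hθ hV (fun x => ⟨x, hxV x⟩) heh hehiso hΦ
    hdet fun z z' p hz hz' => ?_, hgauge⟩
  -- Two representatives of the new coframe are compared through a common representative of `e`.
  obtain ⟨c, hc⟩ := he.cover p
  obtain ⟨r, hr, hre⟩ := hgauge c z p ⟨hc, hz⟩
  obtain ⟨r', hr', hre'⟩ := hgauge c z' p ⟨hc, hz'⟩
  refine ⟨r' * r⁻¹, SO.mul_mem hr' (SO.inv_mem hr), fun v => ?_⟩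
  rw [hre, hre', Matrix.mulVec_mulVec, Matrix.mul_assoc, SO.inv_mul hr, Matrix.mul_one]

end Bundle
end KaluzaKlein

end

theorem mainTheorem6 {k m : ℕ} {G P X ι A A' : Type*}
    [TopologicalSpace G] [ChartedSpace (EuclideanSpace ℝ (Fin k)) G] [CommGroup G]
    [LieGroup (𝓡 k) ∞ G] [ConnectedSpace G]
    [TopologicalSpace P] [ChartedSpace (EuclideanSpace ℝ (Fin (m + 1 + k))) P]
    [IsManifold (𝓡 (m + 1 + k)) ∞ P] [MulAction G P]
    [TopologicalSpace X] [ChartedSpace (EuclideanSpace ℝ (Fin (m + 1))) X]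
    [IsManifold (𝓡 (m + 1)) ∞ X]
    (B : KaluzaKlein.PrincipalBundle k m G P X ι)
    (b : Module.Basis (Fin k) ℝ (KaluzaKlein.LieAlg k)) :
    -- every Kosmann-invariant coframe with spacelike fibres has a partially gauge-fixed form
    (∀ (W : A' → Set P)
        (e : A' → KaluzaKlein.OneForm (m + 1 + k) P (Fin (m + 1) ⊕ Fin k → ℝ)),
      KaluzaKlein.IsCoframe (KaluzaKlein.minkowskiSum m k) W e →
      KaluzaKlein.KosmannInvariant G W e → KaluzaKlein.SpacelikeFibers G W e →
      ∃ (V : X → Set X)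
        (e' : X → KaluzaKlein.OneForm (m + 1 + k) P (Fin (m + 1) ⊕ Fin k → ℝ)),
        KaluzaKlein.IsPartiallyGaugeFixed B b V e' ∧
        KaluzaKlein.GaugeEquivalent (KaluzaKlein.minkowskiSum m k) W e
          (fun x => B.proj ⁻¹' V x) e') ∧
    -- every partially gauge-fixed coframe is Kosmann-invariant with spacelike fibres, and encodes
    -- a unique collection of fields on the base
    (∀ (V : A → Set X)
        (e : A → KaluzaKlein.OneForm (m + 1 + k) P (Fin (m + 1) ⊕ Fin k → ℝ)),
      KaluzaKlein.IsPartiallyGaugeFixed B b V e →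
      KaluzaKlein.KosmannInvariant G (fun a => B.proj ⁻¹' V a) e ∧
      KaluzaKlein.SpacelikeFibers G (fun a => B.proj ⁻¹' V a) e ∧
      ∃ F : KaluzaKlein.KKFields k m X ι A,
        KaluzaKlein.IsKKFields B b V F ∧ KaluzaKlein.Encodes B V e F ∧
        ∀ F' : KaluzaKlein.KKFields k m X ι A,
          KaluzaKlein.Encodes B V e F' → KaluzaKlein.KKFields.Agree B V F F') ∧
    -- every collection of fields on the base is encoded by a unique partially gauge-fixed coframe
    (∀ (V : A → Set X) (F : KaluzaKlein.KKFields k m X ι A),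
      KaluzaKlein.IsKKFields B b V F →
      ∃ e : A → KaluzaKlein.OneForm (m + 1 + k) P (Fin (m + 1) ⊕ Fin k → ℝ),
        KaluzaKlein.IsPartiallyGaugeFixed B b V e ∧ KaluzaKlein.Encodes B V e F ∧
        ∀ e' : A → KaluzaKlein.OneForm (m + 1 + k) P (Fin (m + 1) ⊕ Fin k → ℝ),
          KaluzaKlein.Encodes B V e' F →
          ∀ (a : A) (p : P), B.proj p ∈ V a → e' a p = e a p) ∧
    -- the fields transform as expected under local `G × SO(1,m) × SO(k)`-transformations
    (∀ (V : A → Set X)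
        (e : A → KaluzaKlein.OneForm (m + 1 + k) P (Fin (m + 1) ⊕ Fin k → ℝ))
        (F : KaluzaKlein.KKFields k m X ι A),
      KaluzaKlein.IsPartiallyGaugeFixed B b V e → KaluzaKlein.Encodes B V e F →
      (∀ (u : X → G) (Λ : A → X → Matrix (Fin (m + 1)) (Fin (m + 1)) ℝ)
          (R : X → Matrix (Fin k) (Fin k) ℝ),
        ContMDiff (𝓡 (m + 1)) (𝓡 k) ∞ u →
        (∀ a i j, ContMDiffOn (𝓡 (m + 1)) 𝓘(ℝ, ℝ) ∞ (fun x => Λ a x i j) (V a)) →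
        (∀ a, ∀ x ∈ V a, Λ a x ∈ KaluzaKlein.SO (KaluzaKlein.minkowski m)) →
        (∀ i j, ContMDiff (𝓡 (m + 1)) 𝓘(ℝ, ℝ) ∞ (fun x => R x i j)) →
        (∀ x, R x ∈ KaluzaKlein.SO (1 : Matrix (Fin k) (Fin k) ℝ)) →
        KaluzaKlein.IsPartiallyGaugeFixed B b V (KaluzaKlein.transformCoframe B u Λ R e) ∧
        KaluzaKlein.Encodes B V (KaluzaKlein.transformCoframe B u Λ R e)
          (KaluzaKlein.KKFields.transform u Λ R F)) ∧
      (∀ (u : ι → X → G)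
          (hu : ∀ i, ContMDiffOn (𝓡 (m + 1)) (𝓡 k) ∞ (u i) (B.U i)),
        KaluzaKlein.Encodes (B.changeSections u hu) V e
          (KaluzaKlein.KKFields.changeSections u F))) := by
  refine ⟨fun W e he hK hS => KaluzaKlein.exists_isPartiallyGaugeFixed b B he hK hS,
    fun V e h => ⟨h.kosmannInvariant, h.spacelikeFibers, h.exists_encodes⟩,
    fun V F h => h.exists_encodes, fun V e F h hF =>
      ⟨fun u Λ R hu hΛ hΛSO hR hRSO => h.transform hF hu hΛ hΛSO
        (fun i j => (hR i j).contMDiffOn) hRSO, fun u hu => hF.changeSections hu⟩⟩
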